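/- Let $Y$ be a compact connected Riemann surface. Let $\{E,\mathcal P\}$ be a special parabolic bundle on $Y$: a holomorphic rank two bundle $E$ with a fixed isomorphism $\det E\cong\mathcal O_Y$, a real divisor $\sum_i\alpha_iP_i$ with distinct $P_i$ and $0<\alpha_i<1$, and a line $W_i\subset E_{P_i}$ for each $i$; put $D=\sum_i P_i$ ($D=0$ is allowed). The parabolic degree of a holomorphic line subbundle $N\subset E$ is $\deg N+\frac12\sum_i\gamma_i$, where $\gamma_i=\alpha_i$ if $N_{P_i}=W_i$ and $\gamma_i=-\alpha_i$ otherwise; $\{E,\mathcal P\}$ is stable if every $N$ has negative parabolic degree. Let $\nabla$ be an associated singular connection: a connection on $E|_{Y\setminus D}$ which is a flat $SU(2)$-connection (near each point there are holomorphic parallel frames $e_1,e_2$ with $e_1\wedge e_2=1$, orthonormal for a fixed hermitian metric on $E|_{Y\setminus D}$), with at most simple poles along $D$, and whose residue at $P_i$ has eigenvalues $\pm\alpha_i/2$, with $W_i$ the eigenspace of $\alpha_i/2$. Let $L$ be a holomorphic line bundle on $Y$, let $\mathbb G$ be the Grassmannian of $2$-planes in $H^0(Y,E(L))$, $E(L)=E\otimes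 L$, and let $\mathbb Q\subset\mathbb P(H^0(Y,L^2))$ be the locus of classes $(\sigma^2)$, $0\ne\sigma\in H^0(Y,L)$. A plane $\Pi=\mathrm{span}(v,w)\in\mathbb G$ is special if $v\wedge w=\sigma^2$ for some $0\neq\sigma\in H^0(Y,L)$; on the locus $\mathcal G$ of special planes put $\varrho(\Pi)=(v\wedge w)\in\mathbb Q$. Let $\Upsilon_\varrho\subset\mathbb G\times\mathbb Q$ be the graph of $\varrho$, $\Upsilon$ its Zariski closure in $\mathbb G\times\mathbb Q$, and $\Upsilon_0=\Upsilon\setminus\Upsilon_\varrho$. Let $\mathcal M\subset\mathbb G$ be the locus of $\mathcal B$-planes: the special planes $\mathrm{span}(v,w)$, $v\wedge w=\sigma^2$ with $\sigma\ne0$, such that $\sigma^2\,\nabla(v/\sigma)\wedge\nabla(w/\sigma)=0$. Let $\widetilde M$ be the line bundle on $\Upsilon$ whose fibre at $(\Pi,(\sigma^2))$ is $\bigwedge^2\Pi$, and let $\Lambda$ be the bundle map from $\widetilde M$ to the trivial bundle with fibre $H^0(Y,\omega_Y^2L^2(2D))$ which at $(\Pi,(\sigma^2))$ is $$v\wedge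 w\longmapsto \sigma^2\,\nabla(v/\sigma)\wedge\nabla(w/\sigma).$$ Let $Z_\Lambda\subset\Upsilon$ be its zero locus. **Lemma.** Assume that $\{E,\mathcal P\}$ is stable. Then $\Lambda$ is well defined (there is a unique family of linear maps on the fibres given by the formula above, at the points of $Y\setminus D$ where $\sigma\neq0$), and $Z_\Lambda\cap\Upsilon_0=\emptyset$. In particular, the projection $\mathbb G\times\mathbb Q\to\mathbb G$ restricts to an isomorphism of algebraic sets (a bijection that, together with its inverse, is continuous for the Zariski topology and pulls back regular functions to regular functions) between $Z_\Lambda$ and $\mathcal M$. -/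

import Mathlib

open Bundle Topology Filter
open scoped Manifold ContDiff TensorProduct LinearAlgebra.Projectivization

noncomputable section

namespace CMCOne

/-! ## Regular functions and the Zariski topology on quotients of sets of vectors

The Grassmannian of planes in `V` and the projective space of `H` are presented as quotients
`pr : U → X` of a set `U` of vectors in a vector space `A` (bases of planes, nonzero vectors).
These quotient maps have local algebraic sections, so closed sets and regular functions on `X` are
those whose pullbacks to `U` are closed, resp. regular. -/

section Zariski

/-- Polynomial functions on a complex vector space: they are generated by the homogeneous ones,
`a ↦ m (a, …, a)` with `m` multilinear. -/
def polyFun (A : Type*) [AddCommGroup A] [Module ℂ A] : Subalgebra ℂ (A → ℂ) :=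
  Algebra.adjoin ℂ {p | ∃ (n : ℕ) (m : MultilinearMap ℂ (fun _ : Fin n => A) ℂ),
    p = fun a => m fun _ => a}

/-- The Zariski topology of a complex vector space. -/
@[reducible] def zariskiSpace (A : Type*) [AddCommGroup A] [Module ℂ A] : TopologicalSpace A :=
  TopologicalSpace.generateFrom {O | ∃ p ∈ polyFun A, O = {a | p a ≠ 0}}

variable {A X A' X' : Type*} [AddCommGroup A] [Module ℂ A] [AddCommGroup A'] [Module ℂ A']
  {U : Set A} {U' : Set A'}

/-- The Zariski topology on the target of `pr : U → X`. -/
@[reducible] def zariskiQuot (pr : U → X) : TopologicalSpace X :=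
  TopologicalSpace.coinduced pr (TopologicalSpace.induced Subtype.val (zariskiSpace A))

/-- The Zariski topology on a subset of the target of `pr : U → X`. -/
@[reducible] def zariskiSub (pr : U → X) (Z : Set X) : TopologicalSpace Z :=
  TopologicalSpace.induced Subtype.val (zariskiQuot pr)

/-- The function `f` on `Z ⊆ X` is regular on the open subset `O` of `Z` if it is locally there a
quotient of polynomial functions. -/
def IsRegularOn (pr : U → X) {Z : Set X} (O : Set Z) (f : Z → ℂ) : Prop :=
  ∀ (u₀ : U) (h₀ : pr u₀ ∈ Z), (⟨pr u₀, h₀⟩ : Z) ∈ O →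
    ∃ p ∈ polyFun A, ∃ q ∈ polyFun A, q u₀ ≠ 0 ∧
      ∀ (u : U) (h : pr u ∈ Z), (⟨pr u, h⟩ : Z) ∈ O → q u ≠ 0 → f ⟨pr u, h⟩ = p u / q u

/-- `e : Z ≃ Z'` is an isomorphism of algebraic sets (with the reduced structure): a homeomorphism
for the Zariski topologies that identifies the regular functions on open subsets. -/
structure IsBiregular (pr : U → X) (pr' : U' → X') {Z : Set X} {Z' : Set X'} (e : Z ≃ Z') :
    Prop where
  isOpen_iff : ∀ O : Set Z', IsOpen[zariskiSub pr' Z'] O ↔ IsOpen[zariskiSub pr Z] (e ⁻¹' O)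
  isRegularOn_iff : ∀ O : Set Z', IsOpen[zariskiSub pr' Z'] O → ∀ f : Z' → ℂ,
    (IsRegularOn pr' O f ↔ IsRegularOn pr (e ⁻¹' O) (f ∘ e))

end Zariski

/-! ## Holomorphic bundles on a Riemann surface -/

section Bundles

variable {Y : Type*} [TopologicalSpace Y] [ChartedSpace ℂ Y]

/-- The preferred local coordinate centred at `x₀`. -/
def coord (x₀ x : Y) : ℂ := chartAt ℂ x₀ x - chartAt ℂ x₀ x₀

/-- Its differential at `x`. -/
def dcoord (x₀ x : Y) (ξ : TangentSpace 𝓘(ℂ, ℂ) x) : ℂ :=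
  mfderiv 𝓘(ℂ, ℂ) 𝓘(ℂ, ℂ) (coord x₀) x ξ

/-- The section `s` of `V` is holomorphic near `x₀`. -/
def HolAt (F : Type*) [NormedAddCommGroup F] [NormedSpace ℂ F] {V : Y → Type*}
    [TopologicalSpace (TotalSpace F V)] [∀ x, TopologicalSpace (V x)] [FiberBundle F V]
    (s : ∀ x, V x) (x₀ : Y) : Prop :=
  ContMDiffAt 𝓘(ℂ, ℂ) (𝓘(ℂ, ℂ).prod 𝓘(ℂ, F)) ω (fun x => TotalSpace.mk' F x (s x)) x₀

/-- The function `f` is holomorphic near `x₀`. -/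
def HolFunAt (f : Y → ℂ) (x₀ : Y) : Prop := ContMDiffAt 𝓘(ℂ, ℂ) 𝓘(ℂ, ℂ) ω f x₀

section RankTwo

variable (E : Y → Type*) [∀ x, AddCommGroup (E x)] [∀ x, Module ℂ (E x)]
  [∀ x, TopologicalSpace (E x)] [TopologicalSpace (TotalSpace (Fin 2 → ℂ) E)]
  [FiberBundle (Fin 2 → ℂ) E]

/-- A special parabolic structure on the rank two bundle `E`: a holomorphic trivialization
`e ∧ e' ↦ vol e e'` of `det E`, a real weight divisor with coefficients in `(0, 1)` (its support is
the parabolic divisor), and a line in the fibre over each point of the support. -/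
structure SpecialParabolic where
  vol : ∀ x, E x →ₗ[ℂ] E x →ₗ[ℂ] ℂ
  vol_self : ∀ x e, vol x e e = 0
  vol_ne_zero : ∀ x, vol x ≠ 0
  vol_hol : ∀ (s t : ∀ x, E x) (x₀ : Y), HolAt (Fin 2 → ℂ) s x₀ → HolAt (Fin 2 → ℂ) t x₀ →
    HolFunAt (fun x => vol x (s x) (t x)) x₀
  weight : Y →₀ ℝ
  weight_mem : ∀ P ∈ weight.support, 0 < weight P ∧ weight P < 1
  W : ∀ P, Submodule ℂ (E P)
  finrank_W : ∀ P ∈ weight.support, Module.finrank ℂ (W P) = 1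

variable {E}

/-- `N` is a holomorphic line subbundle of `E`. -/
def IsLineSubbundle (N : ∀ x, Submodule ℂ (E x)) : Prop :=
  ∀ x₀, ∃ e : ∀ x, E x, HolAt (Fin 2 → ℂ) e x₀ ∧ e x₀ ≠ 0 ∧
    ∀ᶠ x in 𝓝 x₀, N x = Submodule.span ℂ {e x}

/-- The line subbundle `N` has degree `d`: it has a nonzero meromorphic section `s` whose divisor
`n` has degree `d`. Near each point `s = z ^ n • e`, with `e` a local holomorphic frame of `N`. -/
def HasDegree (N : ∀ x, Submodule ℂ (E x)) (d : ℤ) : Prop :=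
  ∃ (s : ∀ x, E x) (n : Y →₀ ℤ),
    (∀ x₀, ∃ e : ∀ x, E x, HolAt (Fin 2 → ℂ) e x₀ ∧ e x₀ ≠ 0 ∧ (∀ᶠ x in 𝓝 x₀, e x ∈ N x) ∧
      ∀ᶠ x in 𝓝[≠] x₀, s x = coord x₀ x ^ n x₀ • e x) ∧
    n.sum (fun _ k => k) = d

open scoped Classical in
/-- The parabolic degree of a line subbundle `N` of degree `d`. -/
def SpecialParabolic.parDegree (B : SpecialParabolic E) (N : ∀ x, Submodule ℂ (E x)) (d : ℤ) : ℝ :=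
  d + 1 / 2 * B.weight.sum fun P a => if N P = B.W P then a else -a

/-- Parabolic stability. -/
def SpecialParabolic.IsStable (B : SpecialParabolic E) : Prop :=
  ∀ (N : ∀ x, Submodule ℂ (E x)) (d : ℤ), IsLineSubbundle N → HasDegree N d →
    B.parDegree N d < 0

/-- `nabla` maps sections that are holomorphic near `P` to `E`-valued forms with at most a simple
pole at `P`, and has residue `Γ` there. -/
def HasLogPole (nabla : (∀ x, E x) → ∀ x, TangentSpace 𝓘(ℂ, ℂ) x →L[ℂ] E x) (P : Y)
    (Γ : Module.End ℂ (E P)) : Prop :=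
  ∀ s : ∀ x, E x, HolAt (Fin 2 → ℂ) s P → ∃ r : ∀ x, E x, HolAt (Fin 2 → ℂ) r P ∧
    r P = Γ (s P) ∧
    ∀ᶠ x in 𝓝[≠] P, ∀ ξ, coord P x • nabla s x ξ = dcoord P x ξ • r x

/-- `nabla` is a singular connection on `E` whose restriction to the complement of the parabolic
divisor is an `SU(2)` flat connection, and the parabolic bundle attached to it is `(E, B)`.
Here `nabla s x ξ` is the derivative of `s` at `x` in the direction `ξ`. -/
structure SpecialParabolic.IsAssociated [∀ x, IsTopologicalAddGroup (E x)]
    [∀ x, ContinuousSMul ℂ (E x)] (B : SpecialParabolic E)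
    (nabla : (∀ x, E x) → ∀ x, TangentSpace 𝓘(ℂ, ℂ) x →L[ℂ] E x) : Prop where
  /-- a connection away from the parabolic divisor -/
  isCov : IsCovariantDerivativeOn (Fin 2 → ℂ) nabla {x | x ∉ B.weight.support}
  /-- with local holomorphic parallel frames that are special unitary for a hermitian metric `h` -/
  isSU2 : ∃ h : ∀ x, E x →ₗ⋆[ℂ] E x →ₗ[ℂ] ℂ, ∀ x₀ ∉ B.weight.support, ∃ e₁ e₂ : ∀ x, E x,
    HolAt (Fin 2 → ℂ) e₁ x₀ ∧ HolAt (Fin 2 → ℂ) e₂ x₀ ∧ ∀ᶠ x in 𝓝 x₀,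
      nabla e₁ x = 0 ∧ nabla e₂ x = 0 ∧ B.vol x (e₁ x) (e₂ x) = 1 ∧
      h x (e₁ x) (e₁ x) = 1 ∧ h x (e₂ x) (e₂ x) = 1 ∧
      h x (e₁ x) (e₂ x) = 0 ∧ h x (e₂ x) (e₁ x) = 0
  /-- with simple poles along the parabolic divisor; the residue at `P` has eigenvalues `± α / 2`,
  where `α` is the weight, and the parabolic line is the eigenspace of `α / 2` -/
  residue : ∀ P ∈ B.weight.support, ∃ Γ : Module.End ℂ (E P), HasLogPole nabla P Γ ∧
    Γ.HasEigenvalue (-((B.weight P / 2 : ℝ) : ℂ)) ∧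
    B.W P = Γ.eigenspace ((B.weight P / 2 : ℝ) : ℂ)

end RankTwo

/-! ## Sections of `E(L) = E ⊗ L`, of `L²` and of `ω²L²(2D)` -/

section Line

variable (L : Y → Type*) [∀ x, AddCommGroup (L x)] [∀ x, Module ℂ (L x)]
  [∀ x, TopologicalSpace (L x)] [TopologicalSpace (TotalSpace ℂ L)]
  [FiberBundle ℂ L] [VectorBundle ℂ ℂ L]

/-- The fibre coordinate at `x` in the preferred trivialization of `L` near `x₀`. -/
def fiberCoord (x₀ x : Y) : L x →ₗ[ℂ] ℂ :=
  ((trivializationAt ℂ L x₀).continuousLinearMapAt ℂ x).toLinearMap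

/-- The frame of `L` near `x₀` given by the preferred trivialization. -/
def localFrame (x₀ x : Y) : L x := (trivializationAt ℂ L x₀).symm x 1

/-- The fibre coordinate of `L²` at `x` in the preferred trivialization of `L` near `x₀`. -/
def fiberCoordSq (x₀ x : Y) : L x ⊗[ℂ] L x →ₗ[ℂ] ℂ :=
  TensorProduct.lift ((LinearMap.mul ℂ ℂ).compl₁₂ (fiberCoord L x₀ x) (fiberCoord L x₀ x))

/-- `H⁰(Y, L²)`. -/
def HLL : Submodule ℂ (∀ x, L x ⊗[ℂ] L x) where
  carrier := {τ | ∀ x₀, HolFunAt (fun x => fiberCoordSq L x₀ x (τ x)) x₀}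
  zero_mem' := by
    intro x₀
    simpa [HolFunAt] using contMDiffAt_const
  add_mem' := by
    intro a b ha hb x₀
    have := (ha x₀).add (hb x₀)
    simpa [HolFunAt, Pi.add_def] using this
  smul_mem' := by
    intro c a ha x₀
    have := ContMDiffAt.mul (contMDiffAt_const (c := c)) (ha x₀)
    simpa [HolFunAt, Pi.mul_def] using this

/-- `H⁰(Y, ω²L²(2D))`, as holomorphic sections over the complement of `D` with at most double
poles along `D`. Elements of the fibre of `ω²L²` are bilinear maps `T × T → L²`. -/
def HW (D : Finset Y) : Submodule ℂ (∀ x : {x // x ∉ D},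
    TangentSpace 𝓘(ℂ, ℂ) x.1 →ₗ[ℂ] TangentSpace 𝓘(ℂ, ℂ) x.1 →ₗ[ℂ] L x.1 ⊗[ℂ] L x.1) where
  carrier := {η | ∀ x₀, ∃ f : Y → ℂ, HolFunAt f x₀ ∧ ∀ᶠ x in 𝓝 x₀, ∀ (hx : x ∉ D) (ξ ξ' : _),
    coord x₀ x ^ (open scoped Classical in if x₀ ∈ D then 2 else 0) • η ⟨x, hx⟩ ξ ξ' =
      (f x * dcoord x₀ x ξ * dcoord x₀ x ξ') • (localFrame L x₀ x ⊗ₜ localFrame L x₀ x)}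
  zero_mem' := by
    intro x₀
    exact ⟨fun _ => 0, contMDiffAt_const, by simp⟩
  add_mem' := by
    intro a b ha hb x₀
    obtain ⟨f, hf, hf'⟩ := ha x₀
    obtain ⟨g, hg, hg'⟩ := hb x₀
    refine ⟨fun x => f x + g x, ContMDiffAt.add hf hg, ?_⟩
    filter_upwards [hf', hg'] with x h1 h2 hx ξ ξ'
    simp only [Pi.add_apply, LinearMap.add_apply, smul_add, h1 hx ξ ξ', h2 hx ξ ξ', add_mul,
      add_smul]
  smul_mem' := by
    intro c a ha x₀
    obtain ⟨f, hf, hf'⟩ := ha x₀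
    refine ⟨fun x => c * f x, ContMDiffAt.mul contMDiffAt_const hf, ?_⟩
    filter_upwards [hf'] with x h1 hx ξ ξ'
    simp only [Pi.smul_apply, LinearMap.smul_apply, smul_comm _ c, h1 hx ξ ξ']
    simp only [smul_smul, mul_assoc]

variable (E : Y → Type*) [∀ x, AddCommGroup (E x)] [∀ x, Module ℂ (E x)]
  [∀ x, TopologicalSpace (E x)] [TopologicalSpace (TotalSpace (Fin 2 → ℂ) E)]
  [FiberBundle (Fin 2 → ℂ) E] [VectorBundle ℂ (Fin 2 → ℂ) E]

/-- `e ⊗ l ↦ l • e`, where `l` is read in the preferred trivialization of `L` near `x₀`. -/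
def contract (x₀ x : Y) : E x ⊗[ℂ] L x →ₗ[ℂ] E x :=
  (TensorProduct.rid ℂ (E x)).toLinearMap ∘ₗ (fiberCoord L x₀ x).lTensor (E x)

/-- `H⁰(Y, E(L))`. -/
def HEL : Submodule ℂ (∀ x, E x ⊗[ℂ] L x) where
  carrier := {v | ∀ x₀, HolAt (Fin 2 → ℂ) (fun x => contract L E x₀ x (v x)) x₀}
  zero_mem' := by
    intro x₀
    have := (Bundle.contMDiff_zeroSection ℂ E (F := Fin 2 → ℂ) (IB := 𝓘(ℂ, ℂ)) (n := ω)) x₀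
    simpa [HolAt, zeroSection] using! this
  add_mem' := by
    intro a b ha hb x₀
    have := ContMDiffAt.add_section (ha x₀) (hb x₀)
    simpa [HolAt] using! this
  smul_mem' := by
    intro c a ha x₀
    have := ContMDiffAt.const_smul_section (a := c) (ha x₀)
    simpa [HolAt] using! this

variable {L E}

/-- The section `v / σ` of `E` (with value `0` at the zeros of `σ`). -/
def divSection (v : ∀ x, E x ⊗[ℂ] L x) (σ : ∀ x, L x) (x : Y) : E x :=
  (fiberCoord L x x (σ x))⁻¹ • contract L E x x (v x)

/-- The wedge product `E(L) × E(L) → L²` on fibres, where `det E` is trivialized by `vol`. -/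
def wedge (B : SpecialParabolic E) (x : Y) (v w : E x ⊗[ℂ] L x) : L x ⊗[ℂ] L x :=
  TensorProduct.lid ℂ (L x ⊗[ℂ] L x)
    (TensorProduct.map₂ (B.vol x) (TensorProduct.mk ℂ (L x) (L x)) v w)

/-- The value of `σ² ∇(v/σ) ∧ ∇(w/σ)` at `x`, on tangent vectors `ξ, ξ'`. -/
def theta (B : SpecialParabolic E) (nabla : (∀ x, E x) → ∀ x, TangentSpace 𝓘(ℂ, ℂ) x →L[ℂ] E x)
    (σ : ∀ x, L x) (v w : ∀ x, E x ⊗[ℂ] L x) (x : Y) (ξ ξ' : TangentSpace 𝓘(ℂ, ℂ) x) :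
    L x ⊗[ℂ] L x :=
  B.vol x (nabla (divSection v σ) x ξ) (nabla (divSection w σ) x ξ') • (σ x ⊗ₜ σ x)

/-! ## The Grassmannian, the locus `Q` of squares, and the closure `Υ` -/

variable (L E)

/-- The Grassmannian of `2`-planes in `H⁰(Y, E(L))`. -/
abbrev Gr : Type _ := {S : Submodule ℂ (HEL L E) // Module.finrank ℂ S = 2}

/-- `τ = σ²`. -/
def IsSquareOf (τ : HLL L) (σ : Cₛ^ω⟮𝓘(ℂ, ℂ); ℂ, L⟯) : Prop :=
  ∀ x, τ.1 x = σ x ⊗ₜ σ x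

/-- The locus `Q ⊆ ℙ(H⁰(Y, L²))` of squares. -/
abbrev Q : Type _ := {q : ℙ ℂ (HLL L) // ∃ σ : Cₛ^ω⟮𝓘(ℂ, ℂ); ℂ, L⟯, σ ≠ 0 ∧
  ∃ (τ : HLL L) (hτ : τ ≠ 0), IsSquareOf L τ σ ∧ q = Projectivization.mk ℂ τ hτ}

/-- Bases of planes in `H⁰(Y, E(L))`. -/
def grFrames : Set (HEL L E × HEL L E) := {u | LinearIndependent ℂ ![u.1, u.2]}

/-- The plane with a given basis. -/
def grMk (u : grFrames L E) : Gr L E :=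
  ⟨Submodule.span ℂ (Set.range ![u.1.1, u.1.2]), by
    simpa using finrank_span_eq_card u.2⟩

/-- Pairs of a basis of a plane and a nonzero square. -/
def totalFrames : Set ((HEL L E × HEL L E) × HLL L) :=
  {u | u.1 ∈ grFrames L E ∧ u.2 ≠ 0 ∧
    ∃ σ : Cₛ^ω⟮𝓘(ℂ, ℂ); ℂ, L⟯, σ ≠ 0 ∧ IsSquareOf L u.2 σ}

/-- The point of `Gr × Q` given by a basis of a plane and a nonzero square. -/
def totalMk (u : totalFrames L E) : Gr L E × Q L :=
  (grMk L E ⟨u.1.1, u.2.1⟩, ⟨Projectivization.mk ℂ u.1.2 u.2.2.1, by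
    obtain ⟨σ, hσ, h⟩ := u.2.2.2
    exact ⟨σ, hσ, _, u.2.2.1, h, rfl⟩⟩)

variable {L E}

/-- `(v, w)` is a special frame: `v ∧ w = σ²` with `0 ≠ σ ∈ H⁰(Y, L)`. -/
def IsSpecialFrame (B : SpecialParabolic E) (v w : HEL L E) (σ : Cₛ^ω⟮𝓘(ℂ, ℂ); ℂ, L⟯) : Prop :=
  σ ≠ 0 ∧ ∀ x, wedge B x (v.1 x) (w.1 x) = σ x ⊗ₜ σ x

variable (L)

/-- The graph `Υ_ϱ` of `ϱ : span (v, w) ↦ (v ∧ w) = (σ²)` on the locus of special planes. -/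
def upsilonRho (B : SpecialParabolic E) : Set (Gr L E × Q L) :=
  {t | ∃ v w σ, IsSpecialFrame B v w σ ∧ t.1.1 = Submodule.span ℂ {v, w} ∧
    ∃ (τ : HLL L) (hτ : τ ≠ 0), IsSquareOf L τ σ ∧ t.2.1 = Projectivization.mk ℂ τ hτ}

/-- `Υ`, the closure of the graph in `Gr × Q`. -/
def upsilon (B : SpecialParabolic E) : Set (Gr L E × Q L) :=
  @closure _ (zariskiQuot (totalMk L E)) (upsilonRho L B)

/-- The boundary `Υ₀`. -/
def upsilonZero (B : SpecialParabolic E) : Set (Gr L E × Q L) := upsilon L B \ upsilonRho L B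

/-- The locus `𝓜` of `𝓑`-planes: planes spanned by a special frame `(v, w)`, `v ∧ w = σ²`, with
`σ² ∇(v/σ) ∧ ∇(w/σ) = 0`. -/
def bPlanes (B : SpecialParabolic E)
    (nabla : (∀ x, E x) → ∀ x, TangentSpace 𝓘(ℂ, ℂ) x →L[ℂ] E x) : Set (Gr L E) :=
  {S | ∃ v w σ, IsSpecialFrame B v w σ ∧ S.1 = Submodule.span ℂ {v, w} ∧
    ∀ x ∉ B.weight.support, σ x ≠ 0 → ∀ ξ ξ', theta B nabla σ v.1 w.1 x ξ ξ' = 0}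

/-- Families of linear maps from the fibres of `M̃` (the pullback to `Υ` of the second exterior
power of the tautological plane bundle) to the fibre `H⁰(Y, ω²L²(2D))` of the trivial bundle. -/
abbrev BundleMap (B : SpecialParabolic E) : Type _ :=
  ∀ t : upsilon L B, ⋀[ℂ]^2 t.1.1.1 →ₗ[ℂ] HW L B.weight.support

variable {L}

/-- `Λ` is the bundle map `v ∧ w ↦ σ² ∇(v/σ) ∧ ∇(w/σ)` over the point `(S, (σ²))`. -/
def IsLambda (B : SpecialParabolic E)
    (nabla : (∀ x, E x) → ∀ x, TangentSpace 𝓘(ℂ, ℂ) x →L[ℂ] E x) (Λ : BundleMap L B) : Prop :=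
  ∀ (t : upsilon L B) (v w : t.1.1.1) (σ : Cₛ^ω⟮𝓘(ℂ, ℂ); ℂ, L⟯) (τ : HLL L) (hτ : τ ≠ 0),
    IsSquareOf L τ σ → t.1.2.1 = Projectivization.mk ℂ τ hτ →
    ∀ (x : Y) (hx : x ∉ B.weight.support), σ x ≠ 0 → ∀ ξ ξ',
      (Λ t (exteriorPower.ιMulti ℂ 2 ![v, w])).1 ⟨x, hx⟩ ξ ξ' =
        theta B nabla σ v.1.1 w.1.1 x ξ ξ'

/-- The zero locus of a bundle map. -/
def zeroLocus {B : SpecialParabolic E} (Λ : BundleMap L B) : Set (Gr L E × Q L) :=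
  {t | ∃ ht : t ∈ upsilon L B, Λ ⟨t, ht⟩ = 0}

end Line

end Bundles

end CMCOne

end

noncomputable section

set_option linter.unusedSectionVars false

namespace CMCOne

/-! ## Traces along branched coverings of the projective line -/

section Trace

/-! On the graph of `ϱ` the sections `v ∧ w` and `σ²` are proportional. Proportionality is the
vanishing of minors, so it is Zariski closed in a frame of the plane and a representative of `(σ²)`.
Hence at every point of `Υ` one has `v ∧ w = c σ²`, with `c = 0` allowed
(`exists_wedgeHLL_eq_smul`). In local trivializations, where `v`, `w`, `σ` become `V`, `W`, `g`,
compatibility of `∇` with the determinant turns `g² ∇(V/g) ∧ ∇(W/g)` into `∇V ∧ ∇W - c dg²`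
(`vol_nabla_div`). No division is left, so the form extends over the zeros of `σ`, with at most
double poles on `D`; this gives `Λ` (`existsUnique_isLambda`).

Take a zero of `Λ`. If `c ≠ 0`, then `σ` times a square root of `c` makes the plane special, and the
point lies on the graph. If `c = 0`, put `s = v/σ`; then `w/σ = f s` with `f` meromorphic, and
nonconstant because `v` and `w` are independent (`exists_quotient_normalForm`). On a curve `∇s ∧ ∇s
= 0`, so `∇s ∧ ∇(f s) = df (∇s ∧ s)` and vanishing of `Λ` forces `∇s` to be parallel to `s`. The
line subbundle spanned by `s` is thus preserved by `∇`. Its connection form has residue `ord s ±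
α/2` at each point, the sign recording whether the parabolic line is met (`exists_connection_form`).
These residues sum to the parabolic degree, and the residue theorem makes it `0`, against stability
(`exists_parDegree_eq_zero`, `zeroLocus_subset_upsilonRho`).

The residue theorem is proved for forms `h df`, which suffices because `f` above is available.
Summing `h` over the fibres of the branched covering `f` gives a function on the sphere whose
residues are the fibrewise sums of those of `h df` (`sum_eq_zero_of_isNormalForm`), and Liouville's
theorem settles the sphere (`sum_residues_add_eq_zero`).

Finally, since the zero locus lies in the graph, the projection has the inverse `Π ↦ (Π, ϱ(Π))`. On
frames this is the quadratic map `(v, w) ↦ ((v, w), v ∧ w)`, so it is regular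
(`isBiregular_of_lifts`). -/

lemma tendsto_of_differentiableAt_off {K : ℂ → ℂ} {a : ℂ}
    (hd : ∀ᶠ z in 𝓝[≠] a, DifferentiableAt ℂ K z)
    (h0 : Tendsto (fun z => (z - a) * K z) (𝓝[≠] a) (𝓝 0)) :
    ∃ s ∈ 𝓝 a, DifferentiableOn ℂ (Function.update K a (limUnder (𝓝[≠] a) K)) s ∧
      ∀ z ∈ s, z ≠ a → DifferentiableAt ℂ K z := by
  obtain ⟨s, hs, hs'⟩ := eventually_nhdsWithin_iff.1 hd |>.exists_mem
  refine ⟨s, hs, Complex.differentiableOn_update_limUnder_of_isLittleO hs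
    (fun z hz => (hs' z hz.1 hz.2).differentiableWithinAt) ?_, fun z hz hza => hs' z hz hza⟩
  have hne : ∀ᶠ z in 𝓝[≠] a, (z - a)⁻¹ = 0 → K z - K a = 0 := by
    filter_upwards [self_mem_nhdsWithin] with z hz h
    exact absurd (inv_eq_zero.1 h) (sub_ne_zero.2 hz)
  rw [Asymptotics.isLittleO_iff_tendsto' hne]
  have h1 : Tendsto (fun z => (z - a) * K a) (𝓝[≠] a) (𝓝 0) := by
    have : Tendsto (fun z : ℂ => (z - a) * K a) (𝓝 a) (𝓝 ((a - a) * K a)) :=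
      (Continuous.tendsto (by fun_prop) a)
    simpa using this.mono_left nhdsWithin_le_nhds
  have := h0.sub h1
  simp only [sub_zero] at this
  refine this.congr fun z => ?_
  rw [div_inv_eq_mul]; ring

/-- A function on the plane with isolated singularities that are at most simple poles and that
vanishes at infinity has residues summing to minus the residue at infinity. -/
lemma sum_residues_add_eq_zero {H : ℂ → ℂ} {S : Finset ℂ} {r : ℂ → ℂ} {r' : ℂ}
    (hS : ∀ a ∉ S, r a = 0)
    (hd : ∀ a, ∀ᶠ z in 𝓝[≠] a, DifferentiableAt ℂ H z)
    (hr : ∀ a, Tendsto (fun z => (z - a) * H z) (𝓝[≠] a) (𝓝 (r a)))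
    (hr' : Tendsto (fun z => z * H z) (cocompact ℂ) (𝓝 (-r'))) :
    ∑ a ∈ S, r a + r' = 0 := by
  classical
  -- Subtracting all the principal parts leaves only removable singularities.
  set K : ℂ → ℂ := fun z => H z - ∑ a ∈ S, r a / (z - a) with hK
  have hdK : ∀ a, ∀ᶠ z in 𝓝[≠] a, DifferentiableAt ℂ K z := by
    intro a
    have : ∀ᶠ z in 𝓝[≠] a, z ∉ S := by
      have h2 : ∀ᶠ z in 𝓝[≠] a, z ∉ S.erase a :=
        nhdsWithin_le_nhds ((S.erase a).finite_toSet.isClosed.isOpen_compl.mem_nhds (by simp))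
      filter_upwards [h2, self_mem_nhdsWithin] with z hz hza hzS
      exact hz (Finset.mem_erase.2 ⟨hza, hzS⟩)
    filter_upwards [hd a, this] with z hz hzS
    refine hz.sub (DifferentiableAt.fun_sum fun b hb => ?_)
    have : z - b ≠ 0 := sub_ne_zero.2 fun h => hzS (h ▸ hb)
    exact (differentiableAt_const _).div (by fun_prop) this
  have hK0 : ∀ a, Tendsto (fun z => (z - a) * K z) (𝓝[≠] a) (𝓝 0) := by
    intro a
    have h1 : ∀ b ∈ S, Tendsto (fun z => (z - a) * (r b / (z - b))) (𝓝[≠] a)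
        (𝓝 (if b = a then r a else 0)) := by
      intro b _
      split_ifs with hba
      · subst hba
        refine tendsto_const_nhds.congr' ?_
        filter_upwards [self_mem_nhdsWithin] with z hz
        have : z - b ≠ 0 := sub_ne_zero.2 hz
        field_simp
      · have hc : ContinuousAt (fun z => (z - a) * (r b / (z - b))) a := by
          have : a - b ≠ 0 := sub_ne_zero.2 (Ne.symm hba)
          fun_prop (disch := assumption)
        have := hc.tendsto.mono_left (nhdsWithin_le_nhds (s := {a}ᶜ))
        simpa using this
    have h2 := (hr a).sub (tendsto_finsetSum S h1)
    have h3 : r a - ∑ b ∈ S, (if b = a then r a else 0) = 0 := by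
      rw [Finset.sum_ite_eq']
      split_ifs with h
      · simp
      · simp [hS a h]
    rw [h3] at h2
    refine h2.congr fun z => ?_
    rw [hK, mul_sub, Finset.mul_sum]
  have hinv : Tendsto (fun z : ℂ => z⁻¹) (cocompact ℂ) (𝓝 0) := by
    rw [← Metric.cobounded_eq_cocompact]; exact tendsto_inv₀_cobounded
  have hKinf : Tendsto (fun z => z * K z) (cocompact ℂ) (𝓝 (-r' - ∑ a ∈ S, r a)) := by
    have h1 : ∀ b ∈ S, Tendsto (fun z => z * (r b / (z - b))) (cocompact ℂ) (𝓝 (r b)) := by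
      intro b _
      have h0 : Tendsto (fun z : ℂ => z - b) (cocompact ℂ) (cocompact ℂ) :=
        (Homeomorph.subRight b).isClosedEmbedding.tendsto_cocompact
      have h2 : Tendsto (fun z : ℂ => (z - b)⁻¹) (cocompact ℂ) (𝓝 0) :=
        hinv.comp h0
      have h3 : Tendsto (fun z : ℂ => r b + r b * b * (z - b)⁻¹) (cocompact ℂ) (𝓝 (r b)) := by
        simpa using tendsto_const_nhds.add (h2.const_mul (r b * b))
      refine h3.congr' ?_
      have h4 : ∀ᶠ z in cocompact ℂ, z ≠ b := by
        have := (isCompact_singleton (x := b)).compl_mem_cocompact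
        filter_upwards [this] with z hz using hz
      filter_upwards [h4] with z hz
      have : z - b ≠ 0 := sub_ne_zero.2 hz
      field_simp
      ring
    refine (hr'.sub (tendsto_finsetSum S h1)).congr fun z => ?_
    rw [hK, mul_sub, Finset.mul_sum]
  -- The values of `K` at its isolated singularities carry no information; replacing every value by
  -- the punctured limit gives an entire function that agrees with `K` wherever `K` is
  -- differentiable.
  set G : ℂ → ℂ := fun a => limUnder (𝓝[≠] a) K with hG
  have hlim : ∀ z, DifferentiableAt ℂ K z → G z = K z := fun z hz =>
    (hz.continuousAt.tendsto.mono_left nhdsWithin_le_nhds).limUnder_eq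
  have hGd : ∀ a, DifferentiableAt ℂ G a ∧ Tendsto K (𝓝[≠] a) (𝓝 (G a)) := by
    intro a
    obtain ⟨s, hs, hds, hs'⟩ := tendsto_of_differentiableAt_off (hdK a) (hK0 a)
    have hd1 := hds.differentiableAt hs
    have heq : G =ᶠ[𝓝 a] Function.update K a (limUnder (𝓝[≠] a) K) := by
      filter_upwards [hs] with z hz
      by_cases hza : z = a
      · subst hza; simp [hG]
      · rw [Function.update_of_ne hza, hlim z (hs' z hz hza)]
    refine ⟨hd1.congr_of_eventuallyEq heq, ?_⟩
    have h1 : Tendsto (Function.update K a (limUnder (𝓝[≠] a) K)) (𝓝[≠] a) (𝓝 (G a)) := by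
      have := hd1.continuousAt.tendsto.mono_left (nhdsWithin_le_nhds (s := {a}ᶜ))
      simpa [hG] using this
    refine h1.congr' ?_
    filter_upwards [self_mem_nhdsWithin] with z hz
    rw [Function.update_of_ne hz]
  have hK0' : Tendsto K (cocompact ℂ) (𝓝 0) := by
    have h3 := hinv.mul hKinf
    rw [zero_mul] at h3
    refine h3.congr' ?_
    have h4 : ∀ᶠ z in cocompact ℂ, z ≠ (0 : ℂ) := by
      filter_upwards [(isCompact_singleton (x := (0 : ℂ))).compl_mem_cocompact] with z hz using hz
    filter_upwards [h4] with z hz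
    field_simp
  have hG0 : Tendsto G (cocompact ℂ) (𝓝 0) := by
    rw [Metric.tendsto_nhds]
    intro ε hε
    have h1 : ∀ᶠ z in cocompact ℂ, ‖K z‖ ≤ ε / 2 := by
      have := (Metric.tendsto_nhds.1 hK0') (ε / 2) (by positivity)
      filter_upwards [this] with z hz
      simpa using hz.le
    rw [← Metric.cobounded_eq_cocompact] at h1 ⊢
    obtain ⟨R, -, hR⟩ := (Metric.hasBasis_cobounded_compl_closedBall (0 : ℂ)).eventually_iff.1 h1
    refine (Metric.hasBasis_cobounded_compl_closedBall (0 : ℂ)).eventually_iff.2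
      ⟨R, trivial, fun z hz => ?_⟩
    have hnear : ∀ᶠ y in 𝓝[≠] z, ‖K y‖ ≤ ε / 2 :=
      nhdsWithin_le_nhds (by
        filter_upwards [Metric.isClosed_closedBall.isOpen_compl.mem_nhds hz] with y hy using hR hy)
    have := le_of_tendsto (hGd z).2.norm hnear
    simp only [dist_zero_right]
    linarith
  have hGz : ∀ z, G z = 0 := fun z =>
    Differentiable.apply_eq_of_tendsto_cocompact (fun a => (hGd a).1) z hG0
  -- By Liouville `G = 0`, yet a nonzero limit of `z K(z)` at infinity would make `K` nonzero far
  -- out. The point `a` is built from `|R| + 1` because `R` may be negative.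
  by_contra hne
  have hl : -r' - ∑ a ∈ S, r a ≠ 0 := fun h => hne (by linear_combination -h)
  have hev := hKinf.eventually_ne hl
  rw [← Metric.cobounded_eq_cocompact] at hev
  obtain ⟨R, -, hR⟩ := (Metric.hasBasis_cobounded_compl_closedBall (0 : ℂ)).eventually_iff.1 hev
  set a : ℂ := ((|R| + 1 : ℝ) : ℂ) with ha
  have hmem : a ∈ (Metric.closedBall (0 : ℂ) R)ᶜ := by
    simp only [Set.mem_compl_iff, Metric.mem_closedBall, dist_zero_right, ha, Complex.norm_real,
      Real.norm_eq_abs, not_le]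
    rw [abs_of_pos (by positivity)]
    linarith [le_abs_self R]
  have h5 : ∀ᶠ z in 𝓝[≠] a, z * K z ≠ 0 :=
    nhdsWithin_le_nhds (by
      filter_upwards [Metric.isClosed_closedBall.isOpen_compl.mem_nhds hmem] with y hy using hR hy)
  obtain ⟨z, hz, hz'⟩ := (h5.and (hdK a)).exists
  exact hz (by rw [← hlim z hz', hGz, mul_zero])

/-- The sum of the values of `k` at the `m`-th roots of `w`. -/
def rootTrace (m : ℕ) (k : ℂ → ℂ) (w : ℂ) : ℂ := ∑ u ∈ Polynomial.nthRootsFinset m w, k u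

/-- The other roots are the multiples of one root by powers of a primitive root of unity. Only one
branch of the root then has to be controlled. -/
lemma rootTrace_eq {m : ℕ} (hm : m ≠ 0) (k : ℂ → ℂ) {u w : ℂ} (hu : u ^ m = w) (hw : w ≠ 0) :
    rootTrace m k w =
      ∑ j ∈ Finset.range m, k (Complex.exp (2 * Real.pi * Complex.I / m) ^ j * u) := by
  classical
  have hp := Complex.isPrimitiveRoot_exp m hm
  set μ := Complex.exp (2 * Real.pi * Complex.I / m)
  have hu0 : u ≠ 0 := by rintro rfl; exact hw (by rw [← hu, zero_pow hm])
  have hset : Polynomial.nthRootsFinset m w = (Finset.range m).image fun j => μ ^ j * u := by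
    ext x
    rw [Polynomial.nthRootsFinset, Multiset.mem_toFinset, hp.nthRoots_eq hu]
    simp
  rw [rootTrace, hset, Finset.sum_image]
  intro i hi j hj hij
  exact hp.pow_inj (Finset.mem_range.1 hi) (Finset.mem_range.1 hj) (mul_right_cancel₀ hu0 hij)

lemma tendsto_norm_of_pow_eq {m : ℕ} (hm : m ≠ 0) {ε : ℝ} (hε : 0 < ε) :
    ∀ᶠ w in 𝓝[≠] (0 : ℂ), ∀ u : ℂ, u ^ m = w → u ≠ 0 ∧ ‖u‖ < ε := by
  have h1 : ∀ᶠ w in 𝓝 (0 : ℂ), ‖w‖ < ε ^ m :=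
    (continuous_norm.tendsto' _ _ norm_zero).eventually_lt_const (by positivity)
  filter_upwards [nhdsWithin_le_nhds h1, self_mem_nhdsWithin] with w hw hw0 u hu
  refine ⟨?_, ?_⟩
  · rintro rfl
    exact hw0 (by simp [← hu, hm])
  · rw [← hu, norm_pow] at hw
    exact lt_of_pow_lt_pow_left₀ m hε.le hw

/-- Roots of small nonzero numbers are small and nonzero, so a property near `0` passes to all roots
at once. -/
lemma eventually_root {m : ℕ} (hm : m ≠ 0) {p : ℂ → Prop} (hp : ∀ᶠ u in 𝓝[≠] (0 : ℂ), p u) :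
    ∀ᶠ w in 𝓝[≠] (0 : ℂ), ∀ u : ℂ, u ^ m = w → p u := by
  obtain ⟨ε, hε, h⟩ := Metric.eventually_nhds_iff.1 (eventually_nhdsWithin_iff.1 hp)
  filter_upwards [tendsto_norm_of_pow_eq hm hε] with w hw u hu
  exact h (by simpa using (hw u hu).2) (hw u hu).1

lemma differentiableAt_rootTrace {m : ℕ} (hm : m ≠ 0) {k : ℂ → ℂ}
    (hk : ∀ᶠ u in 𝓝[≠] (0 : ℂ), DifferentiableAt ℂ k u) :
    ∀ᶠ w in 𝓝[≠] (0 : ℂ), DifferentiableAt ℂ (rootTrace m k) w := by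
  filter_upwards [eventually_root hm hk, self_mem_nhdsWithin] with w hw hw0
  have hw0 : w ≠ 0 := hw0
  have hm' : (m : ℂ) ≠ 0 := Nat.cast_ne_zero.2 hm
  -- A branch of the root near `w`. Splitting off a fixed root of `w` keeps the argument of the
  -- second logarithm near `1`, away from the cut.
  set u : ℂ → ℂ := fun z => Complex.exp (Complex.log w / m) * Complex.exp (Complex.log (z / w) / m)
    with hu
  have hpow : ∀ z, z ≠ 0 → u z ^ m = z := by
    intro z hz
    rw [hu, mul_pow, ← Complex.exp_nat_mul, ← Complex.exp_nat_mul, mul_div_cancel₀ _ hm',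
      mul_div_cancel₀ _ hm', Complex.exp_log hw0, Complex.exp_log (div_ne_zero hz hw0)]
    field_simp
  have hdu : DifferentiableAt ℂ u w := by
    have : w / w ∈ Complex.slitPlane := by rw [div_self hw0]; exact Complex.one_mem_slitPlane
    have h2 : DifferentiableAt ℂ (fun z => Complex.log (z / w)) w :=
      DifferentiableAt.clog (by fun_prop) this
    fun_prop
  have hev : rootTrace m k =ᶠ[𝓝 w] fun z =>
      ∑ j ∈ Finset.range m, k (Complex.exp (2 * Real.pi * Complex.I / m) ^ j * u z) := by
    filter_upwards [eventually_ne_nhds hw0] with z hz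
    exact rootTrace_eq hm k (hpow z hz) hz
  refine DifferentiableAt.congr_of_eventuallyEq ?_ hev
  refine DifferentiableAt.fun_sum fun j _ => ?_
  have h1 := hw (Complex.exp (2 * Real.pi * Complex.I / m) ^ j * u w) (by
    rw [mul_pow, hpow w hw0, ← pow_mul, mul_comm j m, pow_mul,
      (Complex.isPrimitiveRoot_exp m hm).pow_eq_one, one_pow, one_mul])
  exact DifferentiableAt.comp w h1 (hdu.const_mul _)

/-- The trace preserves residues: the hypothesis reads off the residue `c` of `k d(u^m)`, and each
of the `m` roots contributes `c / m` to the limit downstairs. -/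
lemma tendsto_mul_rootTrace {m : ℕ} (hm : m ≠ 0) {k : ℂ → ℂ} {c : ℂ}
    (hk : Tendsto (fun u => m * u ^ m * k u) (𝓝[≠] 0) (𝓝 c)) :
    Tendsto (fun w => w * rootTrace m k w) (𝓝[≠] 0) (𝓝 c) := by
  rw [Metric.tendsto_nhds] at hk ⊢
  intro ε hε
  have hm' : (m : ℂ) ≠ 0 := Nat.cast_ne_zero.2 hm
  have hm0 : (0 : ℝ) < m := by positivity
  filter_upwards [eventually_root hm (hk ε hε), self_mem_nhdsWithin] with w hw hw0
  obtain ⟨u, hu⟩ := IsAlgClosed.exists_pow_nat_eq w (Nat.pos_of_ne_zero hm)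
  have h1 : w * rootTrace m k w - c = ∑ j ∈ Finset.range m,
      (w * k (Complex.exp (2 * Real.pi * Complex.I / m) ^ j * u) - c / m) := by
    rw [rootTrace_eq hm k hu hw0, Finset.sum_sub_distrib, Finset.mul_sum]
    simp [mul_div_cancel₀ _ hm']
  rw [dist_eq_norm, h1]
  refine (norm_sum_le _ _).trans_lt ?_
  have h2 : ∀ j ∈ Finset.range m,
      ‖w * k (Complex.exp (2 * Real.pi * Complex.I / m) ^ j * u) - c / m‖ < ε / m := by
    intro j _
    have hx : (Complex.exp (2 * Real.pi * Complex.I / m) ^ j * u) ^ m = w := by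
      rw [mul_pow, hu, ← pow_mul, mul_comm j m, pow_mul,
        (Complex.isPrimitiveRoot_exp m hm).pow_eq_one, one_pow, one_mul]
    have := hw _ hx
    rw [dist_eq_norm, hx] at this
    rw [lt_div_iff₀ hm0]
    calc _ = ‖(w * k (Complex.exp (2 * Real.pi * Complex.I / m) ^ j * u) - c / m) * m‖ := by
          rw [norm_mul, Complex.norm_natCast]
      _ = ‖m * w * k (Complex.exp (2 * Real.pi * Complex.I / m) ^ j * u) - c‖ := by
          congr 1; field_simp
      _ < ε := this
  calc _ < ∑ j ∈ Finset.range m, ε / m :=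
        Finset.sum_lt_sum_of_nonempty ⟨0, Finset.mem_range.2 (Nat.pos_of_ne_zero hm)⟩ h2
    _ = ε := by simp; field_simp

end Trace

end CMCOne

namespace CMCOne

/-! ### Branched coverings of the sphere and the trace of a form -/

section Covering

/-- The standard coordinate of the Riemann sphere centred at `p`, as a map from the plane. -/
def sphereCoord (p : OnePoint ℂ) (w : ℂ) : OnePoint ℂ :=
  p.elim (if w = 0 then OnePoint.infty else ((w⁻¹ : ℂ) : OnePoint ℂ))
    fun a => ((a + w : ℂ) : OnePoint ℂ)

@[simp] lemma sphereCoord_coe (a w : ℂ) : sphereCoord a w = ((a + w : ℂ) : OnePoint ℂ) := rfl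

lemma sphereCoord_infty {w : ℂ} (hw : w ≠ 0) : sphereCoord OnePoint.infty w = ((w⁻¹ : ℂ) : OnePoint ℂ) := by
  simp [sphereCoord, hw]

@[simp] lemma sphereCoord_zero (p : OnePoint ℂ) : sphereCoord p 0 = p := by
  induction p using OnePoint.rec <;> simp [sphereCoord]

lemma sphereCoord_injective (p : OnePoint ℂ) : Function.Injective (sphereCoord p) := by
  intro w w' h
  induction p using OnePoint.rec with
  | infty =>
    by_cases hw : w = 0 <;> by_cases hw' : w' = 0 <;> simp_all [sphereCoord]
  | coe a => simpa using h

lemma tendsto_sphereCoord (p : OnePoint ℂ) : Tendsto (sphereCoord p) (𝓝 0) (𝓝 p) := by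
  induction p using OnePoint.rec with
  | infty =>
    have h0 : pure (sphereCoord OnePoint.infty (0 : ℂ)) ≤ 𝓝 (OnePoint.infty : OnePoint ℂ) := by
      rw [sphereCoord_zero]; exact pure_le_nhds _
    rw [← nhdsNE_sup_pure, tendsto_sup]
    refine ⟨?_, tendsto_pure_left.2 fun s hs => mem_of_mem_nhds (by simpa using hs)⟩
    have h1 : Tendsto (fun w : ℂ => ((w⁻¹ : ℂ) : OnePoint ℂ)) (𝓝[≠] 0) (𝓝 OnePoint.infty) := by
      refine OnePoint.tendsto_coe_infty.comp ?_
      rw [coclosedCompact_eq_cocompact, ← Metric.cobounded_eq_cocompact]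
      exact tendsto_inv₀_nhdsNE_zero
    refine h1.congr' ?_
    filter_upwards [self_mem_nhdsWithin] with w hw
    rw [sphereCoord_infty hw]
  | coe a =>
    have : Tendsto (fun w : ℂ => a + w) (𝓝 0) (𝓝 a) := by
      simpa using (continuous_const.add continuous_id).tendsto (0 : ℂ) (f := fun w : ℂ => a + w)
    exact (OnePoint.continuous_coe.tendsto a).comp this

/-- The derivative of the standard coordinate of the plane with respect to `sphereCoord p`. -/
def sphereDeriv (p : OnePoint ℂ) (w : ℂ) : ℂ := p.elim (-(w ^ 2)⁻¹) fun _ => 1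

@[simp] lemma sphereDeriv_coe (a w : ℂ) : sphereDeriv a w = 1 := rfl

lemma sphereDeriv_infty (w : ℂ) : sphereDeriv OnePoint.infty w = -(w ^ 2)⁻¹ := rfl

variable {Y : Type*} [TopologicalSpace Y]

/-- `ζ` is a local coordinate at `x` in which the map `φ` is `ζ ^ m` and the function `h` is
holomorphic off `x`, the form `h dφ` having residue `c` at `x`. -/
structure IsNormalForm (φ : Y → OnePoint ℂ) (h : Y → ℂ) (c : ℂ) (x : Y) (m : ℕ)
    (ζ : OpenPartialHomeomorph Y ℂ) : Prop where
  m_ne_zero : m ≠ 0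
  mem_source : x ∈ ζ.source
  map_self : ζ x = 0
  map_eq : ∀ y ∈ ζ.source, φ y = sphereCoord (φ x) (ζ y ^ m)
  differentiable : ∀ᶠ u in 𝓝[≠] 0, DifferentiableAt ℂ (fun u => h (ζ.symm u)) u
  tendsto : Tendsto (fun u => m * u ^ m * (sphereDeriv (φ x) (u ^ m) * h (ζ.symm u))) (𝓝[≠] 0) (𝓝 c)

variable {φ : Y → OnePoint ℂ} {h : Y → ℂ} {c : Y → ℂ}

/-- All the conditions on residue and differentiability are germs at `0`, so coordinates can be
shrunk; this makes those at the points of a fibre disjoint. -/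
lemma IsNormalForm.restr {a : ℂ} {x : Y} {m : ℕ} {ζ : OpenPartialHomeomorph Y ℂ}
    (H : IsNormalForm φ h a x m ζ) {U : Set Y} (hU : IsOpen U) (hx : x ∈ U) :
    IsNormalForm φ h a x m (ζ.restrOpen U hU) where
  m_ne_zero := H.m_ne_zero
  mem_source := by simpa using ⟨H.mem_source, hx⟩
  map_self := by simpa using H.map_self
  map_eq y hy := by
    have : y ∈ ζ.source := by simp at hy; exact hy.1
    simpa using H.map_eq y this
  differentiable := by simpa using H.differentiable
  tendsto := by simpa using H.tendsto

lemma continuous_of_isNormalForm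
    (H : ∀ x, ∃ m ζ, IsNormalForm φ h (c x) x m ζ) : Continuous φ := by
  rw [continuous_iff_continuousAt]
  intro x
  obtain ⟨m, ζ, hζ⟩ := H x
  have h1 : Tendsto (fun y => ζ y ^ m) (𝓝 x) (𝓝 0) := by
    have := (ζ.continuousAt hζ.mem_source).fun_pow m
    simpa [ContinuousAt, hζ.map_self, hζ.m_ne_zero] using this
  refine ((tendsto_sphereCoord (φ x)).comp h1).congr' ?_
  filter_upwards [ζ.open_source.mem_nhds hζ.mem_source] with y hy
  exact (hζ.map_eq y hy).symm

/-- In the coordinate at a point of the fibre the equation is `ζ ^ m = 0`, so the fibre is discrete;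
it is also closed in a compact space. -/
lemma finite_fiber_of_isNormalForm [CompactSpace Y]
    (H : ∀ x, ∃ m ζ, IsNormalForm φ h (c x) x m ζ) (p : OnePoint ℂ) : (φ ⁻¹' {p}).Finite := by
  have hcl : IsClosed (φ ⁻¹' {p}) :=
    isClosed_singleton.preimage (continuous_of_isNormalForm H)
  refine hcl.isCompact.finite ?_
  rw [isDiscrete_iff_forall_mem_exists_isOpen]
  intro x hx
  obtain ⟨m, ζ, hζ⟩ := H x
  refine ⟨ζ.source, ζ.open_source, ?_⟩
  ext y
  simp only [Set.mem_inter_iff, Set.mem_preimage, Set.mem_singleton_iff] at hx ⊢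
  constructor
  · rintro ⟨hy, hyp⟩
    have h1 := hζ.map_eq y hy
    rw [hyp, ← hx] at h1
    have h2 := sphereCoord_injective _ ((sphereCoord_zero (φ x)).trans h1)
    have h3 : ζ y = 0 := pow_eq_zero_iff hζ.m_ne_zero |>.1 h2.symm
    exact ζ.injOn hy hζ.mem_source (h3.trans hζ.map_self.symm)
  · rintro rfl
    exact ⟨hζ.mem_source, hx⟩

/-- Near `p`, the trace of `h` along `φ` is a sum of local traces. -/
lemma trace_eq_sum_rootTrace [CompactSpace Y] [T2Space Y]
    (H : ∀ x, ∃ m ζ, IsNormalForm φ h (c x) x m ζ) (p : OnePoint ℂ) :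
    ∃ (m : Y → ℕ) (ζ : Y → OpenPartialHomeomorph Y ℂ),
      (∀ x, IsNormalForm φ h (c x) x (m x) (ζ x)) ∧
      ∀ᶠ w in 𝓝[≠] (0 : ℂ), ∑ᶠ y ∈ φ ⁻¹' {sphereCoord p w}, h y =
        ∑ x ∈ (finite_fiber_of_isNormalForm H p).toFinset,
          rootTrace (m x) (fun u => h ((ζ x).symm u)) w := by
  have hfin := finite_fiber_of_isNormalForm H p
  obtain ⟨U, hU, hdisj⟩ := hfin.t2_separation
  choose m ζ₀ hζ₀ using id H
  set ζ : Y → OpenPartialHomeomorph Y ℂ := fun x => (ζ₀ x).restrOpen (U x) (hU x).2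
  have hζ : ∀ x, IsNormalForm φ h (c x) x (m x) (ζ x) := fun x => (hζ₀ x).restr (hU x).2 (hU x).1
  have hsub : ∀ x, (ζ x).source ⊆ U x := fun x y hy => by
    simp [ζ] at hy; exact hy.2
  refine ⟨m, ζ, hζ, ?_⟩
  have hcont : Continuous φ := continuous_of_isNormalForm fun x => ⟨m x, ζ x, hζ x⟩
  -- The image of this compact set misses `p`, so for values near `p` every preimage lies in one of
  -- the chosen coordinate discs, where the preimages are the roots of `w`.
  set C : Set Y := (⋃ x ∈ φ ⁻¹' {p}, (ζ x).source)ᶜ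
  have hC : IsClosed C :=
    (isOpen_biUnion fun x _ => (ζ x).open_source).isClosed_compl
  have hCp : p ∉ φ '' C := by
    rintro ⟨x, hxC, hxp⟩
    exact hxC (Set.mem_biUnion (show x ∈ φ ⁻¹' {p} from hxp) (hζ x).mem_source)
  have hev1 : ∀ᶠ w in 𝓝 (0 : ℂ), sphereCoord p w ∉ φ '' C :=
    (tendsto_sphereCoord p).eventually
      ((hC.isCompact.image hcont).isClosed.isOpen_compl.mem_nhds hCp)
  have hev2 : ∀ᶠ w in 𝓝[≠] (0 : ℂ), ∀ x ∈ φ ⁻¹' {p}, ∀ u : ℂ, u ^ m x = w → u ∈ (ζ x).target := by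
    rw [hfin.eventually_all]
    intro x _
    have h0 : (ζ x).target ∈ 𝓝 (0 : ℂ) := by
      refine (ζ x).open_target.mem_nhds ?_
      rw [← (hζ x).map_self]
      exact (ζ x).map_source (hζ x).mem_source
    exact eventually_root (hζ x).m_ne_zero (nhdsWithin_le_nhds h0)
  filter_upwards [nhdsWithin_le_nhds hev1, hev2] with w hw1 hw2
  have hroots : ∀ x u, u ∈ (Polynomial.nthRootsFinset (m x) w : Set ℂ) ↔ u ^ m x = w := by
    intro x u
    rw [Finset.mem_coe, Polynomial.mem_nthRootsFinset (Nat.pos_of_ne_zero (hζ x).m_ne_zero)]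
  have hset : φ ⁻¹' {sphereCoord p w} =
      ⋃ x ∈ φ ⁻¹' {p}, (ζ x).symm '' (Polynomial.nthRootsFinset (m x) w : Set ℂ) := by
    ext y
    simp only [Set.mem_iUnion, Set.mem_image]
    constructor
    · intro hy
      have hyC : y ∉ C := fun hyC => hw1 ⟨y, hyC, hy⟩
      simp only [C, Set.mem_compl_iff, not_not, Set.mem_iUnion] at hyC
      obtain ⟨x, hx, hyx⟩ := hyC
      refine ⟨x, hx, ζ x y, ?_, (ζ x).left_inv hyx⟩
      rw [hroots]
      have h1 := (hζ x).map_eq y hyx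
      rw [show φ x = p from hx, show φ y = _ from hy] at h1
      exact (sphereCoord_injective p h1).symm
    · rintro ⟨x, hx, u, hu, rfl⟩
      rw [hroots] at hu
      have hut := hw2 x hx u hu
      have h1 := (hζ x).map_eq _ ((ζ x).map_target hut)
      rw [(ζ x).right_inv hut, hu, show φ x = p from hx] at h1
      exact h1
  have hsrc : ∀ x ∈ φ ⁻¹' {p},
      (ζ x).symm '' (Polynomial.nthRootsFinset (m x) w : Set ℂ) ⊆ U x := by
    rintro x hx _ ⟨u, hu, rfl⟩
    exact hsub x ((ζ x).map_target (hw2 x hx u ((hroots x u).1 hu)))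
  rw [hset, finsum_mem_biUnion (hdisj.mono_on hsrc) hfin
    fun x _ => (Finset.finite_toSet _).image _, finsum_mem_eq_finite_toFinset_sum _ hfin]
  refine Finset.sum_congr rfl fun x hx => ?_
  have hx' : x ∈ φ ⁻¹' {p} := hfin.mem_toFinset.1 hx
  rw [finsum_mem_image ((ζ x).symm.injOn.mono fun u hu => hw2 x hx' u ((hroots x u).1 hu)),
    finsum_mem_coe_finset, rootTrace]

/-- The residues of the form `h dφ` sum to zero. -/
theorem sum_eq_zero_of_isNormalForm [CompactSpace Y] [T2Space Y] {c : Y →₀ ℂ}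
    (H : ∀ x, ∃ m ζ, IsNormalForm φ h (c x) x m ζ) : c.sum (fun _ a => a) = 0 := by
  classical
  have hfin := finite_fiber_of_isNormalForm H
  set T : ℂ → ℂ := fun z => ∑ᶠ y ∈ φ ⁻¹' {(z : OnePoint ℂ)}, h y
  set r : OnePoint ℂ → ℂ := fun p => ∑ x ∈ (hfin p).toFinset, c x with hr
  -- Near every point of the sphere, infinity included, the trace has an isolated singularity, and
  -- the residue of the trace form is the sum `r p` of the residues over the fibre.
  have key : ∀ p, (∀ᶠ w in 𝓝[≠] (0 : ℂ), DifferentiableAt ℂ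
        (fun w => ∑ᶠ y ∈ φ ⁻¹' {sphereCoord p w}, h y) w) ∧
      Tendsto (fun w => w * (sphereDeriv p w * ∑ᶠ y ∈ φ ⁻¹' {sphereCoord p w}, h y)) (𝓝[≠] 0)
        (𝓝 (r p)) := by
    intro p
    obtain ⟨m, ζ, hζ, hev⟩ := trace_eq_sum_rootTrace H p
    constructor
    · have h1 : ∀ᶠ w in 𝓝[≠] (0 : ℂ), ∀ x ∈ (hfin p).toFinset,
          DifferentiableAt ℂ (rootTrace (m x) fun u => h ((ζ x).symm u)) w :=
        (Finset.eventually_all _).2 fun x _ =>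
          differentiableAt_rootTrace (hζ x).m_ne_zero (hζ x).differentiable
      have h2 := eventually_eventually_nhdsWithin.2 hev
      filter_upwards [h1, h2, self_mem_nhdsWithin] with w hw1 hw2 hw0
      refine (DifferentiableAt.fun_sum hw1).congr_of_eventuallyEq ?_
      rwa [nhdsWithin_eq_nhds.2 (isOpen_compl_singleton.mem_nhds hw0)] at hw2
    · have h1 : Tendsto (fun w => ∑ x ∈ (hfin p).toFinset,
          w * (sphereDeriv p w * rootTrace (m x) (fun u => h ((ζ x).symm u)) w)) (𝓝[≠] 0)
          (𝓝 (∑ x ∈ (hfin p).toFinset, c x)) := by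
        refine tendsto_finsetSum _ fun x hx => ?_
        have hxp : φ x = p := (hfin p).mem_toFinset.1 hx
        have := tendsto_mul_rootTrace (hζ x).m_ne_zero (hζ x).tendsto
        rw [hxp] at this
        refine this.congr fun w => ?_
        rw [rootTrace, rootTrace, Finset.mul_sum (a := sphereDeriv p w)]
        congr 1
        refine Finset.sum_congr rfl fun u hu => ?_
        rw [(Polynomial.mem_nthRootsFinset (Nat.pos_of_ne_zero (hζ x).m_ne_zero) w).1 hu]
      refine h1.congr' ?_
      filter_upwards [hev] with w hw
      rw [hw, Finset.mul_sum, Finset.mul_sum]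
  have hshift : ∀ a : ℂ, Tendsto (fun z => z - a) (𝓝[≠] a) (𝓝[≠] 0) := by
    intro a
    refine tendsto_nhdsWithin_iff.2 ⟨?_, ?_⟩
    · have : Tendsto (fun z : ℂ => z - a) (𝓝 a) (𝓝 (a - a)) := Continuous.tendsto (by fun_prop) a
      rw [sub_self] at this
      exact this.mono_left nhdsWithin_le_nhds
    · filter_upwards [self_mem_nhdsWithin] with z hz
      exact sub_ne_zero.2 hz
  have hS : ∀ p ∉ c.support.image φ, r p = 0 := by
    intro p hp
    refine Finset.sum_eq_zero fun x hx => ?_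
    by_contra hne
    refine hp (Finset.mem_image.2 ⟨x, Finsupp.mem_support_iff.2 hne, ?_⟩)
    exact (hfin p).mem_toFinset.1 hx
  set S : Finset ℂ := (c.support.image φ).preimage _ OnePoint.coe_injective.injOn
  have hmain := sum_residues_add_eq_zero (H := T) (S := S) (r := fun a => r a) (r' := r OnePoint.infty)
    (fun a ha => hS a fun h => ha (Finset.mem_preimage.2 h)) ?_ ?_ ?_
  · have hsum : c.sum (fun _ a => a) = ∑ p ∈ insert OnePoint.infty (c.support.image φ), r p := by
      rw [Finsupp.sum, ← Finset.sum_fiberwise_of_maps_to (s := c.support)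
        (t := insert OnePoint.infty (c.support.image φ)) (g := φ)
        (fun x hx => Finset.mem_insert_of_mem (Finset.mem_image_of_mem _ hx))]
      refine Finset.sum_congr rfl fun p _ => Finset.sum_subset ?_ ?_
      · intro x hx
        simp only [Finset.mem_filter] at hx
        simpa using hx.2
      · intro x hx hx'
        by_contra hne
        refine hx' (Finset.mem_filter.2 ⟨Finsupp.mem_support_iff.2 hne, ?_⟩)
        exact (hfin p).mem_toFinset.1 hx
    rw [hsum, ← hmain]
    have h1 : ∑ p ∈ insert OnePoint.infty (c.support.image φ), r p =
        ∑ p ∈ insert OnePoint.infty (S.image fun a : ℂ => (a : OnePoint ℂ)), r p := by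
      refine (Finset.sum_subset ?_ ?_).symm
      · intro p hp
        rw [Finset.mem_insert] at hp ⊢
        refine hp.imp_right fun hp => ?_
        obtain ⟨a, ha, rfl⟩ := Finset.mem_image.1 hp
        exact Finset.mem_preimage.1 ha
      · intro p hp hp'
        induction p using OnePoint.rec with
        | infty => simp at hp'
        | coe a =>
          refine absurd (Finset.mem_insert_of_mem (Finset.mem_image_of_mem _ ?_)) hp'
          refine Finset.mem_preimage.2 ?_
          exact (Finset.mem_insert.1 hp).resolve_left (OnePoint.coe_ne_infty a)
    rw [h1, Finset.sum_insert (by simp), Finset.sum_image OnePoint.coe_injective.injOn, add_comm]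
  · intro a
    have h1 := (hshift a).eventually (key a).1
    filter_upwards [h1] with z hz
    have h2 : DifferentiableAt ℂ (fun z : ℂ => z - a) z := by fun_prop
    have := DifferentiableAt.comp z hz h2
    refine this.congr_of_eventuallyEq (Eventually.of_forall fun y => ?_)
    simp [T]
  · intro a
    have h1 := (key a).2.comp (hshift a)
    refine h1.congr fun z => ?_
    simp [T]
  -- In the coordinate `w = 1/z` at infinity `w * (-w⁻²) = -z`, which gives the sign of the residue
  -- there.
  · have hinv : Tendsto (fun z : ℂ => z⁻¹) (cocompact ℂ) (𝓝[≠] 0) := by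
      rw [← Metric.cobounded_eq_cocompact]; exact tendsto_inv₀_cobounded'
    refine ((key OnePoint.infty).2.comp hinv).neg.congr' ?_
    have h4 : ∀ᶠ z in cocompact ℂ, z ≠ (0 : ℂ) := by
      filter_upwards [(isCompact_singleton (x := (0 : ℂ))).compl_mem_cocompact] with z hz using hz
    filter_upwards [h4] with z hz
    simp only [Function.comp, sphereCoord_infty (inv_ne_zero hz), inv_inv, sphereDeriv_infty, T]
    field_simp

end Covering

end CMCOne

namespace CMCOne

/-! ### Normal coordinates of a meromorphic function; the residue theorem on the surface -/

section NormalForm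

lemma continuousAt_sphereCoord (p : OnePoint ℂ) (w : ℂ) : ContinuousAt (sphereCoord p) w := by
  induction p using OnePoint.rec with
  | infty =>
    by_cases hw : w = 0
    · subst hw
      rw [ContinuousAt, sphereCoord_zero]
      exact tendsto_sphereCoord _
    · have h1 : ContinuousAt (fun w : ℂ => ((w⁻¹ : ℂ) : OnePoint ℂ)) w :=
        OnePoint.continuous_coe.continuousAt.comp (continuousAt_inv₀ hw)
      refine h1.congr ?_
      filter_upwards [eventually_ne_nhds hw] with z hz
      rw [sphereCoord_infty hz]
  | coe a =>
    exact OnePoint.continuous_coe.continuousAt.comp (f := fun w : ℂ => a + w) (by fun_prop)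

/-- A nonvanishing holomorphic function has local `m`-th roots. -/
lemma exists_pow_eq_analyticAt {v : ℂ → ℂ} {z₀ : ℂ} (hv : AnalyticAt ℂ v z₀) (h0 : v z₀ ≠ 0)
    {m : ℕ} (hm : m ≠ 0) :
    ∃ g : ℂ → ℂ, AnalyticAt ℂ g z₀ ∧ g z₀ ≠ 0 ∧ ∀ᶠ z in 𝓝 z₀, g z ^ m = v z := by
  obtain ⟨b, hb⟩ := IsAlgClosed.exists_pow_nat_eq (v z₀) (Nat.pos_of_ne_zero hm)
  have hm' : (m : ℂ) ≠ 0 := Nat.cast_ne_zero.2 hm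
  have hb0 : b ≠ 0 := by rintro rfl; exact h0 (by rw [← hb, zero_pow hm])
  refine ⟨fun z => b * Complex.exp (Complex.log (v z / v z₀) / m), ?_, ?_, ?_⟩
  · have h1 : AnalyticAt ℂ (fun z => Complex.log (v z / v z₀)) z₀ := by
      refine AnalyticAt.clog (hv.div analyticAt_const h0) ?_
      simp [div_self h0]
    exact analyticAt_const.mul ((h1.div analyticAt_const hm').cexp)
  · exact mul_ne_zero hb0 (Complex.exp_ne_zero _)
  · filter_upwards [hv.continuousAt.eventually_ne h0] with z hz
    rw [mul_pow, hb, ← Complex.exp_nat_mul, mul_div_cancel₀ _ hm',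
      Complex.exp_log (div_ne_zero hz h0)]
    field_simp

/-- A function `a + z ^ j * u` is a coordinate of the sphere composed with `z ^ m * v`. -/
lemma exists_eq_sphereCoord {F : ℂ → ℂ} {z₀ a : ℂ} {j : ℤ} {u : ℂ → ℂ} (hj : j ≠ 0)
    (hu : AnalyticAt ℂ u z₀) (hu0 : u z₀ ≠ 0)
    (hF : ∀ᶠ z in 𝓝[≠] z₀, F z = a + (z - z₀) ^ j * u z) :
    ∃ (p : OnePoint ℂ) (m : ℕ) (v : ℂ → ℂ), m ≠ 0 ∧ AnalyticAt ℂ v z₀ ∧ v z₀ ≠ 0 ∧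
      ∀ᶠ z in 𝓝[≠] z₀, (F z : OnePoint ℂ) = sphereCoord p ((z - z₀) ^ m * v z) := by
  obtain ⟨m, rfl | rfl⟩ := j.eq_nat_or_neg
  · have hm : m ≠ 0 := by rintro rfl; simp at hj
    refine ⟨a, m, u, hm, hu, hu0, ?_⟩
    filter_upwards [hF] with z hz
    simp [hz]
  · have hm : m ≠ 0 := by rintro rfl; simp at hj
    -- At a pole `F = (u + a (z - z₀)^m) / (z - z₀)^m`, so the coordinate `1/F` at infinity is `(z -
    -- z₀)^m` times the inverse of this unit.
    have h1 : AnalyticAt ℂ (fun z => u z + a * (z - z₀) ^ m) z₀ := by fun_prop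
    have h2 : u z₀ + a * (z₀ - z₀) ^ m ≠ 0 := by simpa [hm]
    refine ⟨OnePoint.infty, m, fun z => (u z + a * (z - z₀) ^ m)⁻¹, hm, h1.inv h2,
      inv_ne_zero h2, ?_⟩
    filter_upwards [hF, nhdsWithin_le_nhds (h1.continuousAt.eventually_ne h2),
      self_mem_nhdsWithin] with z hz hz2 hz0
    have hz0' : z - z₀ ≠ 0 := sub_ne_zero.2 hz0
    rw [sphereCoord_infty (mul_ne_zero (pow_ne_zero _ hz0') (inv_ne_zero hz2)), hz,
      OnePoint.coe_eq_coe]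
    simp only [zpow_neg, zpow_natCast]
    field_simp
    ring

/-- If `g^m = v`, then `(z - z₀) g` is a local coordinate by the inverse function theorem, and its
`m`-th power is the sphere coordinate of `F`. The last two conclusions say that the residue of `H
dF` does not change with the coordinate. -/
lemma exists_normal_coordinate {F H : ℂ → ℂ} {z₀ a c : ℂ} {j : ℤ} {u : ℂ → ℂ} (hj : j ≠ 0)
    (hu : AnalyticAt ℂ u z₀) (hu0 : u z₀ ≠ 0)
    (hF : ∀ᶠ z in 𝓝[≠] z₀, F z = a + (z - z₀) ^ j * u z)
    (hH : ∀ᶠ z in 𝓝[≠] z₀, DifferentiableAt ℂ H z)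
    (hc : Tendsto (fun z => (z - z₀) * (deriv F z * H z)) (𝓝[≠] z₀) (𝓝 c)) :
    ∃ (p : OnePoint ℂ) (m : ℕ) (ζ : OpenPartialHomeomorph ℂ ℂ), m ≠ 0 ∧ z₀ ∈ ζ.source ∧
      ζ z₀ = 0 ∧ (∀ᶠ z in 𝓝[≠] z₀, (F z : OnePoint ℂ) = sphereCoord p (ζ z ^ m)) ∧
      (∀ᶠ u in 𝓝[≠] 0, DifferentiableAt ℂ (fun u => H (ζ.symm u)) u) ∧
      Tendsto (fun u => m * u ^ m * (sphereDeriv p (u ^ m) * H (ζ.symm u))) (𝓝[≠] 0) (𝓝 c) := by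
  obtain ⟨p, m, v, hm, hv, hv0, hFp⟩ := exists_eq_sphereCoord hj hu hu0 hF
  obtain ⟨g, hg, hg0, hgm⟩ := exists_pow_eq_analyticAt hv hv0 hm
  set ψ : ℂ → ℂ := fun z => (z - z₀) * g z with hψ
  have hψa : AnalyticAt ℂ ψ z₀ := by fun_prop
  have hψd : HasDerivAt ψ (g z₀) z₀ := by
    have := ((hasDerivAt_id z₀).sub_const z₀).mul hg.differentiableAt.hasDerivAt
    simpa [hψ, Pi.mul_def] using this
  have hψ' : HasFDerivAt ψ
      ((ContinuousLinearEquiv.unitsEquivAut ℂ (Units.mk0 (g z₀) hg0) : ℂ ≃L[ℂ] ℂ) : ℂ →L[ℂ] ℂ)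
      z₀ := by
    refine hψd.hasFDerivAt.congr_fderiv ?_
    ext; simp
  have hcd : ContDiffAt ℂ ω ψ z₀ := hψa.contDiffAt
  set ζ := hcd.toOpenPartialHomeomorph ψ hψ' (by simp) with hζ
  have hζψ : ∀ z, ζ z = ψ z := fun z => rfl
  have hsrc : z₀ ∈ ζ.source := hcd.mem_toOpenPartialHomeomorph_source hψ' (by simp)
  have hζ0 : ζ z₀ = 0 := by simp [hζψ, hψ]
  have hsymm0 : ζ.symm 0 = z₀ := by rw [← hζ0, ζ.left_inv hsrc]
  have htgt : (0 : ℂ) ∈ ζ.target := hζ0 ▸ ζ.map_source hsrc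
  have hsa : AnalyticAt ℂ ζ.symm 0 := by
    have h1 : ContDiffAt ℂ ω (hcd.localInverse hψ' (by simp)) (ψ z₀) :=
      hcd.to_localInverse hψ' (by simp)
    have h2 : ψ z₀ = 0 := by simp [hψ]
    rw [h2] at h1
    exact h1.analyticAt
  have hst : Tendsto ζ.symm (𝓝[≠] 0) (𝓝[≠] z₀) := by
    refine tendsto_nhdsWithin_iff.2 ⟨?_, ?_⟩
    · have := hsa.continuousAt.tendsto
      rw [hsymm0] at this
      exact this.mono_left nhdsWithin_le_nhds
    · filter_upwards [nhdsWithin_le_nhds (ζ.open_target.mem_nhds htgt), self_mem_nhdsWithin]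
        with w hw hw0 h
      refine hw0 ?_
      rw [Set.mem_singleton_iff] at h ⊢
      rw [← ζ.right_inv hw, h, hζ0]
  have hFζ : ∀ᶠ z in 𝓝[≠] z₀, (F z : OnePoint ℂ) = sphereCoord p (ζ z ^ m) := by
    filter_upwards [hFp, nhdsWithin_le_nhds hgm] with z hz hz2
    rw [hz, hζψ, hψ, mul_pow, hz2]
  have hsd : ∀ᶠ w in 𝓝[≠] (0 : ℂ), DifferentiableAt ℂ ζ.symm w :=
    nhdsWithin_le_nhds (hsa.eventually_analyticAt.mono fun w hw => hw.differentiableAt)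
  refine ⟨p, m, ζ, hm, hsrc, hζ0, hFζ, ?_, ?_⟩
  · filter_upwards [hsd, hst.eventually hH] with w hw1 hw2
    exact DifferentiableAt.comp w hw2 hw1
  · have hFd : ∀ᶠ z in 𝓝[≠] z₀, DifferentiableAt ℂ F z := by
      have h1 := eventually_eventually_nhdsWithin.2 hF
      filter_upwards [h1, self_mem_nhdsWithin,
        nhdsWithin_le_nhds hu.eventually_analyticAt] with z hz hz0 hua
      rw [nhdsWithin_eq_nhds.2 (isOpen_compl_singleton.mem_nhds hz0)] at hz
      refine DifferentiableAt.congr_of_eventuallyEq ?_ hz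
      have h3 : DifferentiableAt ℂ (fun z => (z - z₀) ^ j) z :=
        DifferentiableAt.zpow (by fun_prop) (Or.inl (sub_ne_zero.2 hz0))
      exact (differentiableAt_const a).add (h3.mul hua.differentiableAt)
    -- Both sides are the derivative of `F ∘ ζ.symm`: by the chain rule on the left, and on the
    -- right from its explicit form `a + w^m` or `(w^m)⁻¹`.
    have hderiv : ∀ᶠ w in 𝓝[≠] (0 : ℂ),
        deriv F (ζ.symm w) * deriv ζ.symm w = m * w ^ (m - 1) * sphereDeriv p (w ^ m) := by
      have h1 := eventually_eventually_nhdsWithin.2 (hst.eventually hFζ)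
      have h2 : ∀ᶠ w in 𝓝[≠] (0 : ℂ), w ∈ ζ.target :=
        nhdsWithin_le_nhds (ζ.open_target.mem_nhds htgt)
      filter_upwards [hst.eventually hFd, hsd, h1, eventually_eventually_nhdsWithin.2 h2,
        self_mem_nhdsWithin] with w hw1 hw2 hw3 hw4 hw0
      have hw0' : w ≠ 0 := hw0
      rw [nhdsWithin_eq_nhds.2 (isOpen_compl_singleton.mem_nhds hw0)] at hw3 hw4
      have hcomp := hw1.hasDerivAt.comp w hw2.hasDerivAt
      refine hcomp.unique ?_
      induction p using OnePoint.rec with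
      | infty =>
        have h5 := ((hasDerivAt_pow m w).fun_inv (pow_ne_zero m hw0'))
        refine (h5.congr_of_eventuallyEq ?_).congr_deriv ?_
        · filter_upwards [hw3, hw4, eventually_ne_nhds hw0'] with y hy hy4 hy0
          rw [ζ.right_inv hy4, sphereCoord_infty (pow_ne_zero m hy0), OnePoint.coe_eq_coe] at hy
          exact hy
        · rw [sphereDeriv_infty]; ring
      | coe a =>
        have h5 := ((hasDerivAt_pow m w).const_add a)
        refine (h5.congr_of_eventuallyEq ?_).congr_deriv ?_
        · filter_upwards [hw3, hw4] with y hy hy4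
          rw [ζ.right_inv hy4, sphereCoord_coe, OnePoint.coe_eq_coe] at hy
          exact hy
        · rw [sphereDeriv_coe]; ring
    have hz' : deriv ζ.symm 0 * g z₀ = 1 := by
      have h1 : HasDerivAt (ψ ∘ ζ.symm) (g z₀ * deriv ζ.symm 0) 0 := by
        refine HasDerivAt.comp 0 ?_ hsa.differentiableAt.hasDerivAt
        rw [hsymm0]; exact hψd
      have h2 : HasDerivAt (ψ ∘ ζ.symm) 1 0 := by
        refine (hasDerivAt_id (0 : ℂ)).congr_of_eventuallyEq ?_
        filter_upwards [ζ.open_target.mem_nhds htgt] with w hw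
        exact ζ.right_inv hw
      rw [mul_comm]; exact h1.unique h2
    -- As `w = (z - z₀) g(z)`, the two residue expressions differ by exactly this factor.
    have hratio : Tendsto (fun w => g (ζ.symm w) * deriv ζ.symm w) (𝓝[≠] 0) (𝓝 1) := by
      have h1 : ContinuousAt (fun w => g (ζ.symm w)) 0 := by
        refine ContinuousAt.comp ?_ hsa.continuousAt
        rw [hsymm0]; exact hg.continuousAt
      have h2 := (h1.fun_mul hsa.deriv.continuousAt).tendsto
      rw [hsymm0, mul_comm (g z₀), hz'] at h2
      exact h2.mono_left nhdsWithin_le_nhds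
    have hlim := (hc.comp hst).mul hratio
    rw [mul_one] at hlim
    refine hlim.congr' ?_
    filter_upwards [hderiv, nhdsWithin_le_nhds (ζ.open_target.mem_nhds htgt)] with w hw hwt
    have h1 : w = (ζ.symm w - z₀) * g (ζ.symm w) := (ζ.right_inv hwt).symm
    obtain ⟨n, rfl⟩ := Nat.exists_eq_succ_of_ne_zero hm
    simp only [Function.comp]
    calc _ = ((ζ.symm w - z₀) * g (ζ.symm w)) * (deriv F (ζ.symm w) * deriv ζ.symm w)
          * H (ζ.symm w) := by ring
      _ = _ := by rw [hw, ← h1]; simp [pow_succ]; ring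

variable {Y : Type*} [TopologicalSpace Y] [ChartedSpace ℂ Y]

lemma tendsto_chart_symm (x : Y) :
    Tendsto (chartAt ℂ x).symm (𝓝[≠] (chartAt ℂ x x)) (𝓝[≠] x) := by
  refine tendsto_nhdsWithin_iff.2 ⟨?_, ?_⟩
  · have := (chartAt ℂ x).continuousAt_symm (mem_chart_target ℂ x)
    rw [ContinuousAt, (chartAt ℂ x).left_inv (mem_chart_source ℂ x)] at this
    exact this.mono_left nhdsWithin_le_nhds
  · filter_upwards [nhdsWithin_le_nhds ((chartAt ℂ x).open_target.mem_nhds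
      (mem_chart_target ℂ x)), self_mem_nhdsWithin] with w hw hw0 h
    rw [Set.mem_singleton_iff] at h
    exact hw0 (by rw [Set.mem_singleton_iff, ← (chartAt ℂ x).right_inv hw, h])

/-- No point of the surface is isolated; limits along punctured neighbourhoods are therefore unique.
-/
instance neBot_nhdsNE_of_chartedSpace (x : Y) : (𝓝[≠] x).NeBot :=
  (tendsto_chart_symm x).neBot

lemma tendsto_chart (x : Y) :
    Tendsto (chartAt ℂ x) (𝓝[≠] x) (𝓝[≠] (chartAt ℂ x x)) := by
  refine tendsto_nhdsWithin_iff.2 ⟨?_, ?_⟩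
  · exact ((chartAt ℂ x).continuousAt (mem_chart_source ℂ x)).tendsto.mono_left nhdsWithin_le_nhds
  · filter_upwards [nhdsWithin_le_nhds ((chartAt ℂ x).open_source.mem_nhds
      (mem_chart_source ℂ x)), self_mem_nhdsWithin] with w hw hw0 h
    exact hw0 ((chartAt ℂ x).injOn hw (mem_chart_source ℂ x) h)

/-- The residue theorem for the form `h df`, with `f` and `h` meromorphic functions on a compact
Riemann surface and `f` not locally constant, in the case of simple poles. -/
theorem sum_residues_eq_zero [CompactSpace Y] [T2Space Y] {f h : Y → ℂ} {c : Y →₀ ℂ}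
    (hf : ∀ x, ∃ (a : ℂ) (j : ℤ) (u : ℂ → ℂ), j ≠ 0 ∧ AnalyticAt ℂ u (chartAt ℂ x x) ∧
      u (chartAt ℂ x x) ≠ 0 ∧ ∀ᶠ z in 𝓝[≠] (chartAt ℂ x x),
        f ((chartAt ℂ x).symm z) = a + (z - chartAt ℂ x x) ^ j * u z)
    (hh : ∀ x, ∀ᶠ z in 𝓝[≠] (chartAt ℂ x x),
      DifferentiableAt ℂ (fun z => h ((chartAt ℂ x).symm z)) z)
    (hc : ∀ x, Tendsto (fun z => (z - chartAt ℂ x x) *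
      (deriv (fun z => f ((chartAt ℂ x).symm z)) z * h ((chartAt ℂ x).symm z)))
      (𝓝[≠] (chartAt ℂ x x)) (𝓝 (c x))) :
    c.sum (fun _ a => a) = 0 := by
  choose a j u hj hu hu0 hf using hf
  choose p m ζ hm hsrc hζ0 hF hH hlim using fun x =>
    exists_normal_coordinate (hj x) (hu x) (hu0 x) (hf x) (hh x) (hc x)
  set ξ : Y → OpenPartialHomeomorph Y ℂ := fun x => (chartAt ℂ x).trans (ζ x)
  have hξx : ∀ x, x ∈ (ξ x).source := fun x => by simp [ξ, hsrc]
  have hξ0 : ∀ x, ξ x x = 0 := fun x => by simp [ξ, hζ0]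
  have hloc : ∀ x, ∀ᶠ y in 𝓝[≠] x, (f y : OnePoint ℂ) = sphereCoord (p x) (ξ x y ^ m x) := by
    intro x
    filter_upwards [(tendsto_chart x).eventually (hF x), nhdsWithin_le_nhds
      ((chartAt ℂ x).open_source.mem_nhds (mem_chart_source ℂ x))] with y hy hys
    rw [(chartAt ℂ x).left_inv hys] at hy
    exact hy
  have hcont : ∀ x, ∀ y ∈ (ξ x).source,
      ContinuousAt (fun y => sphereCoord (p x) (ξ x y ^ m x)) y := fun x y hy =>
    (continuousAt_sphereCoord _ _).comp
      (f := fun y => ξ x y ^ m x) (((ξ x).continuousAt hy).fun_pow (m x))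
  have hlimit : ∀ x, Tendsto (fun y => (f y : OnePoint ℂ)) (𝓝[≠] x) (𝓝 (p x)) := by
    intro x
    have h1 := (hcont x x (hξx x)).tendsto
    rw [hξ0, zero_pow (hm x), sphereCoord_zero] at h1
    exact (h1.mono_left nhdsWithin_le_nhds).congr' ((hloc x).mono fun y hy => hy.symm)
  -- The function `f` may have arbitrary values at isolated points. The map `p` of its punctured
  -- limits has none of these defects: uniqueness of limits gives the normal form at every point
  -- near `x`.
  have hp : ∀ x, ∀ᶠ y in 𝓝 x, p y = sphereCoord (p x) (ξ x y ^ m x) := by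
    intro x
    have h1 := eventually_eventually_nhdsWithin.2 (hloc x)
    rw [eventually_nhdsWithin_iff] at h1
    filter_upwards [h1, (ξ x).open_source.mem_nhds (hξx x)] with y hy hys
    by_cases hyx : y = x
    · subst hyx; rw [hξ0, zero_pow (hm _), sphereCoord_zero]
    · have h2 := hy hyx
      rw [nhdsWithin_eq_nhds.2 (isOpen_compl_singleton.mem_nhds hyx)] at h2
      have h3 := (hcont x y hys).tendsto.mono_left (nhdsWithin_le_nhds (s := {y}ᶜ))
      refine tendsto_nhds_unique (hlimit y) (h3.congr' ?_)
      filter_upwards [nhdsWithin_le_nhds h2] with z hz using hz.symm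
  refine sum_eq_zero_of_isNormalForm (φ := p) (h := h) fun x => ?_
  obtain ⟨U, hU, hUo, hxU⟩ := eventually_nhds_iff.1 (hp x)
  refine ⟨m x, (ξ x).restrOpen U hUo, hm x, ?_, ?_, ?_, ?_, ?_⟩
  · simpa using ⟨hξx x, hxU⟩
  · simpa using hξ0 x
  · intro y hy
    rw [OpenPartialHomeomorph.restrOpen_source] at hy
    exact hU y hy.2
  · exact hH x
  · exact hlim x

end NormalForm

end CMCOne

namespace CMCOne

/-! ### Holomorphic functions in charts -/

section Holomorphic

/-- In a connected space, a property that near each point either holds or fails off the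
point holds everywhere or fails off a discrete set. -/
lemma forall_or_eventually_not {Y : Type*} [TopologicalSpace Y] [PreconnectedSpace Y] {Z : Y → Prop}
    (h : ∀ x₀, (∀ᶠ x in 𝓝 x₀, Z x) ∨ ∀ᶠ x in 𝓝[≠] x₀, ¬Z x) :
    (∀ x, Z x) ∨ ∀ x₀, ∀ᶠ x in 𝓝[≠] x₀, ¬Z x := by
  -- This set is open by construction, and closed by the dichotomy at each point of its complement.
  set A : Set Y := {x₀ | ∀ᶠ x in 𝓝 x₀, Z x}
  have hopen : IsOpen A := isOpen_setOfPred_eventually_nhds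
  have hclosed : IsClosed A := by
    rw [← isOpen_compl_iff, isOpen_iff_mem_nhds]
    intro x₀ hx₀
    have h1 := (h x₀).resolve_left hx₀
    rw [eventually_nhdsWithin_iff] at h1
    filter_upwards [h1] with x hx hxA
    by_cases hxx : x = x₀
    · exact hx₀ (hxx ▸ hxA)
    · exact hx hxx (Eventually.self_of_nhds hxA)
  rcases isClopen_iff.1 ⟨hclosed, hopen⟩ with hA | hA
  · right
    intro x₀
    exact (h x₀).resolve_left fun hx₀ => (hA ▸ (show x₀ ∈ A from hx₀) : x₀ ∈ (∅ : Set Y))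
  · left
    intro x
    have : x ∈ A := hA ▸ Set.mem_univ x
    exact Eventually.self_of_nhds this

variable {Y : Type*} [TopologicalSpace Y] [ChartedSpace ℂ Y]

/-- Regularity `ω` over `ℂ` is analyticity in a chart, which already contains the continuity clause.
This is the passage to one-variable function theory. -/
lemma contMDiffAt_iff_analyticAt {F : Type*} [NormedAddCommGroup F] [NormedSpace ℂ F]
    [CompleteSpace F] {f : Y → F} {x₀ : Y} :
    ContMDiffAt 𝓘(ℂ, ℂ) 𝓘(ℂ, F) ω f x₀ ↔
      AnalyticAt ℂ (fun z => f ((chartAt ℂ x₀).symm z)) (chartAt ℂ x₀ x₀) := by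
  rw [contMDiffAt_iff]
  simp only [mfld_simps, contDiffWithinAt_univ]
  constructor
  · rintro ⟨-, h⟩
    exact h.analyticAt
  · intro h
    refine ⟨?_, h.contDiffAt⟩
    have h1 : ContinuousAt (fun x => f ((chartAt ℂ x₀).symm (chartAt ℂ x₀ x))) x₀ :=
      ContinuousAt.comp (f := chartAt ℂ x₀) (x := x₀) h.continuousAt
        ((chartAt ℂ x₀).continuousAt (mem_chart_source ℂ x₀))
    refine h1.congr ?_
    filter_upwards [(chartAt ℂ x₀).open_source.mem_nhds (mem_chart_source ℂ x₀)] with x hx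
    rw [(chartAt ℂ x₀).left_inv hx]

lemma tendsto_chart_symm_nhds (x : Y) :
    Tendsto (chartAt ℂ x).symm (𝓝 (chartAt ℂ x x)) (𝓝 x) := by
  have := (chartAt ℂ x).continuousAt_symm (mem_chart_target ℂ x)
  rwa [ContinuousAt, (chartAt ℂ x).left_inv (mem_chart_source ℂ x)] at this

lemma tendsto_chart_nhds (x : Y) : Tendsto (chartAt ℂ x) (𝓝 x) (𝓝 (chartAt ℂ x x)) :=
  (chartAt ℂ x).continuousAt (mem_chart_source ℂ x)

lemma eventually_mem_chart_source (x : Y) : ∀ᶠ y in 𝓝 x, y ∈ (chartAt ℂ x).source :=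
  (chartAt ℂ x).open_source.mem_nhds (mem_chart_source ℂ x)

lemma eventually_of_chart {x : Y} {p : Y → Prop}
    (h : ∀ᶠ z in 𝓝 (chartAt ℂ x x), p ((chartAt ℂ x).symm z)) : ∀ᶠ y in 𝓝 x, p y := by
  filter_upwards [(tendsto_chart_nhds x).eventually h, eventually_mem_chart_source x] with y hy hys
  rwa [(chartAt ℂ x).left_inv hys] at hy

lemma eventually_ne_of_chart {x : Y} {p : Y → Prop}
    (h : ∀ᶠ z in 𝓝[≠] (chartAt ℂ x x), p ((chartAt ℂ x).symm z)) : ∀ᶠ y in 𝓝[≠] x, p y := by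
  filter_upwards [(tendsto_chart x).eventually h,
    nhdsWithin_le_nhds (eventually_mem_chart_source x)] with y hy hys
  rwa [(chartAt ℂ x).left_inv hys] at hy

lemma holFunAt_iff {f : Y → ℂ} {x₀ : Y} :
    HolFunAt f x₀ ↔ AnalyticAt ℂ (fun z => f ((chartAt ℂ x₀).symm z)) (chartAt ℂ x₀ x₀) :=
  contMDiffAt_iff_analyticAt

variable {f g : Y → ℂ} {x₀ : Y}

lemma HolFunAt.continuousAt (hf : HolFunAt f x₀) : ContinuousAt f x₀ := ContMDiffAt.continuousAt hf

lemma HolFunAt.mdifferentiableAt (hf : HolFunAt f x₀) :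
    MDifferentiableAt 𝓘(ℂ, ℂ) 𝓘(ℂ, ℂ) f x₀ := ContMDiffAt.mdifferentiableAt hf (by simp)

lemma HolFunAt.congr (hf : HolFunAt f x₀) (h : ∀ᶠ x in 𝓝 x₀, g x = f x) : HolFunAt g x₀ :=
  ContMDiffAt.congr_of_eventuallyEq hf h

lemma holFunAt_const (c : ℂ) : HolFunAt (fun _ : Y => c) x₀ := contMDiffAt_const

lemma HolFunAt.mul (hf : HolFunAt f x₀) (hg : HolFunAt g x₀) : HolFunAt (fun x => f x * g x) x₀ :=
  ContMDiffAt.mul hf hg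

lemma HolFunAt.pow (hf : HolFunAt f x₀) (n : ℕ) : HolFunAt (fun x => f x ^ n) x₀ := by
  rw [holFunAt_iff] at hf ⊢
  exact hf.fun_pow n

lemma HolFunAt.sub (hf : HolFunAt f x₀) (hg : HolFunAt g x₀) :
    HolFunAt (fun x => f x - g x) x₀ := by
  rw [holFunAt_iff] at hf hg ⊢
  exact hf.fun_sub hg

lemma HolFunAt.inv (hf : HolFunAt f x₀) (h0 : f x₀ ≠ 0) : HolFunAt (fun x => (f x)⁻¹) x₀ :=
  ContMDiffAt.inv₀ hf h0

lemma HolFunAt.div (hf : HolFunAt f x₀) (hg : HolFunAt g x₀) (h0 : g x₀ ≠ 0) :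
    HolFunAt (fun x => f x / g x) x₀ := by
  simpa only [div_eq_mul_inv] using hf.mul (hg.inv h0)

lemma coord_self (x₀ : Y) : coord x₀ x₀ = 0 := sub_self _

lemma coord_ne_zero {x : Y} (hx : x ∈ (chartAt ℂ x₀).source) (hne : x ≠ x₀) : coord x₀ x ≠ 0 :=
  sub_ne_zero.2 fun h => hne ((chartAt ℂ x₀).injOn hx (mem_chart_source ℂ x₀) h)

lemma eventually_coord_ne_zero (x₀ : Y) : ∀ᶠ x in 𝓝[≠] x₀, coord x₀ x ≠ 0 := by
  filter_upwards [nhdsWithin_le_nhds (eventually_mem_chart_source x₀), self_mem_nhdsWithin]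
    with x hx hne using coord_ne_zero hx hne

lemma holFunAt_of_chart {u : ℂ → ℂ} (hu : AnalyticAt ℂ u (chartAt ℂ x₀ x₀)) :
    HolFunAt (fun x => u (chartAt ℂ x₀ x)) x₀ := by
  rw [holFunAt_iff]
  refine hu.congr ?_
  filter_upwards [(chartAt ℂ x₀).open_target.mem_nhds (mem_chart_target ℂ x₀)] with z hz
  rw [(chartAt ℂ x₀).right_inv hz]

lemma holFunAt_coord (x₀ : Y) : HolFunAt (coord x₀) x₀ :=
  holFunAt_of_chart (u := fun z => z - chartAt ℂ x₀ x₀) (by fun_prop)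

/-- A continuous identity off a point holds at the point. -/
lemma HolFunAt.eq_of_eventually_ne (hf : HolFunAt f x₀) (hg : HolFunAt g x₀)
    (h : ∀ᶠ x in 𝓝[≠] x₀, f x = g x) : f x₀ = g x₀ :=
  tendsto_nhds_unique_of_eventuallyEq (hf.continuousAt.tendsto.mono_left nhdsWithin_le_nhds)
    (hg.continuousAt.tendsto.mono_left nhdsWithin_le_nhds) h

/-- The derivative of `f` with respect to the coordinate centred at `x₀`. -/
def chartDeriv (x₀ : Y) (f : Y → ℂ) (x : Y) : ℂ :=
  deriv (fun z => f ((chartAt ℂ x₀).symm z)) (chartAt ℂ x₀ x)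

lemma HolFunAt.chartDeriv (hf : HolFunAt f x₀) : HolFunAt (chartDeriv x₀ f) x₀ :=
  holFunAt_of_chart (holFunAt_iff.1 hf).deriv

variable [IsManifold 𝓘(ℂ, ℂ) ω Y]

lemma HolFunAt.eventually (hf : HolFunAt f x₀) : ∀ᶠ x in 𝓝 x₀, HolFunAt f x :=
  (contMDiffAt_iff_contMDiffAt_nhds (by simp)).1 hf

lemma isManifold_one_of_omega : IsManifold 𝓘(ℂ, ℂ) 1 Y :=
  IsManifold.of_le (n := ω) le_top

lemma mdifferentiableAt_chart {x : Y} (hx : x ∈ (chartAt ℂ x₀).source) :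
    MDifferentiableAt 𝓘(ℂ, ℂ) 𝓘(ℂ, ℂ) (chartAt ℂ x₀) x := by
  have := isManifold_one_of_omega (Y := Y)
  exact mdifferentiableAt_atlas (chart_mem_atlas ℂ x₀) hx

lemma dcoord_eq {x : Y} (hx : x ∈ (chartAt ℂ x₀).source) (ξ : TangentSpace 𝓘(ℂ, ℂ) x) :
    dcoord x₀ x ξ = mfderiv 𝓘(ℂ, ℂ) 𝓘(ℂ, ℂ) (chartAt ℂ x₀) x ξ := by
  have h1 := (mdifferentiableAt_chart hx).hasMFDerivAt
  have h2 := h1.sub (hasMFDerivAt_const (I := 𝓘(ℂ, ℂ)) (I' := 𝓘(ℂ, ℂ)) (chartAt ℂ x₀ x₀) x)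
  have h3 : mfderiv 𝓘(ℂ, ℂ) 𝓘(ℂ, ℂ) (coord x₀) x = _ := h2.mfderiv
  rw [dcoord, h3]
  exact sub_zero (mfderiv 𝓘(ℂ, ℂ) 𝓘(ℂ, ℂ) (chartAt ℂ x₀) x ξ : ℂ)

/-- This is `df = f' dz`. The chart stays the one centred at `x₀` while `x` varies, so that forms
near `x₀` have coefficients in a single coordinate. -/
lemma mvfderiv_eq_chartDeriv {x : Y} (hx : x ∈ (chartAt ℂ x₀).source)
    (hf : MDifferentiableAt 𝓘(ℂ, ℂ) 𝓘(ℂ, ℂ) f x) (ξ : TangentSpace 𝓘(ℂ, ℂ) x) :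
    mvfderiv 𝓘(ℂ, ℂ) f x ξ = dcoord x₀ x ξ * chartDeriv x₀ f x := by
  have := isManifold_one_of_omega (Y := Y)
  have hs : MDifferentiableAt 𝓘(ℂ, ℂ) 𝓘(ℂ, ℂ) (chartAt ℂ x₀).symm (chartAt ℂ x₀ x) :=
    mdifferentiableAt_atlas_symm (chart_mem_atlas ℂ x₀) ((chartAt ℂ x₀).map_source hx)
  have hF : MDifferentiableAt 𝓘(ℂ, ℂ) 𝓘(ℂ, ℂ) (fun z => f ((chartAt ℂ x₀).symm z))
      (chartAt ℂ x₀ x) := by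
    refine MDifferentiableAt.comp (I' := 𝓘(ℂ, ℂ)) (chartAt ℂ x₀ x) (g := f) ?_ hs
    rwa [(chartAt ℂ x₀).left_inv hx]
  have hF' := (mdifferentiableAt_iff_differentiableAt.1 hF).hasDerivAt
  have h1 := hF'.hasFDerivAt.hasMFDerivAt.comp x (mdifferentiableAt_chart hx).hasMFDerivAt
  have h2 : f =ᶠ[𝓝 x] (fun z => f ((chartAt ℂ x₀).symm z)) ∘ chartAt ℂ x₀ := by
    filter_upwards [(chartAt ℂ x₀).open_source.mem_nhds hx] with y hy
    simp [(chartAt ℂ x₀).left_inv hy]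
  have h3 := (h1.congr_of_eventuallyEq h2).mfderiv
  have h4 : mvfderiv 𝓘(ℂ, ℂ) f x ξ = (mfderiv 𝓘(ℂ, ℂ) 𝓘(ℂ, ℂ) f x ξ : ℂ) := rfl
  rw [h4, h3, dcoord_eq hx, chartDeriv]
  exact rfl

/-- The differential of a chart is invertible; testing on this vector cancels `dz` from identities
between forms. -/
lemma exists_dcoord_eq_one {x : Y} (hx : x ∈ (chartAt ℂ x₀).source) :
    ∃ ξ : TangentSpace 𝓘(ℂ, ℂ) x, dcoord x₀ x ξ = 1 := by
  have := isManifold_one_of_omega (Y := Y)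
  have h1 : (mfderiv 𝓘(ℂ, ℂ) 𝓘(ℂ, ℂ) (extChartAt 𝓘(ℂ, ℂ) x₀) x).IsInvertible :=
    isInvertible_mfderiv_extChartAt (by simpa using hx)
  obtain ⟨M, hM⟩ := h1
  obtain ⟨ξ, hξ⟩ := M.surjective (1 : ℂ)
  refine ⟨ξ, ?_⟩
  rw [dcoord_eq hx]
  exact (DFunLike.congr_fun hM ξ).symm.trans hξ

end Holomorphic

/-! ### Local sections of holomorphic bundles and their zeros -/

section Sections

variable {Y : Type*} [TopologicalSpace Y] [ChartedSpace ℂ Y]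
  {F : Type*} [NormedAddCommGroup F] [NormedSpace ℂ F] [CompleteSpace F]
  {V : Y → Type*} [∀ x, AddCommGroup (V x)] [∀ x, Module ℂ (V x)]
  [∀ x, TopologicalSpace (V x)] [TopologicalSpace (TotalSpace F V)]
  [FiberBundle F V] {s t : ∀ x, V x} {x₀ : Y} {f : Y → ℂ}

/-- The section `s` read in a chart and in a trivialization. -/
def localRep (F : Type*) [NormedAddCommGroup F] [NormedSpace ℂ F] {V : Y → Type*}
    [TopologicalSpace (TotalSpace F V)] [∀ x, TopologicalSpace (V x)] [FiberBundle F V]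
    (x₀ : Y) (s : ∀ x, V x) (z : ℂ) : F :=
  (trivializationAt F V x₀ ⟨(chartAt ℂ x₀).symm z, s ((chartAt ℂ x₀).symm z)⟩).2

lemma holAt_iff : HolAt F s x₀ ↔ AnalyticAt ℂ (localRep F x₀ s) (chartAt ℂ x₀ x₀) := by
  rw [HolAt, Bundle.contMDiffAt_section, contMDiffAt_iff_analyticAt]
  rfl

lemma HolAt.congr (hs : HolAt F s x₀) (h : ∀ᶠ x in 𝓝 x₀, t x = s x) : HolAt F t x₀ :=
  ContMDiffAt.congr_of_eventuallyEq hs (h.mono fun x hx => by simp only [hx])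

lemma HolAt.mdifferentiableAt (hs : HolAt F s x₀) :
    MDifferentiableAt 𝓘(ℂ, ℂ) (𝓘(ℂ, ℂ).prod 𝓘(ℂ, F)) (fun x => TotalSpace.mk' F x (s x)) x₀ :=
  ContMDiffAt.mdifferentiableAt hs (by simp)

variable [VectorBundle ℂ F V]

lemma HolAt.smul (hf : HolFunAt f x₀) (hs : HolAt F s x₀) : HolAt F (fun x => f x • s x) x₀ :=
  ContMDiffAt.smul_section hf hs

lemma HolAt.add (hs : HolAt F s x₀) (ht : HolAt F t x₀) : HolAt F (fun x => s x + t x) x₀ :=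
  ContMDiffAt.add_section hs ht

lemma eventually_mem_baseSet (x₀ : Y) : ∀ᶠ x in 𝓝 x₀, x ∈ (trivializationAt F V x₀).baseSet :=
  (trivializationAt F V x₀).open_baseSet.mem_nhds (mem_baseSet_trivializationAt F V x₀)

lemma eventually_localRep_eq_zero_iff (s : ∀ x, V x) (x₀ : Y) :
    ∀ᶠ z in 𝓝 (chartAt ℂ x₀ x₀), localRep F x₀ s z = 0 ↔ s ((chartAt ℂ x₀).symm z) = 0 := by
  filter_upwards [(tendsto_chart_symm_nhds x₀).eventually (eventually_mem_baseSet (F := F) (V := V) x₀)]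
    with z hz
  have h1 := (trivializationAt F V x₀).coe_linearMapAt_of_mem (R := ℂ) hz
  rw [localRep, ← congrFun h1]
  have h2 := ((trivializationAt F V x₀).linearEquivAt ℂ _ hz).map_eq_zero_iff
    (x := s ((chartAt ℂ x₀).symm z))
  rw [← h2]
  simp [h1]

/-- A local section with a given representative. -/
lemma exists_holAt_of_analyticAt (x₀ : Y) {S : ℂ → F} (hS : AnalyticAt ℂ S (chartAt ℂ x₀ x₀)) :
    ∃ e : ∀ x, V x, HolAt F e x₀ ∧ (∀ᶠ z in 𝓝 (chartAt ℂ x₀ x₀), localRep F x₀ e z = S z) := by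
  set e : ∀ x, V x := fun x => (trivializationAt F V x₀).symm x (S (chartAt ℂ x₀ x))
  have h1 : ∀ᶠ z in 𝓝 (chartAt ℂ x₀ x₀), localRep F x₀ e z = S z := by
    filter_upwards [(tendsto_chart_symm_nhds x₀).eventually
      (eventually_mem_baseSet (F := F) (V := V) x₀),
      (chartAt ℂ x₀).open_target.mem_nhds (mem_chart_target ℂ x₀)] with z hz hzt
    simp only [localRep, e]
    rw [(trivializationAt F V x₀).apply_mk_symm hz, (chartAt ℂ x₀).right_inv hzt]
  exact ⟨e, holAt_iff.2 (hS.congr (h1.mono fun z hz => hz.symm)), h1⟩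

/-- A section that does not vanish near `x₀` is a power of the coordinate times a nonvanishing
section. -/
lemma HolAt.exists_eq_pow_smul (hs : HolAt F s x₀) (h0 : ¬∀ᶠ x in 𝓝 x₀, s x = 0) :
    ∃ (m : ℕ) (e : ∀ x, V x), HolAt F e x₀ ∧ e x₀ ≠ 0 ∧
      ∀ᶠ x in 𝓝 x₀, s x = coord x₀ x ^ m • e x := by
  have ha := holAt_iff.1 hs
  have hz : ¬∀ᶠ z in 𝓝 (chartAt ℂ x₀ x₀), localRep F x₀ s z = 0 := by
    intro h
    refine h0 (eventually_of_chart ?_)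
    filter_upwards [h, eventually_localRep_eq_zero_iff (F := F) s x₀] with z hz hz'
    exact hz'.1 hz
  obtain ⟨m, S, hS, hS0, hm⟩ := ha.exists_eventuallyEq_pow_smul_nonzero_iff.2 hz
  obtain ⟨e, he, heS⟩ := exists_holAt_of_analyticAt (V := V) x₀ hS
  refine ⟨m, e, he, ?_, ?_⟩
  · intro h
    have h1 := (eventually_localRep_eq_zero_iff (F := F) e x₀).self_of_nhds
    have h2 := heS.self_of_nhds
    rw [(chartAt ℂ x₀).left_inv (mem_chart_source ℂ x₀)] at h1
    exact hS0 (h2 ▸ h1.2 h)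
  · have key : ∀ᶠ z in 𝓝 (chartAt ℂ x₀ x₀), s ((chartAt ℂ x₀).symm z) =
        coord x₀ ((chartAt ℂ x₀).symm z) ^ m • e ((chartAt ℂ x₀).symm z) := by
      filter_upwards [(tendsto_chart_symm_nhds x₀).eventually
        (eventually_mem_baseSet (F := F) (V := V) x₀), hm, heS,
        (chartAt ℂ x₀).open_target.mem_nhds (mem_chart_target ℂ x₀)] with z hz hm he hzt
      have h1 := (trivializationAt F V x₀).coe_linearMapAt_of_mem (R := ℂ) hz
      have h2 := ((trivializationAt F V x₀).linearEquivAt ℂ _ hz).injective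
      refine h2 ?_
      have h3 : ∀ y, (trivializationAt F V x₀).linearEquivAt ℂ _ hz y =
        (trivializationAt F V x₀ ⟨_, y⟩).2 := fun y => rfl
      rw [map_smul, h3, h3]
      have h4 : coord x₀ ((chartAt ℂ x₀).symm z) = z - chartAt ℂ x₀ x₀ := by
        rw [coord, (chartAt ℂ x₀).right_inv hzt]
      rw [h4]
      exact hm.trans (by rw [← he]; rfl)
    exact eventually_of_chart key

lemma exists_holAt_apply_eq (x₀ : Y) (v : V x₀) : ∃ e : ∀ x, V x, HolAt F e x₀ ∧ e x₀ = v := by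
  obtain ⟨e, he, heS⟩ := exists_holAt_of_analyticAt (V := V) x₀
    (S := fun _ => (trivializationAt F V x₀ ⟨x₀, v⟩).2) analyticAt_const
  refine ⟨e, he, ?_⟩
  have h2 := heS.self_of_nhds
  rw [localRep, (chartAt ℂ x₀).left_inv (mem_chart_source ℂ x₀)] at h2
  have hz := mem_baseSet_trivializationAt F V x₀
  exact ((trivializationAt F V x₀).linearEquivAt ℂ _ hz).injective h2

lemma HolAt.eventually_eq_zero_or (hs : HolAt F s x₀) :
    (∀ᶠ x in 𝓝 x₀, s x = 0) ∨ ∀ᶠ x in 𝓝[≠] x₀, s x ≠ 0 := by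
  rcases (holAt_iff.1 hs).eventually_eq_zero_or_eventually_ne_zero with h | h
  · left
    refine eventually_of_chart ?_
    filter_upwards [h, eventually_localRep_eq_zero_iff (F := F) s x₀] with z hz hz'
    exact hz'.1 hz
  · right
    refine eventually_ne_of_chart ?_
    filter_upwards [h, nhdsWithin_le_nhds (eventually_localRep_eq_zero_iff (F := F) s x₀)]
      with z hz hz'
    exact fun h => hz (hz'.2 h)

/-- Holomorphy at a point is an open condition once the total space is itself a manifold; this is
where analyticity of the transition functions enters. -/
lemma HolAt.eventually [IsManifold 𝓘(ℂ, ℂ) ω Y] [ContMDiffVectorBundle ω F V 𝓘(ℂ, ℂ)]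
    (hs : HolAt F s x₀) : ∀ᶠ x in 𝓝 x₀, HolAt F s x := by
  have : IsManifold (𝓘(ℂ, ℂ).prod 𝓘(ℂ, F)) ω (TotalSpace F V) :=
    Bundle.TotalSpace.isManifold F V
  exact (contMDiffAt_iff_contMDiffAt_nhds (by simp)).1 hs

end Sections

end CMCOne

namespace CMCOne

/-! ### Linear algebra of the volume form and calculus of the connection -/

section Connection

variable {Y : Type*} [TopologicalSpace Y] [T2Space Y] [ChartedSpace ℂ Y] [IsManifold 𝓘(ℂ, ℂ) ω Y]
  {E : Y → Type*} [∀ x, AddCommGroup (E x)] [∀ x, Module ℂ (E x)]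
  [∀ x, TopologicalSpace (E x)] [∀ x, IsTopologicalAddGroup (E x)]
  [∀ x, ContinuousSMul ℂ (E x)] [TopologicalSpace (TotalSpace (Fin 2 → ℂ) E)]
  [FiberBundle (Fin 2 → ℂ) E] [VectorBundle ℂ (Fin 2 → ℂ) E]
  [ContMDiffVectorBundle ω (Fin 2 → ℂ) E 𝓘(ℂ, ℂ)]
  {B : SpecialParabolic E}
  {nabla : (∀ x, E x) → ∀ x, TangentSpace 𝓘(ℂ, ℂ) x →L[ℂ] E x}

lemma vol_swap (x : Y) (a b : E x) : B.vol x a b = -B.vol x b a := by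
  have h := B.vol_self x (a + b)
  simp only [map_add, LinearMap.add_apply, B.vol_self, zero_add, add_zero] at h
  linear_combination h

lemma finrank_fiber (x : Y) : Module.finrank ℂ (E x) = 2 := by
  have h := ((trivializationAt (Fin 2 → ℂ) E x).linearEquivAt ℂ x
    (mem_baseSet_trivializationAt _ E x)).finrank_eq
  simpa using h

/-- Otherwise `a` and `b` form a basis of the plane on which the alternating form vanishes, so it is
zero. -/
lemma exists_eq_smul_of_vol_eq_zero {x : Y} {a b : E x} (ha : a ≠ 0) (h : B.vol x a b = 0) :
    ∃ c : ℂ, b = c • a := by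
  by_contra hne
  push Not at hne
  have hli : LinearIndependent ℂ ![a, b] := by
    rw [LinearIndependent.pair_iff' ha]
    exact fun c hc => hne c hc.symm
  have hcard : Fintype.card (Fin 2) = Module.finrank ℂ (E x) := by simp [finrank_fiber]
  refine B.vol_ne_zero x ?_
  have : Nonempty (Fin 2) := ⟨0⟩
  set b' := basisOfLinearIndependentOfCardEqFinrank hli hcard
  have h' : B.vol x b a = 0 := by rw [vol_swap, h, neg_zero]
  refine b'.ext fun i => b'.ext fun j => ?_
  fin_cases i <;> fin_cases j <;> simp [b', B.vol_self, h, h']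

lemma exists_vol_ne_zero {x : Y} {a : E x} (ha : a ≠ 0) : ∃ b, B.vol x a b ≠ 0 := by
  by_contra! h
  have h1 : (⊤ : Submodule ℂ (E x)) ≤ Submodule.span ℂ {a} := fun b _ => by
    obtain ⟨c, rfl⟩ := exists_eq_smul_of_vol_eq_zero ha (h b)
    exact Submodule.smul_mem _ _ (Submodule.mem_span_singleton_self a)
  have h2 := finrank_span_singleton (K := ℂ) ha
  rw [top_le_iff.1 h1, finrank_top, finrank_fiber] at h2
  omega

/-- Cramer's rule. It makes the coefficients of a section in a unimodular holomorphic frame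
holomorphic. -/
lemma eq_vol_smul_add {x : Y} {a b : E x} (h : B.vol x a b = 1) (s : E x) :
    s = B.vol x s b • a + B.vol x a s • b := by
  have hb : b ≠ 0 := by rintro rfl; simp at h
  obtain ⟨c, hc⟩ := exists_eq_smul_of_vol_eq_zero (B := B) hb
    (b := s - (B.vol x s b • a + B.vol x a s • b)) (by
      rw [map_sub, map_add, map_smul, map_smul, B.vol_self, vol_swap x b s, vol_swap x b a, h]
      simp)
  have h1 : B.vol x a (s - (B.vol x s b • a + B.vol x a s • b)) = 0 := by
    simp only [map_sub, map_add, map_smul, smul_eq_mul, B.vol_self, h]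
    ring
  rw [hc, map_smul, h, smul_eq_mul, mul_one] at h1
  rw [h1, zero_smul] at hc
  exact sub_eq_zero.1 hc

lemma smul_apply_comm {M : Type*} [AddCommGroup M] [Module ℂ M] [TopologicalSpace M]
    (a : ℂ →L[ℂ] ℂ) (φ : ℂ →L[ℂ] M) (ξ ξ' : ℂ) : a ξ' • φ ξ = a ξ • φ ξ' := by
  have h1 : ∀ ξ, φ ξ = ξ • φ 1 := fun ξ => by rw [← map_smul, smul_eq_mul, mul_one]
  have h2 : ∀ ξ, a ξ = ξ * a 1 := fun ξ => by rw [← smul_eq_mul, ← map_smul, smul_eq_mul, mul_one]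
  rw [h1 ξ, h1 ξ', h2 ξ, h2 ξ', smul_smul, smul_smul]
  congr 1
  ring

/-- Tangent spaces are lines, so both arguments can be rescaled to `1`. In particular `∇s ∧ ∇s = 0`.
-/
lemma vol_apply_comm {x : Y} (a b : ℂ →L[ℂ] E x) (ξ ξ' : ℂ) :
    B.vol x (b ξ) (a ξ') = -B.vol x (a ξ) (b ξ') := by
  have h1 : ∀ (a : ℂ →L[ℂ] E x) (ξ : ℂ), a ξ = ξ • a 1 := fun a ξ => by
    rw [← map_smul, smul_eq_mul, mul_one]
  rw [h1 a ξ, h1 a ξ', h1 b ξ, h1 b ξ']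
  simp only [map_smul, LinearMap.smul_apply, smul_eq_mul]
  rw [vol_swap]
  ring

lemma isOpen_compl_support : IsOpen {x | x ∉ B.weight.support} :=
  (Finset.finite_toSet B.weight.support).isClosed.isOpen_compl

lemma eventually_notMem_support (x₀ : Y) : ∀ᶠ x in 𝓝[≠] x₀, x ∉ B.weight.support := by
  classical
  have h : ∀ᶠ x in 𝓝 x₀, x ∉ B.weight.support.erase x₀ :=
    (B.weight.support.erase x₀).finite_toSet.isClosed.isOpen_compl.mem_nhds (by simp)
  filter_upwards [nhdsWithin_le_nhds h, self_mem_nhdsWithin] with x hx hne hxs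
  exact hx (Finset.mem_erase.2 ⟨hne, hxs⟩)

variable (hn : B.IsAssociated nabla) {x x₀ : Y} {s t : ∀ x, E x} {f : Y → ℂ}

include hn

lemma nabla_congr (hx : x ∉ B.weight.support) (hs : HolAt (Fin 2 → ℂ) s x)
    (ht : HolAt (Fin 2 → ℂ) t x) (h : ∀ᶠ y in 𝓝 x, s y = t y) : nabla s x = nabla t x :=
  hn.isCov.congr_of_eventuallyEq hs.mdifferentiableAt ht.mdifferentiableAt
    (isOpen_compl_support.mem_nhds hx) h

lemma nabla_smul (hx : x ∉ B.weight.support) (hf : HolFunAt f x) (hs : HolAt (Fin 2 → ℂ) s x)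
    (ξ : TangentSpace 𝓘(ℂ, ℂ) x) :
    nabla (fun y => f y • s y) x ξ = f x • nabla s x ξ + mvfderiv 𝓘(ℂ, ℂ) f x ξ • s x := by
  have := hn.isCov.leibniz hs.mdifferentiableAt hf.mdifferentiableAt hx
  exact DFunLike.congr_fun this ξ

lemma nabla_add (hx : x ∉ B.weight.support) (hs : HolAt (Fin 2 → ℂ) s x)
    (ht : HolAt (Fin 2 → ℂ) t x) (ξ : TangentSpace 𝓘(ℂ, ℂ) x) :
    nabla (fun y => s y + t y) x ξ = nabla s x ξ + nabla t x ξ := by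
  have := hn.isCov.add hs.mdifferentiableAt ht.mdifferentiableAt hx
  exact DFunLike.congr_fun this ξ

lemma exists_parallel_frame (hx : x₀ ∉ B.weight.support) : ∃ e₁ e₂ : ∀ x, E x,
    HolAt (Fin 2 → ℂ) e₁ x₀ ∧ HolAt (Fin 2 → ℂ) e₂ x₀ ∧ ∀ᶠ x in 𝓝 x₀,
      nabla e₁ x = 0 ∧ nabla e₂ x = 0 ∧ B.vol x (e₁ x) (e₂ x) = 1 := by
  obtain ⟨h, hh⟩ := hn.isSU2
  obtain ⟨e₁, e₂, h1, h2, h3⟩ := hh x₀ hx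
  exact ⟨e₁, e₂, h1, h2, h3.mono fun x hx => ⟨hx.1, hx.2.1, hx.2.2.1⟩⟩

/-- In a parallel frame the connection differentiates the coefficients, which Cramer's rule
provides. -/
lemma nabla_eq_of_frame {e₁ e₂ : ∀ x, E x} (hx : x ∉ B.weight.support)
    (h1 : HolAt (Fin 2 → ℂ) e₁ x) (h2 : HolAt (Fin 2 → ℂ) e₂ x)
    (h3 : ∀ᶠ x in 𝓝 x, nabla e₁ x = 0 ∧ nabla e₂ x = 0 ∧ B.vol x (e₁ x) (e₂ x) = 1)
    (hs : HolAt (Fin 2 → ℂ) s x) (ξ : TangentSpace 𝓘(ℂ, ℂ) x) :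
    nabla s x ξ = mvfderiv 𝓘(ℂ, ℂ) (fun y => B.vol y (s y) (e₂ y)) x ξ • e₁ x +
      mvfderiv 𝓘(ℂ, ℂ) (fun y => B.vol y (e₁ y) (s y)) x ξ • e₂ x := by
  have ha := B.vol_hol s e₂ x hs h2
  have hb := B.vol_hol e₁ s x h1 hs
  have h4 : nabla s x = nabla (fun y => B.vol y (s y) (e₂ y) • e₁ y +
      B.vol y (e₁ y) (s y) • e₂ y) x := by
    refine nabla_congr hn hx hs ((h1.smul ha).add (h2.smul hb)) ?_
    filter_upwards [h3] with y hy
    exact eq_vol_smul_add hy.2.2 (s y)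
  obtain ⟨h5, h6, -⟩ := h3.self_of_nhds
  rw [h4, nabla_add hn hx (h1.smul ha) (h2.smul hb), nabla_smul hn hx ha h1,
    nabla_smul hn hx hb h2, h5, h6]
  simp

/-- The connection is compatible with the trivialization of the determinant. -/
lemma mvfderiv_vol (hx : x ∉ B.weight.support) (hs : HolAt (Fin 2 → ℂ) s x)
    (ht : HolAt (Fin 2 → ℂ) t x) (ξ : TangentSpace 𝓘(ℂ, ℂ) x) :
    mvfderiv 𝓘(ℂ, ℂ) (fun y => B.vol y (s y) (t y)) x ξ =
      B.vol x (nabla s x ξ) (t x) + B.vol x (s x) (nabla t x ξ) := by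
  obtain ⟨e₁, e₂, h1, h2, h3⟩ := exists_parallel_frame hn hx
  have h12 := h3.self_of_nhds.2.2
  rw [nabla_eq_of_frame hn hx h1 h2 h3 hs, nabla_eq_of_frame hn hx h1 h2 h3 ht]
  set a := fun y => B.vol y (s y) (e₂ y)
  set b := fun y => B.vol y (e₁ y) (s y)
  set c := fun y => B.vol y (t y) (e₂ y)
  set d := fun y => B.vol y (e₁ y) (t y)
  have ha : HolFunAt a x := B.vol_hol s e₂ x hs h2
  have hb : HolFunAt b x := B.vol_hol e₁ s x h1 hs
  have hc : HolFunAt c x := B.vol_hol t e₂ x ht h2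
  have hd : HolFunAt d x := B.vol_hol e₁ t x h1 ht
  have hst : (fun y => B.vol y (s y) (t y)) =ᶠ[𝓝 x] a * d + -(b * c) := by
    filter_upwards [h3] with y hy
    rw [eq_vol_smul_add hy.2.2 (s y)]
    simp only [map_add, LinearMap.add_apply, map_smul, LinearMap.smul_apply, smul_eq_mul,
      Pi.add_apply, Pi.mul_apply, Pi.neg_apply, a, b, c, d, vol_swap y (e₂ y) (t y)]
    ring
  have h5 : mvfderiv 𝓘(ℂ, ℂ) (fun y => B.vol y (s y) (t y)) x =
      mvfderiv 𝓘(ℂ, ℂ) (a * d + -(b * c)) x := by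
    rw [mvfderiv, mvfderiv, hst.mfderiv_eq]
    rfl
  have had : MDifferentiableAt 𝓘(ℂ, ℂ) 𝓘(ℂ, ℂ) (a * d) x := (ha.mul hd).mdifferentiableAt
  have hbc : MDifferentiableAt 𝓘(ℂ, ℂ) 𝓘(ℂ, ℂ) (b * c) x := (hb.mul hc).mdifferentiableAt
  rw [h5, mvfderiv_add had hbc.neg, mvfderiv_neg,
    mvfderiv_mul ha.mdifferentiableAt hd.mdifferentiableAt,
    mvfderiv_mul hb.mdifferentiableAt hc.mdifferentiableAt]
  simp only [add_apply, neg_apply,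
    smul_apply, smul_eq_mul, map_add, LinearMap.add_apply, map_smul,
    LinearMap.smul_apply]
  have e1 : B.vol x (e₁ x) (t x) = d x := rfl
  have e2 : B.vol x (e₂ x) (t x) = -c x := vol_swap x _ _
  have e3 : B.vol x (s x) (e₁ x) = -b x := vol_swap x _ _
  have e4 : B.vol x (s x) (e₂ x) = a x := rfl
  rw [e1, e2, e3, e4]
  ring

open scoped Classical in
/-- The connection has at most a simple pole at each point, and none off the parabolic divisor. -/
lemma exists_log_form (x₀ : Y) (hs : HolAt (Fin 2 → ℂ) s x₀) :
    ∃ r : ∀ x, E x, HolAt (Fin 2 → ℂ) r x₀ ∧ ∀ᶠ x in 𝓝 x₀, x ∉ B.weight.support →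
      ∀ ξ, coord x₀ x ^ (if x₀ ∈ B.weight.support then 1 else 0) • nabla s x ξ =
        dcoord x₀ x ξ • r x := by
  by_cases hx₀ : x₀ ∈ B.weight.support
  · obtain ⟨Γ, hΓ, -⟩ := hn.residue x₀ hx₀
    obtain ⟨r, hr, -, h⟩ := hΓ s hs
    refine ⟨r, hr, ?_⟩
    filter_upwards [eventually_nhdsWithin_iff.1 h] with x hx hxD ξ
    rw [if_pos hx₀, pow_one]
    exact hx (fun h => hxD (h ▸ hx₀)) ξ
  · obtain ⟨e₁, e₂, h1, h2, h3⟩ := exists_parallel_frame hn hx₀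
    have ha := B.vol_hol s e₂ x₀ hs h2
    have hb := B.vol_hol e₁ s x₀ h1 hs
    refine ⟨_, (h1.smul ha.chartDeriv).add (h2.smul hb.chartDeriv), ?_⟩
    filter_upwards [eventually_eventually_nhds.2 h3, h1.eventually, h2.eventually, hs.eventually,
      eventually_mem_chart_source x₀] with x h3 h1 h2 hs hxs hxD ξ
    rw [if_neg hx₀, pow_zero, one_smul, nabla_eq_of_frame hn hxD h1 h2 h3 hs,
      mvfderiv_eq_chartDeriv hxs (B.vol_hol s e₂ x hs h2).mdifferentiableAt,
      mvfderiv_eq_chartDeriv hxs (B.vol_hol e₁ s x h1 hs).mdifferentiableAt, smul_add, smul_smul,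
      smul_smul]

/-- The expression `g² ∇(V/g) ∧ ∇(W/g)` when `V ∧ W = c g²`. -/
lemma vol_nabla_div {V W : ∀ x, E x} {g : Y → ℂ} {c : ℂ} (hx : x ∉ B.weight.support)
    (hV : HolAt (Fin 2 → ℂ) V x) (hW : HolAt (Fin 2 → ℂ) W x) (hg : HolFunAt g x)
    (hg0 : g x ≠ 0) (hc : ∀ᶠ y in 𝓝 x, B.vol y (V y) (W y) = c * g y ^ 2)
    (ξ ξ' : TangentSpace 𝓘(ℂ, ℂ) x) :
    g x ^ 2 * B.vol x (nabla (fun y => (g y)⁻¹ • V y) x ξ) (nabla (fun y => (g y)⁻¹ • W y) x ξ') =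
      B.vol x (nabla V x ξ) (nabla W x ξ') -
        c * (mvfderiv 𝓘(ℂ, ℂ) g x ξ * mvfderiv 𝓘(ℂ, ℂ) g x ξ') := by
  have hgi := hg.inv hg0
  set p := mvfderiv 𝓘(ℂ, ℂ) g x
  set q := mvfderiv 𝓘(ℂ, ℂ) (fun y => (g y)⁻¹) x
  -- `d(1/g) = -dg/g²`, from differentiating `g * (1/g) = 1`.
  have hq : ∀ ξ, q ξ = -(g x ^ 2)⁻¹ * p ξ := by
    intro ξ
    have h1 : (g * fun y => (g y)⁻¹) =ᶠ[𝓝 x] fun _ => (1 : ℂ) := by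
      filter_upwards [hg.continuousAt.eventually_ne hg0] with y hy
      simp [hy]
    have h2 : mvfderiv 𝓘(ℂ, ℂ) (g * fun y => (g y)⁻¹) x = 0 := by
      rw [mvfderiv, h1.mfderiv_eq, mfderiv_const]
      ext
      rfl
    rw [mvfderiv_mul hg.mdifferentiableAt hgi.mdifferentiableAt] at h2
    have h3 := DFunLike.congr_fun h2 ξ
    simp only [add_apply, smul_apply, smul_eq_mul,
      zero_apply] at h3
    have h4 : g x * q ξ = -((g x)⁻¹ * p ξ) := by linear_combination h3
    field_simp at h4 ⊢
    linear_combination h4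
  -- The derivative of `V ∧ W = c g²`. It collects the two mixed terms of the expansion into `-2c
  -- dg²`; with `+c dg²` from the last term this leaves `-c dg²`.
  have hVW : B.vol x (nabla V x ξ') (W x) + B.vol x (V x) (nabla W x ξ') =
      2 * c * g x * p ξ' := by
    rw [← mvfderiv_vol hn hx hV hW]
    have h1 : (fun y => B.vol y (V y) (W y)) =ᶠ[𝓝 x] (fun _ => c) * (g * g) := by
      filter_upwards [hc] with y hy
      rw [hy, sq]; rfl
    have h2 : mvfderiv 𝓘(ℂ, ℂ) (fun y => B.vol y (V y) (W y)) x =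
        mvfderiv 𝓘(ℂ, ℂ) ((fun _ => c) * (g * g)) x := by
      rw [mvfderiv, mvfderiv, h1.mfderiv_eq]
      rfl
    have h3 : mvfderiv 𝓘(ℂ, ℂ) (fun _ : Y => c) x = 0 := mvfderiv_const c
    have hgg : MDifferentiableAt 𝓘(ℂ, ℂ) 𝓘(ℂ, ℂ) (g * g) x := (hg.mul hg).mdifferentiableAt
    rw [h2, mvfderiv_mul (holFunAt_const c).mdifferentiableAt hgg,
      mvfderiv_mul hg.mdifferentiableAt hg.mdifferentiableAt, h3]
    simp only [add_apply, smul_apply, smul_eq_mul,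
      smul_zero, add_zero]
    change c * (g x * p ξ' + g x * p ξ') = _
    ring
  have hcx := hc.self_of_nhds
  -- The two mixed terms come with their tangent vectors interchanged, which is harmless on a line.
  have hsw : p ξ' * B.vol x (nabla V x ξ) (W x) = p ξ * B.vol x (nabla V x ξ') (W x) := by
    have h1 : p ξ' • nabla V x ξ = p ξ • nabla V x ξ' := smul_apply_comm (M := E x) p _ ξ ξ'
    have h2 := congrArg (fun e => B.vol x e (W x)) h1
    simpa only [map_smul, LinearMap.smul_apply, smul_eq_mul] using h2
  rw [nabla_smul hn hx hgi hV, nabla_smul hn hx hgi hW]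
  simp only [map_add, LinearMap.add_apply, map_smul, LinearMap.smul_apply, smul_eq_mul]
  change g x ^ 2 * ((g x)⁻¹ * ((g x)⁻¹ * _ + q ξ * _) + q ξ' * ((g x)⁻¹ * _ + q ξ * _)) = _
  rw [hq, hq, hcx]
  field_simp
  linear_combination -hsw - p ξ * hVW

end Connection

end CMCOne

namespace CMCOne

/-! ### Sections of `E ⊗ L` and `L²`; the form `σ² ∇(v/σ) ∧ ∇(w/σ)` -/

section LineBundle

variable {Y : Type*} [TopologicalSpace Y] [T2Space Y] [ChartedSpace ℂ Y] [IsManifold 𝓘(ℂ, ℂ) ω Y]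
  {E : Y → Type*} [∀ x, AddCommGroup (E x)] [∀ x, Module ℂ (E x)]
  [∀ x, TopologicalSpace (E x)] [∀ x, IsTopologicalAddGroup (E x)]
  [∀ x, ContinuousSMul ℂ (E x)] [TopologicalSpace (TotalSpace (Fin 2 → ℂ) E)]
  [FiberBundle (Fin 2 → ℂ) E] [VectorBundle ℂ (Fin 2 → ℂ) E]
  [ContMDiffVectorBundle ω (Fin 2 → ℂ) E 𝓘(ℂ, ℂ)]
  {L : Y → Type*} [∀ x, AddCommGroup (L x)] [∀ x, Module ℂ (L x)]
  [∀ x, TopologicalSpace (L x)] [TopologicalSpace (TotalSpace ℂ L)]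
  [FiberBundle ℂ L] [VectorBundle ℂ ℂ L] [ContMDiffVectorBundle ω ℂ L 𝓘(ℂ, ℂ)]
  {B : SpecialParabolic E} {x₀ x : Y}

lemma fiberCoord_apply (hx : x ∈ (trivializationAt ℂ L x₀).baseSet) (l : L x) :
    fiberCoord L x₀ x l = (trivializationAt ℂ L x₀ ⟨x, l⟩).2 := by
  have h1 := (trivializationAt ℂ L x₀).coe_linearMapAt_of_mem (R := ℂ) hx
  exact congrFun h1 l

lemma fiberCoord_smul_localFrame (hx : x ∈ (trivializationAt ℂ L x₀).baseSet) (l : L x) :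
    fiberCoord L x₀ x l • localFrame L x₀ x = l := by
  have h1 := (trivializationAt ℂ L x₀).symmL_continuousLinearMapAt (R := ℂ) hx l
  have h2 : localFrame L x₀ x = (trivializationAt ℂ L x₀).symmL ℂ x 1 :=
    ((trivializationAt ℂ L x₀).symmL_apply (R := ℂ) hx 1).symm
  rw [h2, ← map_smul, smul_eq_mul, mul_one]
  exact h1

lemma fiberCoord_eq_zero_iff (hx : x ∈ (trivializationAt ℂ L x₀).baseSet) (l : L x) :
    fiberCoord L x₀ x l = 0 ↔ l = 0 := by
  refine ⟨fun h => ?_, fun h => by rw [h, map_zero]⟩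
  rw [← fiberCoord_smul_localFrame hx l, h, zero_smul]

lemma mem_baseSet_self (x : Y) : x ∈ (trivializationAt ℂ L x).baseSet :=
  mem_baseSet_trivializationAt ℂ L x

lemma eq_smul_of_fiberCoord (hx : x ∈ (trivializationAt ℂ L x₀).baseSet) {l : L x} (hl : l ≠ 0)
    (l' : L x) : l' = ((fiberCoord L x₀ x l)⁻¹ * fiberCoord L x₀ x l') • l := by
  have h0 := (fiberCoord_eq_zero_iff hx l).not.2 hl
  calc l' = fiberCoord L x₀ x l' • localFrame L x₀ x := (fiberCoord_smul_localFrame hx l').symm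
    _ = ((fiberCoord L x₀ x l)⁻¹ * fiberCoord L x₀ x l') •
        fiberCoord L x₀ x l • localFrame L x₀ x := by
      rw [smul_smul]; congr 1; field_simp
    _ = _ := by rw [fiberCoord_smul_localFrame hx l]

@[simp] lemma contract_tmul (e : E x) (l : L x) :
    contract L E x₀ x (e ⊗ₜ l) = fiberCoord L x₀ x l • e := by
  simp [contract]

@[simp] lemma fiberCoordSq_tmul (l l' : L x) :
    fiberCoordSq L x₀ x (l ⊗ₜ l') = fiberCoord L x₀ x l * fiberCoord L x₀ x l' := by
  simp [fiberCoordSq]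

lemma tmul_eq_smul_localFrame (hx : x ∈ (trivializationAt ℂ L x₀).baseSet) (l l' : L x) :
    l ⊗ₜ[ℂ] l' = (fiberCoord L x₀ x l * fiberCoord L x₀ x l') •
      (localFrame L x₀ x ⊗ₜ[ℂ] localFrame L x₀ x) := by
  conv_lhs => rw [← fiberCoord_smul_localFrame hx l, ← fiberCoord_smul_localFrame hx l']
  rw [TensorProduct.smul_tmul_smul]

lemma eq_fiberCoordSq_smul (hx : x ∈ (trivializationAt ℂ L x₀).baseSet) (q : L x ⊗[ℂ] L x) :
    q = fiberCoordSq L x₀ x q • (localFrame L x₀ x ⊗ₜ[ℂ] localFrame L x₀ x) := by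
  induction q with
  | zero => simp
  | tmul l l' => rw [fiberCoordSq_tmul]; exact tmul_eq_smul_localFrame hx l l'
  | add a b ha hb => rw [map_add, add_smul, ← ha, ← hb]

lemma fiberCoord_localFrame (hx : x ∈ (trivializationAt ℂ L x₀).baseSet) :
    fiberCoord L x₀ x (localFrame L x₀ x) = 1 := by
  rw [fiberCoord_apply hx, localFrame, (trivializationAt ℂ L x₀).apply_mk_symm hx]

lemma localFrame_tmul_ne_zero (hx : x ∈ (trivializationAt ℂ L x₀).baseSet) :
    localFrame L x₀ x ⊗ₜ[ℂ] localFrame L x₀ x ≠ 0 := by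
  intro h
  have h1 := congrArg (fiberCoordSq L x₀ x) h
  rw [fiberCoordSq_tmul, fiberCoord_localFrame hx, map_zero] at h1
  norm_num at h1

lemma tmul_self_eq_zero_iff (l : L x) : l ⊗ₜ[ℂ] l = 0 ↔ l = 0 := by
  refine ⟨fun h => ?_, fun h => by rw [h, TensorProduct.zero_tmul]⟩
  have h1 := congrArg (fiberCoordSq L x x) h
  rw [fiberCoordSq_tmul, map_zero, mul_self_eq_zero, fiberCoord_eq_zero_iff (mem_baseSet_self x)] at h1
  exact h1

/-- Where `σ` is nonzero it spans the fibre of `L`, so the quotient by `σ` is a true inverse of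
tensoring with `σ` and is independent of the trivialization. -/
lemma eq_divSection_tmul (v : ∀ x, E x ⊗[ℂ] L x) {σ : ∀ x, L x} (hσ : σ x ≠ 0) :
    v x = divSection v σ x ⊗ₜ σ x := by
  have hb := mem_baseSet_self (L := L) x
  have h0 := (fiberCoord_eq_zero_iff hb (σ x)).not.2 hσ
  rw [divSection]
  induction v x with
  | zero => simp
  | tmul e l =>
    rw [contract_tmul, smul_smul, TensorProduct.smul_tmul]
    congr 1
    exact eq_smul_of_fiberCoord hb hσ l
  | add a b ha hb => rw [map_add, smul_add, TensorProduct.add_tmul, ← ha, ← hb]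

lemma contract_eq_smul_divSection (x₀ : Y) (v : ∀ x, E x ⊗[ℂ] L x) {σ : ∀ x, L x}
    (hσ : σ x ≠ 0) :
    contract L E x₀ x (v x) = fiberCoord L x₀ x (σ x) • divSection v σ x := by
  conv_lhs => rw [eq_divSection_tmul v hσ]
  rw [contract_tmul]

lemma contract_eq_zero_iff (hx : x ∈ (trivializationAt ℂ L x₀).baseSet) (q : E x ⊗[ℂ] L x) :
    contract L E x₀ x q = 0 ↔ q = 0 := by
  refine ⟨fun h => ?_, fun h => by rw [h, map_zero]⟩
  have hq : q = contract L E x₀ x q ⊗ₜ localFrame L x₀ x := by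
    clear h
    induction q with
    | zero => simp
    | tmul e l =>
      rw [contract_tmul, TensorProduct.smul_tmul, fiberCoord_smul_localFrame hx]
    | add a b ha hb => rw [map_add, TensorProduct.add_tmul, ← ha, ← hb]
  rw [hq, h, TensorProduct.zero_tmul]

lemma divSection_eq (hx : x ∈ (trivializationAt ℂ L x₀).baseSet) (v : ∀ x, E x ⊗[ℂ] L x)
    {σ : ∀ x, L x} (hσ : σ x ≠ 0) :
    divSection v σ x = (fiberCoord L x₀ x (σ x))⁻¹ • contract L E x₀ x (v x) := by
  have h0 := (fiberCoord_eq_zero_iff hx (σ x)).not.2 hσ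
  rw [contract_eq_smul_divSection x₀ v hσ, smul_smul, inv_mul_cancel₀ h0, one_smul]

/-- The wedge product as a bilinear map. -/
def wedgeMap (B : SpecialParabolic E) (x : Y) :
    (E x ⊗[ℂ] L x) →ₗ[ℂ] (E x ⊗[ℂ] L x) →ₗ[ℂ] L x ⊗[ℂ] L x :=
  (TensorProduct.map₂ (B.vol x) (TensorProduct.mk ℂ (L x) (L x))).compr₂
    (TensorProduct.lid ℂ (L x ⊗[ℂ] L x)).toLinearMap

lemma wedge_eq (v w : E x ⊗[ℂ] L x) : wedge B x v w = wedgeMap B x v w := rfl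

@[simp] lemma wedgeMap_tmul (e e' : E x) (l l' : L x) :
    wedgeMap B x (e ⊗ₜ l) (e' ⊗ₜ l') = B.vol x e e' • (l ⊗ₜ l') := by
  simp [wedgeMap]

/-- Trivializing `L` reduces the wedge product to `vol`; holomorphy, antisymmetry and degeneracy of
`v ∧ w` are all inherited through this identity. -/
lemma fiberCoordSq_wedgeMap (v w : E x ⊗[ℂ] L x) :
    fiberCoordSq L x₀ x (wedgeMap B x v w) =
      B.vol x (contract L E x₀ x v) (contract L E x₀ x w) := by
  induction v with
  | zero => simp
  | add a b ha hb => simp only [map_add, LinearMap.add_apply, ha, hb]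
  | tmul e l =>
    induction w with
    | zero => simp
    | add a b ha hb => simp only [map_add, ha, hb]
    | tmul e' l' => simp; ring

lemma wedgeMap_self (v : E x ⊗[ℂ] L x) : wedgeMap B x v v = 0 := by
  rw [eq_fiberCoordSq_smul (mem_baseSet_self x) (wedgeMap B x v v), fiberCoordSq_wedgeMap,
    B.vol_self, zero_smul]

lemma wedgeMap_swap (v w : E x ⊗[ℂ] L x) : wedgeMap B x w v = -wedgeMap B x v w := by
  rw [eq_fiberCoordSq_smul (mem_baseSet_self x) (wedgeMap B x w v), fiberCoordSq_wedgeMap,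
    vol_swap, ← fiberCoordSq_wedgeMap, neg_smul,
    ← eq_fiberCoordSq_smul (mem_baseSet_self x)]

lemma holFunAt_fiberCoord (σ : Cₛ^ω⟮𝓘(ℂ, ℂ); ℂ, L⟯) (x₀ : Y) :
    HolFunAt (fun x => fiberCoord L x₀ x (σ x)) x₀ := by
  have h : HolFunAt (fun x => (trivializationAt ℂ L x₀ ⟨x, σ x⟩).2) x₀ :=
    (Bundle.contMDiffAt_section x₀).1 (σ.contMDiff x₀)
  refine h.congr ?_
  filter_upwards [eventually_mem_baseSet (F := ℂ) (V := L) x₀] with x hx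
  exact fiberCoord_apply hx (σ x)

lemma holAt_contract (v : HEL L E) (x₀ : Y) :
    HolAt (Fin 2 → ℂ) (fun x => contract L E x₀ x (v.1 x)) x₀ := v.2 x₀

/-- `v ∧ w` as a section of `L²`. -/
def wedgeHLL (B : SpecialParabolic E) : HEL L E →ₗ[ℂ] HEL L E →ₗ[ℂ] HLL L :=
  LinearMap.mk₂ ℂ (fun v w => ⟨fun x => wedgeMap B x (v.1 x) (w.1 x), fun x₀ => by
      simp only [fiberCoordSq_wedgeMap]
      exact B.vol_hol _ _ x₀ (holAt_contract v x₀) (holAt_contract w x₀)⟩)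
    (fun a b c => by ext x; simp) (fun r a b => by ext x; simp)
    (fun a b c => by ext x; simp) (fun r a b => by ext x; simp)

@[simp] lemma wedgeHLL_apply (v w : HEL L E) (x : Y) :
    (wedgeHLL B v w).1 x = wedgeMap B x (v.1 x) (w.1 x) := rfl

lemma section_ne_zero_iff (σ : Cₛ^ω⟮𝓘(ℂ, ℂ); ℂ, L⟯) : σ ≠ 0 ↔ ∃ x, σ x ≠ 0 := by
  rw [ne_eq, ← not_forall, not_iff_not]
  exact ⟨fun h x => by rw [h]; rfl, fun h => ContMDiffSection.ext h⟩

lemma IsSquareOf.ne_zero {τ : HLL L} {σ : Cₛ^ω⟮𝓘(ℂ, ℂ); ℂ, L⟯} (h : IsSquareOf L τ σ) :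
    τ ≠ 0 ↔ σ ≠ 0 := by
  rw [section_ne_zero_iff]
  constructor
  · intro hτ
    by_contra! h0
    refine hτ (Subtype.ext (funext fun x => ?_))
    rw [h x, h0 x, TensorProduct.zero_tmul]; rfl
  · rintro ⟨x, hx⟩ rfl
    exact hx ((tmul_self_eq_zero_iff _).1 (h x).symm)

/-- The identity theorem on a connected surface. -/
lemma eventually_section_ne_zero [PreconnectedSpace Y] {σ : Cₛ^ω⟮𝓘(ℂ, ℂ); ℂ, L⟯} (hσ : σ ≠ 0)
    (x₀ : Y) : ∀ᶠ x in 𝓝[≠] x₀, σ x ≠ 0 := by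
  rcases forall_or_eventually_not (Z := fun x => σ x = 0) fun x₀ =>
    HolAt.eventually_eq_zero_or (F := ℂ) (s := σ) (σ.contMDiff x₀) with h | h
  · obtain ⟨x, hx⟩ := (section_ne_zero_iff σ).1 hσ
    exact absurd (h x) hx
  · exact h x₀

lemma eventually_HEL_ne_zero [PreconnectedSpace Y] {v : HEL L E} (hv : v ≠ 0) (x₀ : Y) :
    ∀ᶠ x in 𝓝[≠] x₀, v.1 x ≠ 0 := by
  have hloc : ∀ x₀, (∀ᶠ x in 𝓝 x₀, v.1 x = 0) ∨ ∀ᶠ x in 𝓝[≠] x₀, ¬v.1 x = 0 := fun x₀ => by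
    have hb := eventually_mem_baseSet (F := ℂ) (V := L) x₀
    refine (holAt_contract v x₀).eventually_eq_zero_or.imp (fun h => ?_) fun h => ?_
    · filter_upwards [h, hb] with x hx hb using (contract_eq_zero_iff hb _).1 hx
    · filter_upwards [h, nhdsWithin_le_nhds hb] with x hx hb using
        fun h0 => hx ((contract_eq_zero_iff hb _).2 h0)
  rcases forall_or_eventually_not hloc with h | h
  · exact absurd (Subtype.ext (funext h)) hv
  · exact h x₀

variable {nabla : (∀ x, E x) → ∀ x, TangentSpace 𝓘(ℂ, ℂ) x →L[ℂ] E x}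

/-- The quotient section is defined with a trivialization that changes from point to point; here it
is computed in a single one, so that it can be differentiated. -/
lemma eventually_divSection_eq (hx : x ∈ (trivializationAt ℂ L x₀).baseSet)
    {σ : ∀ x, L x} (hg : HolFunAt (fun y => fiberCoord L x₀ y (σ y)) x)
    (hσ : σ x ≠ 0) (v : ∀ x, E x ⊗[ℂ] L x) :
    ∀ᶠ y in 𝓝 x, divSection v σ y = (fiberCoord L x₀ y (σ y))⁻¹ • contract L E x₀ y (v y) := by
  have h0 := (fiberCoord_eq_zero_iff hx (σ x)).not.2 hσ
  filter_upwards [hg.continuousAt.eventually_ne h0,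
    (trivializationAt ℂ L x₀).open_baseSet.mem_nhds hx] with y hy hyb
  exact divSection_eq hyb v fun h => hy (by rw [h, map_zero])

lemma holAt_divSection (hx : x ∈ (trivializationAt ℂ L x₀).baseSet)
    {σ : ∀ x, L x} (hg : HolFunAt (fun y => fiberCoord L x₀ y (σ y)) x) (hσ : σ x ≠ 0)
    {v : ∀ x, E x ⊗[ℂ] L x}
    (hv : HolAt (Fin 2 → ℂ) (fun y => contract L E x₀ y (v y)) x) :
    HolAt (Fin 2 → ℂ) (divSection v σ) x :=
  (hv.smul (hg.inv ((fiberCoord_eq_zero_iff hx (σ x)).not.2 hσ))).congr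
    (eventually_divSection_eq hx hg hσ v)

variable (hn : B.IsAssociated nabla)

include hn

/-- The form `σ² ∇(v/σ) ∧ ∇(w/σ)` in a local trivialization of `L`, when `v ∧ w = c σ²`. -/
lemma theta_eq (hx : x ∈ (trivializationAt ℂ L x₀).baseSet) (hxD : x ∉ B.weight.support)
    {σ : ∀ x, L x} (hg : HolFunAt (fun y => fiberCoord L x₀ y (σ y)) x) (hσ : σ x ≠ 0)
    {v w : ∀ x, E x ⊗[ℂ] L x}
    (hv : HolAt (Fin 2 → ℂ) (fun y => contract L E x₀ y (v y)) x)
    (hw : HolAt (Fin 2 → ℂ) (fun y => contract L E x₀ y (w y)) x) {c : ℂ}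
    (hc : ∀ y, wedgeMap B y (v y) (w y) = c • (σ y ⊗ₜ σ y)) (ξ ξ' : TangentSpace 𝓘(ℂ, ℂ) x) :
    theta B nabla σ v w x ξ ξ' =
      (B.vol x (nabla (fun y => contract L E x₀ y (v y)) x ξ)
          (nabla (fun y => contract L E x₀ y (w y)) x ξ') -
        c * (mvfderiv 𝓘(ℂ, ℂ) (fun y => fiberCoord L x₀ y (σ y)) x ξ *
          mvfderiv 𝓘(ℂ, ℂ) (fun y => fiberCoord L x₀ y (σ y)) x ξ')) •
      (localFrame L x₀ x ⊗ₜ localFrame L x₀ x) := by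
  have h0 := (fiberCoord_eq_zero_iff hx (σ x)).not.2 hσ
  have hi := hg.inv h0
  have hV := nabla_congr hn hxD (holAt_divSection hx hg hσ hv) (hv.smul hi)
    (eventually_divSection_eq hx hg hσ v)
  have hW := nabla_congr hn hxD (holAt_divSection hx hg hσ hw) (hw.smul hi)
    (eventually_divSection_eq hx hg hσ w)
  rw [theta, hV, hW, tmul_eq_smul_localFrame hx, smul_smul,
    ← vol_nabla_div hn hxD hv hw hg h0 (c := c) ?_ ξ ξ']
  · congr 1
    ring
  · refine Eventually.of_forall fun y => ?_
    rw [← fiberCoordSq_wedgeMap, hc, map_smul, fiberCoordSq_tmul, smul_eq_mul, sq]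

/-- The form depends only on `σ²` up to scalars. -/
lemma theta_congr (hxD : x ∉ B.weight.support) {σ σ' : Cₛ^ω⟮𝓘(ℂ, ℂ); ℂ, L⟯} (hσ : σ x ≠ 0)
    {v w : HEL L E} {c κ : ℂ} (hκ : κ ≠ 0)
    (hc : ∀ y, wedgeMap B y (v.1 y) (w.1 y) = c • (σ y ⊗ₜ σ y))
    (hκ' : ∀ y, σ' y ⊗ₜ[ℂ] σ' y = κ • (σ y ⊗ₜ[ℂ] σ y)) (ξ ξ' : TangentSpace 𝓘(ℂ, ℂ) x) :
    theta B nabla σ' v.1 w.1 x ξ ξ' = theta B nabla σ v.1 w.1 x ξ ξ' := by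
  have hb := mem_baseSet_self (L := L) x
  have hg := holFunAt_fiberCoord σ x
  have hg' := holFunAt_fiberCoord σ' x
  have hσ' : σ' x ≠ 0 := by
    intro h
    have := hκ' x
    rw [h, TensorProduct.zero_tmul, eq_comm, smul_eq_zero, tmul_self_eq_zero_iff] at this
    exact this.elim hκ hσ
  have hc' : ∀ y, wedgeMap B y (v.1 y) (w.1 y) = (c / κ) • (σ' y ⊗ₜ[ℂ] σ' y) := fun y => by
    rw [hc, hκ', smul_smul, div_mul_cancel₀ _ hκ]
  rw [theta_eq hn hb hxD hg' hσ' (holAt_contract v x) (holAt_contract w x) hc',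
    theta_eq hn hb hxD hg hσ (holAt_contract v x) (holAt_contract w x) hc]
  set g := fun y => fiberCoord L x y (σ y)
  set g' := fun y => fiberCoord L x y (σ' y)
  have hgx : g x ≠ 0 := (fiberCoord_eq_zero_iff hb _).not.2 hσ
  have hgx' : g' x ≠ 0 := (fiberCoord_eq_zero_iff hb _).not.2 hσ'
  have hsq : ∀ y, g' y * g' y = κ * (g y * g y) := fun y => by
    have := congrArg (fiberCoordSq L x y) (hκ' y)
    simpa using this
  -- Differentiating `g'² = κ g²` and halving. Multiplying two such identities and cancelling `g'²`
  -- gives `dg'² = κ dg²`, which absorbs the change of the constant from `c` to `c / κ`.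
  have hd : ∀ ξ, g' x * mvfderiv 𝓘(ℂ, ℂ) g' x ξ = κ * (g x * mvfderiv 𝓘(ℂ, ℂ) g x ξ) := by
    intro ξ
    have h1 : g' * g' = (fun _ => κ) * (g * g) := funext hsq
    have h2 := congrArg (fun f => mvfderiv 𝓘(ℂ, ℂ) f x ξ) h1
    have hgg : MDifferentiableAt 𝓘(ℂ, ℂ) 𝓘(ℂ, ℂ) (g * g) x := (hg.mul hg).mdifferentiableAt
    simp only [mvfderiv_mul (holFunAt_const κ).mdifferentiableAt hgg, mvfderiv_const,
      mvfderiv_mul hg.mdifferentiableAt hg.mdifferentiableAt,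
      mvfderiv_mul hg'.mdifferentiableAt hg'.mdifferentiableAt, add_apply, smul_apply,
      smul_eq_mul, zero_apply, mul_zero, add_zero] at h2
    linear_combination h2 / 2
  congr 2
  have h1 := hd ξ
  have h2 := hd ξ'
  have h3 : (g' x * g' x) * (mvfderiv 𝓘(ℂ, ℂ) g' x ξ * mvfderiv 𝓘(ℂ, ℂ) g' x ξ') =
      κ * (g' x * g' x) * (mvfderiv 𝓘(ℂ, ℂ) g x ξ * mvfderiv 𝓘(ℂ, ℂ) g x ξ') := by
    rw [show κ * (g' x * g' x) = κ * (κ * (g x * g x)) by rw [hsq]]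
    linear_combination (g' x * mvfderiv 𝓘(ℂ, ℂ) g' x ξ') * h1 +
      (κ * (g x * mvfderiv 𝓘(ℂ, ℂ) g x ξ)) * h2
  have h4 : mvfderiv 𝓘(ℂ, ℂ) g' x ξ * mvfderiv 𝓘(ℂ, ℂ) g' x ξ' =
      κ * (mvfderiv 𝓘(ℂ, ℂ) g x ξ * mvfderiv 𝓘(ℂ, ℂ) g x ξ') :=
    mul_left_cancel₀ (mul_ne_zero hgx' hgx') (h3.trans (by ring))
  rw [h4]
  field_simp

/-- The form is bilinear and alternating in the frame. -/
lemma theta_add_smul (hxD : x ∉ B.weight.support) {σ : Cₛ^ω⟮𝓘(ℂ, ℂ); ℂ, L⟯} (hσ : σ x ≠ 0)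
    (v w : HEL L E) (a b a' b' : ℂ) (ξ ξ' : TangentSpace 𝓘(ℂ, ℂ) x) :
    theta B nabla σ (a • v + b • w).1 (a' • v + b' • w).1 x ξ ξ' =
      (a * b' - b * a') • theta B nabla σ v.1 w.1 x ξ ξ' := by
  have hb := mem_baseSet_self (L := L) x
  have hg := holFunAt_fiberCoord σ x
  have hv := holAt_divSection hb hg hσ (holAt_contract v x)
  have hw := holAt_divSection hb hg hσ (holAt_contract w x)
  have hlin : ∀ (a b : ℂ) ξ, nabla (divSection (a • v + b • w).1 σ) x ξ =
      a • nabla (divSection v.1 σ) x ξ + b • nabla (divSection w.1 σ) x ξ := by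
    intro a b ξ
    have h1 : divSection (a • v + b • w).1 σ =
        fun y => a • divSection v.1 σ y + b • divSection w.1 σ y := by
      funext y
      simp only [divSection, Submodule.coe_add, Submodule.coe_smul, Pi.add_apply, Pi.smul_apply,
        map_add, map_smul, smul_add]
      rw [smul_comm a, smul_comm b]
    have ha := holFunAt_const (x₀ := x) a
    have hb := holFunAt_const (x₀ := x) b
    have hd : ∀ c : ℂ, mvfderiv 𝓘(ℂ, ℂ) (fun _ : Y => c) x ξ = 0 := fun c => by
      rw [mvfderiv_const, zero_apply]
    rw [h1, nabla_add hn hxD (hv.smul ha) (hw.smul hb), nabla_smul hn hxD ha hv,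
      nabla_smul hn hxD hb hw, hd, hd, zero_smul, zero_smul, add_zero, add_zero]
  have hcomm : ∀ A C : TangentSpace 𝓘(ℂ, ℂ) x →L[ℂ] E x,
      B.vol x (C ξ) (A ξ') = -B.vol x (A ξ) (C ξ') := by
    intro A C
    exact vol_apply_comm (B := B) (x := x) A C ξ ξ'
  have hself : ∀ A : TangentSpace 𝓘(ℂ, ℂ) x →L[ℂ] E x, B.vol x (A ξ) (A ξ') = 0 := by
    intro A
    have := hcomm A A
    linear_combination this / 2
  rw [theta, theta, hlin, hlin]
  simp only [map_add, map_smul, LinearMap.add_apply, LinearMap.smul_apply, smul_eq_mul, hself]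
  rw [hcomm (nabla (divSection v.1 σ) x) (nabla (divSection w.1 σ) x), smul_smul]
  congr 1
  ring

end LineBundle

end CMCOne

namespace CMCOne

/-! ### Polynomial maps and Zariski open sets -/

section ZariskiMaps

variable {A A' X X' : Type*} [AddCommGroup A] [Module ℂ A] [AddCommGroup A'] [Module ℂ A']
  {U : Set A} {U' : Set A'}

lemma multilinear_mem_polyFun {n : ℕ} (m : MultilinearMap ℂ (fun _ : Fin n => A) ℂ) :
    (fun a => m fun _ => a) ∈ polyFun A := Algebra.subset_adjoin ⟨n, m, rfl⟩

lemma linear_mem_polyFun (l : A →ₗ[ℂ] ℂ) : (fun a => l a) ∈ polyFun A :=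
  multilinear_mem_polyFun (MultilinearMap.ofSubsingleton ℂ A ℂ (0 : Fin 1) l)

lemma bilinear_mem_polyFun (b : A →ₗ[ℂ] A →ₗ[ℂ] ℂ) : (fun a => b a a) ∈ polyFun A :=
  multilinear_mem_polyFun (n := 2) (MultilinearMap.uncurryRight (M := fun _ : Fin 2 => A)
    (MultilinearMap.ofSubsingleton ℂ A (A →ₗ[ℂ] ℂ) (0 : Fin 1) b))

/-- Induction on the number `n` of slots still to be filled by `l a + b a a`. Splitting one slot
moves it outside: the linear part adds one outer argument and the quadratic part two. Allowing
arbitrary outer arity `k` is what makes the induction close. -/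
lemma multilinear_comp_quadratic_mem_polyFun (l : A' →ₗ[ℂ] A) (b : A' →ₗ[ℂ] A' →ₗ[ℂ] A) (n : ℕ) :
    ∀ (k : ℕ) (M : MultilinearMap ℂ (fun _ : Fin k => A')
      (MultilinearMap ℂ (fun _ : Fin n => A) ℂ)),
      (fun a => M (fun _ => a) fun _ => l a + b a a) ∈ polyFun A' := by
  induction n with
  | zero =>
    intro k M
    let ev : MultilinearMap ℂ (fun _ : Fin 0 => A) ℂ →ₗ[ℂ] ℂ :=
      { toFun := fun m => m fun _ => 0
        map_add' := fun _ _ => rfl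
        map_smul' := fun _ _ => rfl }
    have h := multilinear_mem_polyFun (ev.compMultilinearMap M)
    convert! h using 1
    funext a
    exact congrArg _ (Subsingleton.elim _ _)
  | succ n ih =>
    intro k M
    set Z := MultilinearMap ℂ (fun _ : Fin n => A) ℂ
    let N : MultilinearMap ℂ (fun _ : Fin k => A') (A →ₗ[ℂ] Z) :=
      (multilinearCurryLeftEquiv ℂ (fun _ : Fin (n + 1) => A) ℂ).toLinearMap.compMultilinearMap M
    have hN : ∀ a y, M a (fun _ => y) = N a y fun _ => y := by
      intro a y
      have h1 : (fun _ : Fin (n + 1) => y) = Fin.cons y fun _ => y := by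
        funext i
        refine Fin.cases ?_ (fun i => ?_) i <;> simp
      rw [h1]
      rfl
    let N1 : MultilinearMap ℂ (fun _ : Fin (k + 1) => A') Z :=
      MultilinearMap.uncurryRight (M := fun _ : Fin (k + 1) => A')
        ((LinearMap.lcomp ℂ Z l).compMultilinearMap N)
    let N2 : MultilinearMap ℂ (fun _ : Fin (k + 2) => A') Z :=
      MultilinearMap.uncurryRight (M := fun _ : Fin (k + 2) => A')
        (MultilinearMap.uncurryRight (M := fun _ : Fin (k + 1) => A')
          ((LinearMap.lcomp ℂ (A' →ₗ[ℂ] Z) b ∘ₗ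
            LinearMap.llcomp ℂ A' A Z).compMultilinearMap N))
    have h := (polyFun A').add_mem (ih (k + 1) N1) (ih (k + 2) N2)
    convert! h using 1
    funext a
    rw [hN, map_add]
    rfl

/-- The pullback of a polynomial function by an inhomogeneous quadratic map. -/
lemma comp_quadratic_mem_polyFun (l : A' →ₗ[ℂ] A) (b : A' →ₗ[ℂ] A' →ₗ[ℂ] A) {p : A → ℂ}
    (hp : p ∈ polyFun A) : (fun a => p (l a + b a a)) ∈ polyFun A' := by
  induction hp using Algebra.adjoin_induction with
  | mem p hp =>
    obtain ⟨n, m, rfl⟩ := hp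
    exact multilinear_comp_quadratic_mem_polyFun l b n 0
      (MultilinearMap.constOfIsEmpty ℂ (fun _ : Fin 0 => A') m)
  | algebraMap r => exact (polyFun A').algebraMap_mem r
  | add p q _ _ hp hq => exact (polyFun A').add_mem hp hq
  | mul p q _ _ hp hq => exact (polyFun A').mul_mem hp hq

lemma comp_linear_mem_polyFun (l : A' →ₗ[ℂ] A) {p : A → ℂ}
    (hp : p ∈ polyFun A) : (fun a => p (l a)) ∈ polyFun A' := by
  simpa using comp_quadratic_mem_polyFun l 0 hp

lemma isOpen_zariski_preimage {ψ : A' → A}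
    (hψ : ∀ p ∈ polyFun A, (fun a => p (ψ a)) ∈ polyFun A') {O : Set A}
    (hO : IsOpen[zariskiSpace A] O) : IsOpen[zariskiSpace A'] (ψ ⁻¹' O) := by
  have h : @Continuous _ _ (zariskiSpace A') (zariskiSpace A) ψ := by
    refine continuous_generateFrom_iff.2 ?_
    rintro _ ⟨p, hp, rfl⟩
    exact TopologicalSpace.isOpen_generateFrom_of_mem ⟨_, hψ p hp, rfl⟩
  exact @Continuous.isOpen_preimage _ _ (zariskiSpace A') (zariskiSpace A) ψ h O hO

lemma isOpen_zariski_ne {p : A → ℂ} (hp : p ∈ polyFun A) :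
    IsOpen[zariskiSpace A] {a | p a ≠ 0} :=
  TopologicalSpace.isOpen_generateFrom_of_mem ⟨p, hp, rfl⟩

lemma isOpen_zariskiQuot_iff {pr : U → X} {O : Set X} :
    IsOpen[zariskiQuot pr] O ↔
      ∃ O', IsOpen[zariskiSpace A] O' ∧ ∀ u : U, pr u ∈ O ↔ u.1 ∈ O' := by
  refine (@isOpen_induced_iff _ _ (zariskiSpace A) (pr ⁻¹' O) Subtype.val).trans ?_
  refine exists_congr fun O' => and_congr_right fun _ => ?_
  rw [Set.ext_iff]
  exact forall_congr' fun u => Iff.comm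

lemma isOpen_zariskiSub_iff {pr : U → X} {Z : Set X} {O : Set Z} :
    IsOpen[zariskiSub pr Z] O ↔
      ∃ O', IsOpen[zariskiQuot pr] O' ∧ ∀ z : Z, z ∈ O ↔ z.1 ∈ O' := by
  refine (@isOpen_induced_iff _ _ (zariskiQuot pr) O Subtype.val).trans ?_
  refine exists_congr fun O' => and_congr_right fun _ => ?_
  rw [Set.ext_iff]
  exact forall_congr' fun u => Iff.comm

end ZariskiMaps

/-- Unlike in `exteriorPower.linearMap_ext`, the target need not be a group. -/
lemma exteriorSquare_linearMap_ext {S N : Type*} [AddCommGroup S] [Module ℂ S] [AddCommMonoid N]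
    [Module ℂ N] {f g : ⋀[ℂ]^2 S →ₗ[ℂ] N}
    (h : ∀ v w, f (exteriorPower.ιMulti ℂ 2 ![v, w]) = g (exteriorPower.ιMulti ℂ 2 ![v, w])) :
    f = g := by
  refine LinearMap.ext_on (exteriorPower.ιMulti_span ℂ 2 S) ?_
  rintro _ ⟨a, rfl⟩
  have ha : a = ![a 0, a 1] := by
    funext i; fin_cases i <;> rfl
  rw [ha, h]

/-- The functional `d` is the determinant in a basis. It identifies the exterior square with `ℂ`, so
a linear map out of it is given by its value on `e ∧ e'`. -/
lemma exists_coordinates_of_finrank_eq_two {S : Type*} [AddCommGroup S] [Module ℂ S]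
    (h : Module.finrank ℂ S = 2) : ∃ (e e' : S) (r r' : S → ℂ) (d : ⋀[ℂ]^2 S →ₗ[ℂ] ℂ),
      (∀ v, v = r v • e + r' v • e') ∧
      ∀ v w, d (exteriorPower.ιMulti ℂ 2 ![v, w]) = r v * r' w - r' v * r w := by
  have : FiniteDimensional ℂ S := Module.finite_of_finrank_pos (by omega)
  set b := Module.finBasisOfFinrankEq ℂ S h
  refine ⟨b 0, b 1, fun v => b.repr v 0, fun v => b.repr v 1,
    exteriorPower.alternatingMapLinearEquiv b.det, fun v => ?_, fun v w => ?_⟩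
  · conv_lhs => rw [← b.sum_repr v, Fin.sum_univ_two]
  · rw [exteriorPower.alternatingMapLinearEquiv_apply_ιMulti, Module.Basis.det_apply,
      Matrix.det_fin_two]
    simp only [Module.Basis.toMatrix_apply, Matrix.cons_val_zero, Matrix.cons_val_one]
    rw [mul_comm (b.repr w 0)]

/-! ### Proportionality on the closure of the graph; construction of `Λ` -/

section Bundle

variable {Y : Type*} [TopologicalSpace Y] [T2Space Y] [ChartedSpace ℂ Y] [IsManifold 𝓘(ℂ, ℂ) ω Y]
  {E : Y → Type*} [∀ x, AddCommGroup (E x)] [∀ x, Module ℂ (E x)]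
  [∀ x, TopologicalSpace (E x)] [∀ x, IsTopologicalAddGroup (E x)]
  [∀ x, ContinuousSMul ℂ (E x)] [TopologicalSpace (TotalSpace (Fin 2 → ℂ) E)]
  [FiberBundle (Fin 2 → ℂ) E] [VectorBundle ℂ (Fin 2 → ℂ) E]
  [ContMDiffVectorBundle ω (Fin 2 → ℂ) E 𝓘(ℂ, ℂ)]
  {L : Y → Type*} [∀ x, AddCommGroup (L x)] [∀ x, Module ℂ (L x)]
  [∀ x, TopologicalSpace (L x)] [TopologicalSpace (TotalSpace ℂ L)]
  [FiberBundle ℂ L] [VectorBundle ℂ ℂ L] [ContMDiffVectorBundle ω ℂ L 𝓘(ℂ, ℂ)]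
  {B : SpecialParabolic E} {x₀ x : Y}

/-- The value of a section of `L²` at `x`, in the preferred trivialization. -/
def evalSq (x : Y) : HLL L →ₗ[ℂ] ℂ :=
  fiberCoordSq L x x ∘ₗ LinearMap.proj x ∘ₗ (HLL L).subtype

lemma evalSq_apply (x : Y) (τ : HLL L) : evalSq x τ = fiberCoordSq L x x (τ.1 x) := rfl

lemma HLL_ext {τ τ' : HLL L} (h : ∀ x, evalSq x τ = evalSq x τ') : τ = τ' := by
  refine Subtype.ext (funext fun x => ?_)
  rw [eq_fiberCoordSq_smul (mem_baseSet_self x) (τ.1 x),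
    eq_fiberCoordSq_smul (mem_baseSet_self x) (τ'.1 x), ← evalSq_apply, h, evalSq_apply]

lemma wedgeHLL_self (v : HEL L E) : wedgeHLL B v v = 0 :=
  Subtype.ext (funext fun _ => wedgeMap_self _)

lemma wedgeHLL_swap (v w : HEL L E) : wedgeHLL B w v = -wedgeHLL B v w :=
  Subtype.ext (funext fun _ => wedgeMap_swap _ _)

lemma wedgeHLL_add_smul (v w : HEL L E) (a b a' b' : ℂ) :
    wedgeHLL B (a • v + b • w) (a' • v + b' • w) = (a * b' - b * a') • wedgeHLL B v w := by
  simp only [map_add, map_smul, LinearMap.add_apply, LinearMap.smul_apply, wedgeHLL_self,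
    wedgeHLL_swap v w, smul_zero]
  module

/-- A section of `L²` is a multiple of the nonzero section `τ` if all minors vanish. -/
lemma exists_eq_smul_of_minors {τ τ' : HLL L} (hτ : τ ≠ 0)
    (h : ∀ x y, evalSq x τ' * evalSq y τ = evalSq y τ' * evalSq x τ) : ∃ c : ℂ, τ' = c • τ := by
  have h1 : ∃ x, evalSq x τ ≠ 0 := by
    by_contra! h0
    exact hτ (HLL_ext fun x => by rw [h0, map_zero])
  obtain ⟨x, hx⟩ := h1
  refine ⟨evalSq x τ' / evalSq x τ, HLL_ext fun y => ?_⟩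
  rw [map_smul, smul_eq_mul]
  field_simp
  rw [h y x]

/-- On the graph `v ∧ w` and `τ` are proportional. This means that their minors vanish, a polynomial
condition on `(v, w, τ)`, so it persists on the closure. The constant may become zero there. -/
lemma exists_wedgeHLL_eq_smul {t : Gr L E × Q L} (ht : t ∈ upsilon L B) {v w : HEL L E}
    (hv : v ∈ t.1.1) (hw : w ∈ t.1.1) {τ : HLL L} (hτ : τ ≠ 0)
    (htτ : t.2.1 = Projectivization.mk ℂ τ hτ) : ∃ c : ℂ, wedgeHLL B v w = c • τ := by
  set C : Set (Gr L E × Q L) := {t | ∀ v ∈ t.1.1, ∀ w ∈ t.1.1, ∀ (τ : HLL L) (hτ : τ ≠ 0),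
    t.2.1 = Projectivization.mk ℂ τ hτ →
      ∀ x y, evalSq x (wedgeHLL B v w) * evalSq y τ = evalSq y (wedgeHLL B v w) * evalSq x τ}
    with hCdef
  -- Changing basis multiplies the minors by a determinant and changing representative by a nonzero
  -- scalar, so one basis and one representative suffice.
  have hbasis : ∀ (t : Gr L E × Q L) (v₀ w₀ : HEL L E) (τ₀ : HLL L) (hτ₀ : τ₀ ≠ 0),
      t.1.1 = Submodule.span ℂ {v₀, w₀} → t.2.1 = Projectivization.mk ℂ τ₀ hτ₀ →
      (∀ x y, evalSq x (wedgeHLL B v₀ w₀) * evalSq y τ₀ =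
        evalSq y (wedgeHLL B v₀ w₀) * evalSq x τ₀) → t ∈ C := by
    intro t v₀ w₀ τ₀ hτ₀ ht1 ht2 h v hv w hw τ hτ htτ x y
    rw [ht1, Submodule.mem_span_pair] at hv hw
    obtain ⟨a, b, rfl⟩ := hv
    obtain ⟨a', b', rfl⟩ := hw
    rw [ht2, Projectivization.mk_eq_mk_iff'] at htτ
    obtain ⟨κ, rfl⟩ := htτ
    have := h x y
    rw [wedgeHLL_add_smul]
    simp only [map_smul, smul_eq_mul] at this ⊢
    have hκ : κ ≠ 0 := by
      rintro rfl
      exact hτ₀ (zero_smul ℂ τ)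
    refine mul_left_cancel₀ hκ ?_
    linear_combination (a * b' - b * a') * this
  have hclosed : @IsClosed _ (zariskiQuot (totalMk L E)) C := by
    refine @IsClosed.mk _ (zariskiQuot (totalMk L E)) _ ?_
    rw [isOpen_zariskiQuot_iff]
    refine ⟨⋃ x, ⋃ y, {u | evalSq x (wedgeHLL B u.1.1 u.1.2) * evalSq y u.2 -
      evalSq y (wedgeHLL B u.1.1 u.1.2) * evalSq x u.2 ≠ 0}, ?_, ?_⟩
    · refine @isOpen_iUnion _ _ (zariskiSpace _) _ fun x =>
        @isOpen_iUnion _ _ (zariskiSpace _) _ fun y => isOpen_zariski_ne ?_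
      set A := (HEL L E × HEL L E) × HLL L
      let f1 : A →ₗ[ℂ] HEL L E := LinearMap.fst ℂ _ _ ∘ₗ LinearMap.fst ℂ _ _
      let f2 : A →ₗ[ℂ] HEL L E := LinearMap.snd ℂ _ _ ∘ₗ LinearMap.fst ℂ _ _
      let f3 : A →ₗ[ℂ] HLL L := LinearMap.snd ℂ _ _
      have hw : ∀ x, (fun u : A => evalSq x (wedgeHLL B u.1.1 u.1.2)) ∈ polyFun A := fun x =>
        bilinear_mem_polyFun (((wedgeHLL B).compl₁₂ f1 f2).compr₂ (evalSq x))
      have ht : ∀ x, (fun u : A => evalSq x u.2) ∈ polyFun A := fun x =>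
        linear_mem_polyFun (evalSq x ∘ₗ f3)
      exact (polyFun A).sub_mem ((polyFun A).mul_mem (hw x) (ht y))
        ((polyFun A).mul_mem (hw y) (ht x))
    · intro u
      simp only [Set.mem_iUnion, Set.mem_ofPred_eq, Set.mem_compl_iff]
      have hspan : (totalMk L E u).1.1 = Submodule.span ℂ {u.1.1.1, u.1.1.2} := by
        simp [totalMk, grMk, Matrix.range_cons, Matrix.range_empty, Set.pair_comm]
      constructor
      · intro hu
        by_contra! h
        exact hu (hbasis _ _ _ u.1.2 u.2.2.1 hspan rfl fun x y => sub_eq_zero.1 (h x y))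
      · rintro ⟨x, y, h⟩ hu
        refine h (sub_eq_zero.2 (hu _ ?_ _ ?_ _ u.2.2.1 rfl x y))
        · rw [hspan]; exact Submodule.subset_span (by simp)
        · rw [hspan]; exact Submodule.subset_span (by simp)
  have hsub : upsilonRho L B ⊆ C := by
    rintro t ⟨v, w, σ, hσ, hspan, τ, hτ, hsq, htτ⟩
    refine hbasis t v w τ hτ hspan htτ fun x y => ?_
    have h1 : wedgeHLL B v w = τ := Subtype.ext (funext fun x => (hσ.2 x).trans (hsq x).symm)
    rw [h1, mul_comm]
  have hC : t ∈ C := @closure_minimal _ (zariskiQuot (totalMk L E)) _ _ hsub hclosed _ ht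
  exact exists_eq_smul_of_minors hτ fun x y => hC v hv w hw τ hτ htτ x y

/-- The zeros of `σ` are isolated and the coefficients are continuous, so the values away from the
zeros determine the form. -/
lemma HW_ext [PreconnectedSpace Y] {D : Finset Y} {σ : Cₛ^ω⟮𝓘(ℂ, ℂ); ℂ, L⟯} (hσ : σ ≠ 0)
    {η η' : HW L D} (h : ∀ x (hx : x ∉ D), σ x ≠ 0 → ∀ ξ ξ', η.1 ⟨x, hx⟩ ξ ξ' = η'.1 ⟨x, hx⟩ ξ ξ') :
    η = η' := by
  refine Subtype.ext (funext fun ⟨x₀, hx₀⟩ => LinearMap.ext fun ξ => LinearMap.ext fun ξ' => ?_)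
  obtain ⟨f, hf, hf'⟩ := η.2 x₀
  obtain ⟨g, hg, hg'⟩ := η'.2 x₀
  rw [if_neg hx₀] at hf' hg'
  have hD : ∀ᶠ x in 𝓝 x₀, x ∉ D := D.finite_toSet.isClosed.isOpen_compl.mem_nhds hx₀
  have h0 : f x₀ = g x₀ := by
    refine hf.eq_of_eventually_ne hg ?_
    filter_upwards [eventually_section_ne_zero hσ x₀, nhdsWithin_le_nhds hf',
      nhdsWithin_le_nhds hg',
      nhdsWithin_le_nhds hD, nhdsWithin_le_nhds (eventually_mem_chart_source x₀),
      nhdsWithin_le_nhds (eventually_mem_baseSet (F := ℂ) (V := L) x₀)]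
      with x hσx hfx hgx hxD hxs hxb
    obtain ⟨ξ, hξ⟩ := exists_dcoord_eq_one hxs
    have h1 := (hfx hxD ξ ξ).symm.trans ((congrArg _ (h x hxD hσx ξ ξ)).trans (hgx hxD ξ ξ))
    rw [hξ] at h1
    simpa using smul_left_injective ℂ (localFrame_tmul_ne_zero hxb) h1
  have h1 := hf'.self_of_nhds hx₀ ξ ξ'
  have h2 := hg'.self_of_nhds hx₀ ξ ξ'
  rw [h0, ← h2, pow_zero, one_smul, one_smul] at h1
  exact h1

variable {nabla : (∀ x, E x) → ∀ x, TangentSpace 𝓘(ℂ, ℂ) x →L[ℂ] E x}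
  (hn : B.IsAssociated nabla)

include hn

open scoped Classical in
/-- The form `σ² ∇(v/σ) ∧ ∇(w/σ)` extends over the zeros of `σ`, with at most double poles along
the parabolic divisor. -/
lemma exists_HW_eq_theta [PreconnectedSpace Y] {σ : Cₛ^ω⟮𝓘(ℂ, ℂ); ℂ, L⟯} (hσ : σ ≠ 0)
    (v w : HEL L E) {c : ℂ} (hc : ∀ y, wedgeMap B y (v.1 y) (w.1 y) = c • (σ y ⊗ₜ σ y)) :
    ∃ η : HW L B.weight.support, ∀ x (hx : x ∉ B.weight.support), σ x ≠ 0 → ∀ ξ ξ',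
      η.1 ⟨x, hx⟩ ξ ξ' = theta B nabla σ v.1 w.1 x ξ ξ' := by
  set V : Y → ∀ x, E x := fun x₀ x => contract L E x₀ x (v.1 x)
  set W : Y → ∀ x, E x := fun x₀ x => contract L E x₀ x (w.1 x)
  set g : Y → Y → ℂ := fun x₀ x => fiberCoord L x₀ x (σ x)
  -- The division-free expression `∇V ∧ ∇W - c dg²`, which makes sense at the zeros of `σ` too.
  set Φ : ∀ x₀ x, TangentSpace 𝓘(ℂ, ℂ) x → TangentSpace 𝓘(ℂ, ℂ) x → ℂ := fun x₀ x ξ ξ' =>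
    B.vol x (nabla (V x₀) x ξ) (nabla (W x₀) x ξ') -
      c * (mvfderiv 𝓘(ℂ, ℂ) (g x₀) x ξ * mvfderiv 𝓘(ℂ, ℂ) (g x₀) x ξ')
  let η : ∀ x : {x // x ∉ B.weight.support},
      TangentSpace 𝓘(ℂ, ℂ) x.1 →ₗ[ℂ] TangentSpace 𝓘(ℂ, ℂ) x.1 →ₗ[ℂ] L x.1 ⊗[ℂ] L x.1 := fun x =>
    LinearMap.mk₂ ℂ (fun ξ ξ' => Φ x x ξ ξ' • (localFrame L x x.1 ⊗ₜ localFrame L x x.1))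
      (fun a b d => by simp only [Φ, map_add, LinearMap.add_apply, ← add_smul]; congr 1; ring)
      (fun r a b => by
        simp only [Φ, map_smul, LinearMap.smul_apply, smul_eq_mul, smul_smul]; congr 1; ring)
      (fun a b d => by simp only [Φ, map_add, ← add_smul]; congr 1; ring)
      (fun r a b => by simp only [Φ, map_smul, smul_eq_mul, smul_smul]; congr 1; ring)
  have hη : ∀ x ξ ξ', η x ξ ξ' = Φ x x ξ ξ' • (localFrame L x x.1 ⊗ₜ localFrame L x x.1) :=
    fun x ξ ξ' => rfl
  have hθ : ∀ x (hx : x ∉ B.weight.support), σ x ≠ 0 → ∀ ξ ξ',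
      η ⟨x, hx⟩ ξ ξ' = theta B nabla σ v.1 w.1 x ξ ξ' := fun x hx hσx ξ ξ' =>
    (theta_eq hn (mem_baseSet_self x) hx (holFunAt_fiberCoord σ x) hσx (holAt_contract v x)
      (holAt_contract w x) hc ξ ξ').symm
  refine ⟨⟨η, fun x₀ => ?_⟩, hθ⟩
  -- Near `x₀` but away from it `σ` is nonzero, so the expressions in the trivializations at `x` and
  -- at `x₀` both compute the same form.
  have hloc : ∀ᶠ x in 𝓝 x₀, ∀ hx : x ∉ B.weight.support, ∀ ξ ξ',
      η ⟨x, hx⟩ ξ ξ' = Φ x₀ x ξ ξ' • (localFrame L x₀ x ⊗ₜ localFrame L x₀ x) := by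
    filter_upwards [eventually_nhdsWithin_iff.1 (eventually_section_ne_zero hσ x₀),
      (holAt_contract v x₀).eventually, (holAt_contract w x₀).eventually,
      (holFunAt_fiberCoord σ x₀).eventually,
      eventually_mem_baseSet (F := ℂ) (V := L) x₀] with x hσx hV hW hg hb hx ξ ξ'
    by_cases hxx : x = x₀
    · subst hxx; exact hη _ ξ ξ'
    · rw [hθ x hx (hσx hxx)]
      exact theta_eq hn hb hx hg (hσx hxx) hV hW hc ξ ξ'
  obtain ⟨rV, hrV, hrV'⟩ := exists_log_form hn x₀ (holAt_contract v x₀)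
  obtain ⟨rW, hrW, hrW'⟩ := exists_log_form hn x₀ (holAt_contract w x₀)
  have hg := holFunAt_fiberCoord σ x₀
  set k := if x₀ ∈ B.weight.support then 1 else 0
  have hk : (if x₀ ∈ B.weight.support then 2 else 0) = k + k := by
    simp only [k]; split_ifs <;> rfl
  -- Each of `∇V` and `∇W` absorbs one factor `coord ^ k`; the term `dg²` has no pole and keeps both
  -- factors.
  refine ⟨fun x => B.vol x (rV x) (rW x) - c * (coord x₀ x ^ k * coord x₀ x ^ k) *
    (chartDeriv x₀ (g x₀) x * chartDeriv x₀ (g x₀) x), ?_, ?_⟩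
  · have hk' := (holFunAt_coord x₀).pow k
    exact (B.vol_hol _ _ x₀ hrV hrW).sub ((((holFunAt_const c).mul (hk'.mul hk'))).mul
      (hg.chartDeriv.mul hg.chartDeriv))
  · filter_upwards [hloc, hrV', hrW', hg.eventually, eventually_mem_chart_source x₀]
      with x h1 h2 h3 h4 h5 hx ξ ξ'
    rw [h1 hx, smul_smul, hk, pow_add]
    congr 1
    have h6 := congrArg₂ (fun a b => B.vol x a b) (h2 hx ξ) (h3 hx ξ')
    simp only [map_smul, LinearMap.smul_apply, smul_eq_mul] at h6
    simp only [Φ]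
    rw [mvfderiv_eq_chartDeriv h5 h4.mdifferentiableAt,
      mvfderiv_eq_chartDeriv h5 h4.mdifferentiableAt]
    linear_combination h6

set_option maxHeartbeats 2000000 in
-- Existence: extend the form for one basis and one `σ`; `theta_add_smul` and `theta_congr` show
-- that the resulting linear map obeys the formula for all choices. Uniqueness: decomposable vectors
-- span, and `HW_ext` recovers the form from its values off the zeros of `σ`.
lemma existsUnique_isLambda [PreconnectedSpace Y] : ∃! Λ : BundleMap L B, IsLambda B nabla Λ := by
  have hex : ∀ t : upsilon L B, ∃ Λ : ⋀[ℂ]^2 t.1.1.1 →ₗ[ℂ] HW L B.weight.support,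
      ∀ (v w : t.1.1.1) (σ : Cₛ^ω⟮𝓘(ℂ, ℂ); ℂ, L⟯) (τ : HLL L) (hτ : τ ≠ 0),
      IsSquareOf L τ σ → t.1.2.1 = Projectivization.mk ℂ τ hτ →
      ∀ (x : Y) (hx : x ∉ B.weight.support), σ x ≠ 0 → ∀ ξ ξ',
        (Λ (exteriorPower.ιMulti ℂ 2 ![v, w])).1 ⟨x, hx⟩ ξ ξ' =
          theta B nabla σ v.1.1 w.1.1 x ξ ξ' := by
    intro t
    obtain ⟨σ, hσ, τ, hτ, hsq, htτ⟩ := t.1.2.2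
    obtain ⟨e, e', r, r', d, hr, hd⟩ :=
      exists_coordinates_of_finrank_eq_two (S := t.1.1.1) t.1.1.2
    obtain ⟨c, hc⟩ := exists_wedgeHLL_eq_smul t.2 e.2 e'.2 hτ htτ
    have hc' : ∀ y, wedgeMap B y (e.1.1 y) (e'.1.1 y) = c • (σ y ⊗ₜ σ y) := fun y => by
      rw [← hsq y, ← wedgeHLL_apply, hc]; rfl
    obtain ⟨η, hη⟩ := exists_HW_eq_theta hn hσ e.1 e'.1 hc'
    refine ⟨d.smulRight η, ?_⟩
    intro v w σ' τ' hτ' hsq' htτ' x hx hσ' ξ ξ'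
    have hκ := htτ'.symm.trans htτ
    rw [Projectivization.mk_eq_mk_iff'] at hκ
    obtain ⟨κ, hκ⟩ := hκ
    have hκ0 : κ ≠ 0 := by
      rintro rfl
      exact hτ' (by rw [← hκ, zero_smul])
    have hσσ : ∀ y, σ' y ⊗ₜ[ℂ] σ' y = κ • (σ y ⊗ₜ[ℂ] σ y) := fun y => by
      rw [← hsq' y, ← hsq y, ← hκ]; rfl
    have hσx : σ x ≠ 0 := by
      intro h
      have := hσσ x
      rw [h, TensorProduct.zero_tmul, smul_zero, tmul_self_eq_zero_iff] at this
      exact hσ' this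
    have hv : v.1 = r v • e.1 + r' v • e'.1 := congrArg Subtype.val (hr v)
    have hw : w.1 = r w • e.1 + r' w • e'.1 := congrArg Subtype.val (hr w)
    rw [hv, hw, theta_add_smul hn hx hσ', theta_congr hn hx hσx hκ0 hc' hσσ, ← hη x hx hσx,
      LinearMap.smulRight_apply, hd]
    rfl
  choose Λ hΛ using hex
  refine ⟨Λ, hΛ, fun Λ' hΛ' => funext fun t => ?_⟩
  obtain ⟨σ, hσ, τ, hτ, hsq, htτ⟩ := t.1.2.2
  refine exteriorSquare_linearMap_ext fun v w => HW_ext hσ fun x hx hσx ξ ξ' => ?_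
  rw [hΛ' t _ _ σ τ hτ hsq htτ x hx hσx, hΛ t _ _ σ τ hτ hsq htτ x hx hσx]

end Bundle

end CMCOne

namespace CMCOne

/-! ### Germs of meromorphic functions -/

section MeromorphicFunctions

variable {F u : ℂ → ℂ} {z₀ a : ℂ} {j : ℤ}

/-- A meromorphic germ that is not constant is a constant plus a nontrivial power times a unit. -/
lemma exists_normalForm (hF : MeromorphicAt F z₀) (hc : ∀ a, ¬∀ᶠ z in 𝓝[≠] z₀, F z = a) :
    ∃ (a : ℂ) (j : ℤ) (u : ℂ → ℂ), j ≠ 0 ∧ AnalyticAt ℂ u z₀ ∧ u z₀ ≠ 0 ∧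
      ∀ᶠ z in 𝓝[≠] z₀, F z = a + (z - z₀) ^ j * u z := by
  have key : ∀ a, ∃ (j : ℤ) (u : ℂ → ℂ), AnalyticAt ℂ u z₀ ∧ u z₀ ≠ 0 ∧
      ∀ᶠ z in 𝓝[≠] z₀, F z = a + (z - z₀) ^ j * u z := by
    intro a
    have hm : MeromorphicAt (fun z => F z - a) z₀ := hF.sub (MeromorphicAt.const a z₀)
    have htop : meromorphicOrderAt (fun z => F z - a) z₀ ≠ ⊤ := by
      rw [ne_eq, meromorphicOrderAt_eq_top_iff]
      exact fun h => hc a (h.mono fun z hz => sub_eq_zero.1 hz)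
    obtain ⟨u, hu, hu0, h⟩ := (meromorphicOrderAt_ne_top_iff hm).1 htop
    exact ⟨_, u, hu, hu0, h.mono fun z hz => sub_eq_iff_eq_add'.1 hz⟩
  obtain ⟨j, u, hu, hu0, h⟩ := key 0
  by_cases hj : j = 0
  -- If the germ is a unit, its value is subtracted. The new exponent cannot be zero, since that
  -- would force `v z₀ = 0`.
  · obtain ⟨k, v, hv, hv0, h'⟩ := key (u z₀)
    refine ⟨_, k, v, ?_, hv, hv0, h'⟩
    rintro rfl
    have h1 : ∀ᶠ z in 𝓝[≠] z₀, u z = u z₀ + v z := by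
      filter_upwards [h, h'] with z h1 h2
      rw [hj] at h1
      simpa using h1.symm.trans h2
    have h2 := tendsto_nhds_unique_of_eventuallyEq
      (hu.continuousAt.tendsto.mono_left nhdsWithin_le_nhds)
      ((continuousAt_const.add hv.continuousAt).tendsto.mono_left nhdsWithin_le_nhds) h1
    exact hv0 (by simpa using h2)
  · exact ⟨0, j, u, hj, hu, hu0, h⟩

lemma hasDerivAt_sub_zpow (j : ℤ) {z : ℂ} (hz : z - z₀ ≠ 0) :
    HasDerivAt (fun z => (z - z₀) ^ j) (j * (z - z₀) ^ (j - 1)) z :=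
  (hasDerivAt_zpow j (z - z₀) (Or.inl hz)).comp_sub_const z z₀

lemma eventually_analyticAt_of_normalForm (hu : AnalyticAt ℂ u z₀)
    (h : ∀ᶠ z in 𝓝[≠] z₀, F z = a + (z - z₀) ^ j * u z) :
    ∀ᶠ z in 𝓝[≠] z₀, AnalyticAt ℂ F z := by
  filter_upwards [eventually_eventually_nhdsWithin.2 h,
    nhdsWithin_le_nhds hu.eventually_analyticAt, self_mem_nhdsWithin] with z hz huz hne
  rw [(isOpen_compl_singleton.nhdsWithin_eq hne : 𝓝[{z₀}ᶜ] z = 𝓝 z)] at hz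
  have h1 : AnalyticAt ℂ (fun z => (z - z₀) ^ j) z :=
    (analyticAt_id.sub analyticAt_const).fun_zpow (sub_ne_zero.2 hne)
  exact (analyticAt_const.add (h1.mul huz)).congr (hz.mono fun _ h => h.symm)

/-- The derivative is `(z - z₀)^(j-1) (j u + (z - z₀) u')`, whose second factor is `j u(z₀) ≠ 0` at
the centre. -/
lemma eventually_deriv_ne_zero_of_normalForm (hj : j ≠ 0) (hu : AnalyticAt ℂ u z₀)
    (hu0 : u z₀ ≠ 0) (h : ∀ᶠ z in 𝓝[≠] z₀, F z = a + (z - z₀) ^ j * u z) :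
    ∀ᶠ z in 𝓝[≠] z₀, deriv F z ≠ 0 := by
  have hlim : ∀ᶠ z in 𝓝 z₀, (j : ℂ) * u z + (z - z₀) * deriv u z ≠ 0 := by
    have h1 : ContinuousAt (fun z => (j : ℂ) * u z + (z - z₀) * deriv u z) z₀ :=
      (continuousAt_const.mul hu.continuousAt).add
        ((continuousAt_id.sub continuousAt_const).mul hu.deriv.continuousAt)
    refine h1.eventually_ne ?_
    simp [hj, hu0]
  filter_upwards [eventually_eventually_nhdsWithin.2 h, nhdsWithin_le_nhds hlim,
    nhdsWithin_le_nhds hu.eventually_analyticAt, self_mem_nhdsWithin] with z hz h0 huz hne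
  rw [(isOpen_compl_singleton.nhdsWithin_eq hne : 𝓝[{z₀}ᶜ] z = 𝓝 z)] at hz
  have hz0 : z - z₀ ≠ 0 := sub_ne_zero.2 hne
  have h2 := ((hasDerivAt_sub_zpow j hz0).mul huz.differentiableAt.hasDerivAt).const_add a
  have h3 : deriv F z = (z - z₀) ^ (j - 1) * ((j : ℂ) * u z + (z - z₀) * deriv u z) := by
    rw [Filter.EventuallyEq.deriv_eq hz]
    refine h2.deriv.trans ?_
    have h4 : (z - z₀) ^ j = (z - z₀) ^ (j - 1) * (z - z₀) := by
      rw [← zpow_add_one₀ hz0, sub_add_cancel]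
    rw [h4]
    ring
  rw [h3]
  exact mul_ne_zero (zpow_ne_zero _ hz0) h0

end MeromorphicFunctions

/-! ### Discrete sets and powers of the coordinate -/

section Surface

variable {Y : Type*} [TopologicalSpace Y]

lemma finite_of_eventually_nhdsNE [CompactSpace Y] {p : Y → Prop}
    (h : ∀ x, ∀ᶠ y in 𝓝[≠] x, p y) : {x | ¬p x}.Finite := by
  have h1 : ∀ x, ({x} ∪ {y | p y} : Set Y) ∈ 𝓝 x := by
    intro x
    filter_upwards [eventually_nhdsWithin_iff.1 (h x)] with y hy
    by_cases hyx : y = x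
    · exact Or.inl hyx
    · exact Or.inr (hy hyx)
  obtain ⟨t, -, ht⟩ := isCompact_univ.elim_nhds_subcover _ fun x _ => h1 x
  refine t.finite_toSet.subset fun x hx => ?_
  obtain ⟨y, hy, hxy⟩ := Set.mem_iUnion₂.1 (ht (Set.mem_univ x))
  rcases hxy with rfl | hxy
  · exact hy
  · exact absurd hxy hx

variable [ChartedSpace ℂ Y] {x₀ : Y}

lemma coord_chart_symm {z : ℂ} (hz : z ∈ (chartAt ℂ x₀).target) :
    coord x₀ ((chartAt ℂ x₀).symm z) = z - chartAt ℂ x₀ x₀ := by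
  rw [coord, (chartAt ℂ x₀).right_inv hz]

lemma eventually_mem_chart_target (x₀ : Y) : ∀ᶠ z in 𝓝 (chartAt ℂ x₀ x₀),
    z ∈ (chartAt ℂ x₀).target := (chartAt ℂ x₀).open_target.mem_nhds (mem_chart_target ℂ x₀)

variable [T2Space Y] [IsManifold 𝓘(ℂ, ℂ) ω Y]

lemma eventually_nhds_of_nhdsNE {p : Y → Prop} (h : ∀ᶠ x in 𝓝[≠] x₀, p x) :
    ∀ᶠ x in 𝓝[≠] x₀, ∀ᶠ y in 𝓝 x, p y := by
  filter_upwards [eventually_eventually_nhdsWithin.2 h, self_mem_nhdsWithin] with x hx hne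
  rwa [(isOpen_compl_singleton.nhdsWithin_eq hne : 𝓝[{x₀}ᶜ] x = 𝓝 x)] at hx

/-- Analyticity in the chart centred at a nearby point. -/
lemma holFunAt_of_analyticAt_chart {f : Y → ℂ} {x : Y} (hx : x ∈ (chartAt ℂ x₀).source)
    (hf : AnalyticAt ℂ (fun z => f ((chartAt ℂ x₀).symm z)) (chartAt ℂ x₀ x)) :
    HolFunAt f x := by
  have h1 : ContMDiffAt 𝓘(ℂ, ℂ) 𝓘(ℂ, ℂ) ω (chartAt ℂ x₀) x :=
    contMDiffAt_of_mem_maximalAtlas (IsManifold.chart_mem_maximalAtlas x₀) hx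
  have h2 : ContMDiffAt 𝓘(ℂ, ℂ) 𝓘(ℂ, ℂ) ω (fun z => f ((chartAt ℂ x₀).symm z))
      (chartAt ℂ x₀ x) := hf.contDiffAt.contMDiffAt
  refine HolFunAt.congr (h2.comp x h1) ?_
  filter_upwards [(chartAt ℂ x₀).open_source.mem_nhds hx] with y hy
  simp [(chartAt ℂ x₀).left_inv hy]

lemma holFunAt_coord_zpow {x : Y} (hx : x ∈ (chartAt ℂ x₀).source) (hne : x ≠ x₀) (k : ℤ) :
    HolFunAt (fun y => coord x₀ y ^ k) x := by
  refine holFunAt_of_analyticAt_chart hx ?_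
  have h0 : chartAt ℂ x₀ x - chartAt ℂ x₀ x₀ ≠ 0 := coord_ne_zero hx hne
  have h1 : AnalyticAt ℂ (fun z => (z - chartAt ℂ x₀ x₀) ^ k) (chartAt ℂ x₀ x) :=
    (analyticAt_id.sub analyticAt_const).fun_zpow h0
  refine h1.congr ?_
  filter_upwards [(chartAt ℂ x₀).open_target.mem_nhds ((chartAt ℂ x₀).map_source hx)] with z hz
  rw [coord_chart_symm hz]

/-- The logarithmic derivative of `z^k`; it contributes the order of a section to the residue of its
connection form. -/
lemma mvfderiv_coord_zpow {x : Y} (hx : x ∈ (chartAt ℂ x₀).source) (hne : x ≠ x₀) (k : ℤ)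
    (ξ : TangentSpace 𝓘(ℂ, ℂ) x) :
    coord x₀ x * mvfderiv 𝓘(ℂ, ℂ) (fun y => coord x₀ y ^ k) x ξ =
      dcoord x₀ x ξ * (k * coord x₀ x ^ k) := by
  have h0 : chartAt ℂ x₀ x - chartAt ℂ x₀ x₀ ≠ 0 := coord_ne_zero hx hne
  rw [mvfderiv_eq_chartDeriv hx (holFunAt_coord_zpow hx hne k).mdifferentiableAt, chartDeriv]
  have h1 : (fun z => coord x₀ ((chartAt ℂ x₀).symm z) ^ k) =ᶠ[𝓝 (chartAt ℂ x₀ x)]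
      fun z => (z - chartAt ℂ x₀ x₀) ^ k := by
    filter_upwards [(chartAt ℂ x₀).open_target.mem_nhds ((chartAt ℂ x₀).map_source hx)] with z hz
    rw [coord_chart_symm hz]
  rw [h1.deriv_eq, (hasDerivAt_sub_zpow k h0).deriv]
  have h4 : coord x₀ x ^ k = coord x₀ x ^ (k - 1) * coord x₀ x := by
    rw [← zpow_add_one₀ (coord_ne_zero hx hne), sub_add_cancel]
  rw [h4]
  simp only [coord]
  ring

end Surface

/-! ### Eigenvalues of the residue -/

section LinearAlgebra

/-- In a plane, an eigenvector outside the line `W` of eigenvectors for `a` has the other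
eigenvalue. -/
lemma eigenvalue_eq_ite {V : Type*} [AddCommGroup V] [Module ℂ V] (hV : Module.finrank ℂ V = 2)
    {Γ : Module.End ℂ V} {W : Submodule ℂ V} {a b c : ℂ} (hab : a ≠ b)
    (hW : W = Γ.eigenspace a) (hW1 : Module.finrank ℂ W = 1) (hb : Γ.HasEigenvalue b)
    {e : V} (he : e ≠ 0) (hc : Γ e = c • e) [Decidable (Submodule.span ℂ {e} = W)] :
    c = if Submodule.span ℂ {e} = W then a else b := by
  have hfin : FiniteDimensional ℂ V := Module.finite_of_finrank_pos (by omega)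
  split_ifs with h
  · have h1 : e ∈ Γ.eigenspace a := by
      rw [← hW, ← h]; exact Submodule.mem_span_singleton_self e
    rw [Module.End.mem_eigenspace_iff, hc] at h1
    exact smul_left_injective ℂ he h1
  · by_contra hcb
    have hca : c ≠ a := by
      rintro rfl
      refine h (Submodule.eq_of_le_of_finrank_eq ?_ ?_)
      · rw [Submodule.span_singleton_le_iff_mem, hW, Module.End.mem_eigenspace_iff, hc]
      · rw [hW1, finrank_span_singleton he]
    obtain ⟨u, hu⟩ := hb.exists_hasEigenvector
    obtain ⟨w, hw, hw0⟩ := W.exists_mem_ne_zero_of_ne_bot (by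
      rintro rfl
      simp at hW1)
    -- Three distinct eigenvalues would need three independent eigenvectors in a plane.
    have hli := Module.End.eigenvectors_linearIndependent' Γ ![a, b, c] (by
      intro i j hij
      fin_cases i <;> fin_cases j <;> simp_all [eq_comm]) ![w, u, e] (by
      intro i
      fin_cases i
      · exact ⟨(hW ▸ hw : w ∈ Γ.eigenspace a), hw0⟩
      · exact hu
      · exact ⟨Module.End.mem_eigenspace_iff.2 hc, he⟩)
    have := hli.fintype_card_le_finrank
    simp [hV] at this

end LinearAlgebra

end CMCOne

namespace CMCOne

/-! ### Invariant line subbundles have parabolic degree zero -/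

section InvariantSubbundle

variable {Y : Type*} [TopologicalSpace Y] [T2Space Y] [ChartedSpace ℂ Y] [IsManifold 𝓘(ℂ, ℂ) ω Y]
  {E : Y → Type*} [∀ x, AddCommGroup (E x)] [∀ x, Module ℂ (E x)]
  [∀ x, TopologicalSpace (E x)] [∀ x, IsTopologicalAddGroup (E x)]
  [∀ x, ContinuousSMul ℂ (E x)] [TopologicalSpace (TotalSpace (Fin 2 → ℂ) E)]
  [FiberBundle (Fin 2 → ℂ) E] [VectorBundle ℂ (Fin 2 → ℂ) E]
  [ContMDiffVectorBundle ω (Fin 2 → ℂ) E 𝓘(ℂ, ℂ)]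
  {B : SpecialParabolic E} {x₀ x : Y} {e e' : ∀ x, E x}

lemma HolAt.eventually_ne_zero (he : HolAt (Fin 2 → ℂ) e x₀) (h0 : e x₀ ≠ 0) :
    ∀ᶠ x in 𝓝 x₀, e x ≠ 0 := by
  rcases he.eventually_eq_zero_or with h | h
  · exact absurd h.self_of_nhds h0
  · filter_upwards [eventually_nhdsWithin_iff.1 h] with x hx
    by_cases hxx : x = x₀
    · rwa [hxx]
    · exact hx hxx

include B in
-- Pairing with a local section through `vol` reduces the identity to one between holomorphic
-- functions.
lemma HolAt.eq_of_eventually_ne (he : HolAt (Fin 2 → ℂ) e x₀) (he' : HolAt (Fin 2 → ℂ) e' x₀)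
    (h : ∀ᶠ x in 𝓝[≠] x₀, e x = e' x) : e x₀ = e' x₀ := by
  by_contra hne
  obtain ⟨b, hb⟩ := exists_vol_ne_zero (B := B) (sub_ne_zero.2 hne)
  obtain ⟨β, hβ, rfl⟩ := exists_holAt_apply_eq (F := Fin 2 → ℂ) x₀ b
  refine hb ?_
  rw [map_sub, LinearMap.sub_apply, sub_eq_zero]
  exact (B.vol_hol e β x₀ he hβ).eq_of_eventually_ne (B.vol_hol e' β x₀ he' hβ)
    (h.mono fun x hx => by rw [hx])

include B in
/-- Nonvanishing holomorphic germs that differ by a power of the coordinate are equal. -/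
lemma HolAt.eq_of_eq_zpow_smul (he : HolAt (Fin 2 → ℂ) e x₀) (he' : HolAt (Fin 2 → ℂ) e' x₀)
    (h0 : e x₀ ≠ 0) (h0' : e' x₀ ≠ 0) {k : ℤ}
    (h : ∀ᶠ x in 𝓝[≠] x₀, e' x = coord x₀ x ^ k • e x) : k = 0 ∧ e' x₀ = e x₀ := by
  rcases Int.eq_nat_or_neg k with ⟨n, rfl | rfl⟩
  · have h1 := he'.eq_of_eventually_ne (B := B) (he.smul ((holFunAt_coord x₀).pow n))
      (h.mono fun x hx => by rw [hx, zpow_natCast])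
    rw [coord_self] at h1
    rcases eq_or_ne n 0 with rfl | hn
    · exact ⟨rfl, by rw [h1, pow_zero, one_smul]⟩
    · rw [zero_pow hn, zero_smul] at h1
      exact absurd h1 h0'
  · have h1 := he.eq_of_eventually_ne (B := B) (he'.smul ((holFunAt_coord x₀).pow n)) (by
      filter_upwards [h, eventually_coord_ne_zero x₀] with x hx hc
      rw [hx, smul_smul, zpow_neg, zpow_natCast, mul_inv_cancel₀ (pow_ne_zero _ hc), one_smul])
    rw [coord_self] at h1
    rcases eq_or_ne n 0 with rfl | hn
    · exact ⟨rfl, by rw [h1, pow_zero, one_smul]⟩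
    · rw [zero_pow hn, zero_smul] at h1
      exact absurd h1 h0

/-- The section `s` is meromorphic and not zero: `n` is its divisor, and `e x₀` is the local frame
near `x₀` of the line subbundle that it spans. -/
structure IsMeromorphicSection (s : ∀ x, E x) (e : Y → ∀ x, E x) (n : Y → ℤ) : Prop where
  hol : ∀ x₀, HolAt (Fin 2 → ℂ) (e x₀) x₀
  ne_zero : ∀ x₀, e x₀ x₀ ≠ 0
  eq_smul : ∀ x₀, ∀ᶠ x in 𝓝[≠] x₀, s x = coord x₀ x ^ n x₀ • e x₀ x

variable {s : ∀ x, E x} {e : Y → ∀ x, E x} {n : Y → ℤ}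

namespace IsMeromorphicSection

lemma eventually_holAt (hs : IsMeromorphicSection s e n) (x₀ : Y) :
    ∀ᶠ x in 𝓝[≠] x₀, HolAt (Fin 2 → ℂ) s x := by
  filter_upwards [eventually_nhds_of_nhdsNE (hs.eq_smul x₀),
    nhdsWithin_le_nhds (hs.hol x₀).eventually,
    nhdsWithin_le_nhds (eventually_mem_chart_source x₀), self_mem_nhdsWithin] with x h1 h2 h3 hne
  exact (h2.smul (holFunAt_coord_zpow h3 hne _)).congr h1

lemma eventually_ne_zero (hs : IsMeromorphicSection s e n) (x₀ : Y) :
    ∀ᶠ x in 𝓝[≠] x₀, s x ≠ 0 := by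
  filter_upwards [hs.eq_smul x₀, eventually_coord_ne_zero x₀,
    nhdsWithin_le_nhds ((hs.hol x₀).eventually_ne_zero (hs.ne_zero x₀))] with x h1 h2 h3
  rw [h1]
  exact smul_ne_zero (zpow_ne_zero _ h2) h3

include B in
-- Near `x₀` and off it, `s` is holomorphic and nonzero, so it has order zero and is its own local
-- frame. Hence the divisor is discrete, and the lines spanned by the various frames agree nearby.
lemma eventually_order_eq_zero (hs : IsMeromorphicSection s e n) (x₀ : Y) :
    ∀ᶠ x in 𝓝[≠] x₀, n x = 0 ∧ s x = e x x := by
  filter_upwards [hs.eventually_holAt x₀, hs.eventually_ne_zero x₀] with x h1 h2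
  exact (hs.hol x).eq_of_eq_zpow_smul (B := B) h1 (hs.ne_zero x) h2 (hs.eq_smul x)

include B in
lemma eventually_span_eq (hs : IsMeromorphicSection s e n) (x₀ : Y) :
    ∀ᶠ x in 𝓝 x₀, Submodule.span ℂ {e x x} = Submodule.span ℂ {e x₀ x} := by
  filter_upwards [eventually_nhdsWithin_iff.1 (hs.eventually_order_eq_zero (B := B) x₀),
    eventually_nhdsWithin_iff.1 (hs.eq_smul x₀),
    eventually_nhdsWithin_iff.1 (eventually_coord_ne_zero x₀)] with x h1 h2 h3
  by_cases hxx : x = x₀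
  · rw [hxx]
  · rw [← (h1 hxx).2, h2 hxx]
    exact Submodule.span_singleton_smul_eq (zpow_ne_zero _ (h3 hxx)).isUnit _

include B in
lemma isLineSubbundle (hs : IsMeromorphicSection s e n) :
    IsLineSubbundle fun x => Submodule.span ℂ {e x x} := fun x₀ =>
  ⟨e x₀, hs.hol x₀, hs.ne_zero x₀, hs.eventually_span_eq (B := B) x₀⟩

include B in
lemma hasDegree (hs : IsMeromorphicSection s e n) {m : Y →₀ ℤ} (hm : ∀ x, m x = n x) :
    HasDegree (fun x => Submodule.span ℂ {e x x}) (m.sum fun _ k => k) := by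
  refine ⟨s, m, fun x₀ => ⟨e x₀, hs.hol x₀, hs.ne_zero x₀, ?_, ?_⟩, rfl⟩
  · filter_upwards [hs.eventually_span_eq (B := B) x₀] with x hx
    rw [hx]
    exact Submodule.mem_span_singleton_self _
  · rw [hm]; exact hs.eq_smul x₀

end IsMeromorphicSection

variable {nabla : (∀ x, E x) → ∀ x, TangentSpace 𝓘(ℂ, ℂ) x →L[ℂ] E x}
  (hn : B.IsAssociated nabla)

include hn

/-- The residue of the connection, with value `0` off the parabolic divisor. -/
lemma exists_log_form_residue (x₀ : Y) {e : ∀ x, E x} (he : HolAt (Fin 2 → ℂ) e x₀) :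
    ∃ (Γ : Module.End ℂ (E x₀)) (r : ∀ x, E x), HolAt (Fin 2 → ℂ) r x₀ ∧ r x₀ = Γ (e x₀) ∧
      (∀ᶠ x in 𝓝[≠] x₀, ∀ ξ, coord x₀ x • nabla e x ξ = dcoord x₀ x ξ • r x) ∧
      (x₀ ∉ B.weight.support → Γ = 0) ∧
      (x₀ ∈ B.weight.support → Γ.HasEigenvalue (-((B.weight x₀ / 2 : ℝ) : ℂ)) ∧
        B.W x₀ = Γ.eigenspace ((B.weight x₀ / 2 : ℝ) : ℂ)) := by
  by_cases hx₀ : x₀ ∈ B.weight.support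
  · obtain ⟨Γ, hΓ, h1, h2⟩ := hn.residue x₀ hx₀
    obtain ⟨r, hr, hr0, h⟩ := hΓ e he
    exact ⟨Γ, r, hr, hr0, h, fun h => absurd hx₀ h, fun _ => ⟨h1, h2⟩⟩
  · obtain ⟨r, hr, h⟩ := exists_log_form hn x₀ he
    refine ⟨0, fun x => coord x₀ x • r x, hr.smul (holFunAt_coord x₀), ?_, ?_, fun _ => rfl,
      fun h => absurd h hx₀⟩
    · simp [coord_self]
    · filter_upwards [nhdsWithin_le_nhds h, eventually_notMem_support (B := B) x₀] with x hx hxD ξ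
      have := hx hxD ξ
      rw [if_neg hx₀, pow_zero, one_smul] at this
      rw [this, smul_comm]

open scoped Classical in
/-- Along a meromorphic section `s` with `∇s` parallel to `s`, the connection form has simple poles;
its residues are given by the divisor of `s` and by the position of the parabolic lines. -/
lemma exists_connection_form (hs : IsMeromorphicSection s e n)
    (hinv : ∀ x₀, ∀ᶠ x in 𝓝[≠] x₀, ∀ ξ, B.vol x (nabla s x ξ) (s x) = 0) (x₀ : Y) :
    ∃ ρ : Y → ℂ, HolFunAt ρ x₀ ∧
      ρ x₀ = (((if Submodule.span ℂ {e x₀ x₀} = B.W x₀ then B.weight x₀ else -B.weight x₀) / 2 :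
        ℝ) : ℂ) ∧
      ∀ᶠ x in 𝓝[≠] x₀, ∀ ξ, coord x₀ x • nabla s x ξ = (dcoord x₀ x ξ * (n x₀ + ρ x)) • s x := by
  obtain ⟨Γ, r, hr, hr0, hre, hΓ0, hΓ⟩ := exists_log_form_residue hn x₀ (hs.hol x₀)
  obtain ⟨b, hb⟩ := exists_vol_ne_zero (B := B) (hs.ne_zero x₀)
  obtain ⟨β, hβ, rfl⟩ := exists_holAt_apply_eq (F := Fin 2 → ℂ) x₀ b
  have hnum := B.vol_hol r β x₀ hr hβ
  have hden := B.vol_hol (e x₀) β x₀ (hs.hol x₀) hβ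
  -- The factor in `r = ρ e`, written as a quotient so that it is visibly holomorphic. The
  -- proportionality itself is proved below.
  set ρ : Y → ℂ := fun x => B.vol x (r x) (β x) / B.vol x (e x₀ x) (β x)
  have hρ : HolFunAt ρ x₀ := hnum.div hden hb
  have hform : ∀ᶠ x in 𝓝[≠] x₀, ∀ ξ, coord x₀ x • nabla s x ξ =
      dcoord x₀ x ξ • (coord x₀ x ^ n x₀ • (r x + (n x₀ : ℂ) • e x₀ x)) := by
    filter_upwards [eventually_nhds_of_nhdsNE (hs.eq_smul x₀), hs.eventually_holAt x₀, hre,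
      nhdsWithin_le_nhds (hs.hol x₀).eventually,
      nhdsWithin_le_nhds (eventually_mem_chart_source x₀), self_mem_nhdsWithin,
      eventually_notMem_support (B := B) x₀] with x h1 h2 h3 h4 h5 hne hxD ξ
    have hz := holFunAt_coord_zpow h5 hne (n x₀)
    rw [nabla_congr hn hxD h2 (h4.smul hz) h1, nabla_smul hn hxD hz h4, smul_add, smul_smul,
      mul_comm, ← smul_smul, h3, smul_smul _ _ (e x₀ x), mvfderiv_coord_zpow h5 hne]
    module
  -- With `s = z^n e`, the Leibniz rule gives `z ∇s = z^n (r + n e) dz`, so `∇s ∧ s = 0` forces `r ∧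
  -- e = 0` off `x₀`, and by continuity also at `x₀`.
  have hpar : ∀ᶠ x in 𝓝 x₀, B.vol x (e x₀ x) (r x) = 0 := by
    have hne : ∀ᶠ x in 𝓝[≠] x₀, B.vol x (e x₀ x) (r x) = 0 := by
      filter_upwards [hform, hinv x₀, hs.eq_smul x₀, eventually_coord_ne_zero x₀,
        nhdsWithin_le_nhds (eventually_mem_chart_source x₀)] with x h1 h2 h3 h4 h5
      obtain ⟨ξ, hξ⟩ := exists_dcoord_eq_one h5
      have h6 : B.vol x (coord x₀ x • nabla s x ξ) (s x) = 0 := by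
        rw [map_smul, LinearMap.smul_apply, h2, smul_zero]
      rw [h1, h3, hξ] at h6
      simp only [map_smul, map_add, LinearMap.smul_apply, LinearMap.add_apply, B.vol_self,
        smul_eq_mul, mul_zero, add_zero, one_mul] at h6
      rw [vol_swap]
      have h7 := zpow_ne_zero (n x₀) h4
      simpa [h7] using h6
    have h0 := (B.vol_hol (e x₀) r x₀ (hs.hol x₀) hr).eq_of_eventually_ne (holFunAt_const 0) hne
    filter_upwards [eventually_nhdsWithin_iff.1 hne] with x hx
    by_cases hxx : x = x₀
    · rwa [hxx]
    · exact hx hxx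
  have hrρ : ∀ᶠ x in 𝓝 x₀, r x = ρ x • e x₀ x := by
    filter_upwards [hpar, (hs.hol x₀).eventually_ne_zero (hs.ne_zero x₀),
      hden.continuousAt.eventually_ne hb] with x h1 h2 h3
    obtain ⟨c, hc⟩ := exists_eq_smul_of_vol_eq_zero h2 h1
    have h4 : ρ x = c := by
      simp only [ρ, hc, map_smul, LinearMap.smul_apply, smul_eq_mul]
      exact mul_div_cancel_right₀ c h3
    rw [h4, hc]
  refine ⟨ρ, hρ, ?_, ?_⟩
  -- The invariant line is an eigenline of the residue: its eigenvalue is `α/2` if it is the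
  -- parabolic line and `-α/2` otherwise.
  · have h1 : Γ (e x₀ x₀) = ρ x₀ • e x₀ x₀ := by rw [← hr0, hrρ.self_of_nhds]
    by_cases hx₀ : x₀ ∈ B.weight.support
    · have hα := (B.weight_mem x₀ hx₀).1
      rw [eigenvalue_eq_ite (finrank_fiber x₀) (a := ((B.weight x₀ / 2 : ℝ) : ℂ)) ?_ (hΓ hx₀).2
        (B.finrank_W x₀ hx₀) (hΓ hx₀).1 (hs.ne_zero x₀) h1]
      · split_ifs <;> push_cast <;> ring
      · intro h
        have h2 : B.weight x₀ / 2 = -(B.weight x₀ / 2) := by exact_mod_cast h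
        linarith
    · have h2 : B.weight x₀ = 0 := Finsupp.notMem_support_iff.1 hx₀
      rw [hΓ0 hx₀, LinearMap.zero_apply, eq_comm, smul_eq_zero] at h1
      rw [h1.resolve_right (hs.ne_zero x₀), h2]
      simp
  · filter_upwards [hform, nhdsWithin_le_nhds hrρ, hs.eq_smul x₀] with x h1 h2 h3 ξ
    rw [h1, h2, h3]
    module

open scoped Classical in
/-- A meromorphic section `s` with `∇s` parallel to `s` spans a line subbundle of parabolic
degree `0`. The nonconstant meromorphic function `f` serves to apply the residue theorem. -/
theorem exists_parDegree_eq_zero [CompactSpace Y] (hs : IsMeromorphicSection s e n)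
    (hinv : ∀ x₀, ∀ᶠ x in 𝓝[≠] x₀, ∀ ξ, B.vol x (nabla s x ξ) (s x) = 0) {f : Y → ℂ}
    (hf : ∀ x₀ : Y, ∃ (a : ℂ) (j : ℤ) (u : ℂ → ℂ), j ≠ 0 ∧ AnalyticAt ℂ u (chartAt ℂ x₀ x₀) ∧
      u (chartAt ℂ x₀ x₀) ≠ 0 ∧ ∀ᶠ z in 𝓝[≠] (chartAt ℂ x₀ x₀),
        f ((chartAt ℂ x₀).symm z) = a + (z - chartAt ℂ x₀ x₀) ^ j * u z) :
    ∃ (N : ∀ x, Submodule ℂ (E x)) (d : ℤ), IsLineSubbundle N ∧ HasDegree N d ∧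
      B.parDegree N d = 0 := by
  set m : Y →₀ ℤ := Finsupp.ofSupportFinite n (finite_of_eventually_nhdsNE fun x₀ =>
    (hs.eventually_order_eq_zero (B := B) x₀).mono fun x hx => hx.1)
  set N : ∀ x, Submodule ℂ (E x) := fun x => Submodule.span ℂ {e x x}
  refine ⟨N, m.sum fun _ k => k, hs.isLineSubbundle (B := B),
    hs.hasDegree (B := B) fun _ => rfl, ?_⟩
  set R : Y → ℝ := fun x => if N x = B.W x then B.weight x else -B.weight x
  set S := m.support ∪ B.weight.support
  set c : Y →₀ ℂ := Finsupp.onFinset S (fun x => n x + ((R x / 2 : ℝ) : ℂ)) (by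
    intro x hx
    by_contra hxS
    simp only [S, Finset.mem_union, not_or, Finsupp.notMem_support_iff] at hxS
    have h1 : n x = 0 := hxS.1
    refine hx ?_
    simp only [R, hxS.2, h1]
    simp)
  -- The connection form `θ`, defined by `∇s = θ s`, is written as `h df`; the choice of `h` is
  -- forced wherever `s` and `df` are nonzero, which is all that the residue theorem sees.
  set P : Y → ℂ → Prop := fun x c => ∀ ξ, nabla s x ξ = (c * mvfderiv 𝓘(ℂ, ℂ) f x ξ) • s x
  set h : Y → ℂ := fun x => Classical.epsilon (P x)
  have hloc : ∀ x₀, ∃ ρ : ℂ → ℂ, AnalyticAt ℂ ρ (chartAt ℂ x₀ x₀) ∧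
      ρ (chartAt ℂ x₀ x₀) = c x₀ ∧ ∀ᶠ z in 𝓝[≠] (chartAt ℂ x₀ x₀),
        deriv (fun z => f ((chartAt ℂ x₀).symm z)) z ≠ 0 ∧
        h ((chartAt ℂ x₀).symm z) = ρ z / ((z - chartAt ℂ x₀ x₀) *
          deriv (fun z => f ((chartAt ℂ x₀).symm z)) z) := by
    intro x₀
    obtain ⟨ρ, hρ, hρ0, hρs⟩ := exists_connection_form hn hs hinv x₀
    obtain ⟨a, j, u, hj, hu, hu0, hfu⟩ := hf x₀
    refine ⟨fun z => n x₀ + ρ ((chartAt ℂ x₀).symm z), analyticAt_const.add (holFunAt_iff.1 hρ),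
      ?_, ?_⟩
    · simp only [(chartAt ℂ x₀).left_inv (mem_chart_source ℂ x₀), hρ0]
      rfl
    · filter_upwards [eventually_deriv_ne_zero_of_normalForm hj hu hu0 hfu,
        eventually_analyticAt_of_normalForm hu hfu, (tendsto_chart_symm x₀).eventually hρs,
        (tendsto_chart_symm x₀).eventually (hs.eventually_ne_zero x₀),
        nhdsWithin_le_nhds (eventually_mem_chart_target x₀), self_mem_nhdsWithin]
        with z h1 h2 h3 h4 h5 hne
      refine ⟨h1, ?_⟩
      set x := (chartAt ℂ x₀).symm z
      have hxs : x ∈ (chartAt ℂ x₀).source := (chartAt ℂ x₀).map_target h5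
      have hxz : chartAt ℂ x₀ x = z := (chartAt ℂ x₀).right_inv h5
      have hcoord : coord x₀ x = z - chartAt ℂ x₀ x₀ := coord_chart_symm h5
      have hz0 : z - chartAt ℂ x₀ x₀ ≠ 0 := sub_ne_zero.2 hne
      have hfx : HolFunAt f x := holFunAt_of_analyticAt_chart hxs (by rw [hxz]; exact h2)
      have hdf : ∀ ξ, mvfderiv 𝓘(ℂ, ℂ) f x ξ =
          dcoord x₀ x ξ * deriv (fun z => f ((chartAt ℂ x₀).symm z)) z := fun ξ => by
        rw [mvfderiv_eq_chartDeriv hxs hfx.mdifferentiableAt, chartDeriv, hxz]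
      have hP : P x ((n x₀ + ρ x) / ((z - chartAt ℂ x₀ x₀) *
          deriv (fun z => f ((chartAt ℂ x₀).symm z)) z)) := by
        intro ξ
        have h6 := congrArg (fun t => (z - chartAt ℂ x₀ x₀)⁻¹ • t) (h3 ξ)
        simp only [hcoord, smul_smul, inv_mul_cancel₀ hz0, one_smul] at h6
        rw [h6, hdf]
        congr 1
        field_simp
      have hPh : P x (h x) := Classical.epsilon_spec ⟨_, hP⟩
      obtain ⟨ξ, hξ⟩ := exists_dcoord_eq_one hxs
      have h7 := smul_left_injective ℂ h4 ((hPh ξ).symm.trans (hP ξ))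
      rw [hdf, hξ, one_mul] at h7
      exact mul_right_cancel₀ h1 h7
  have hres := sum_residues_eq_zero (f := f) (h := h) (c := c) hf ?_ ?_
  · have h1 : c.sum (fun _ a => a) = ∑ x ∈ S, ((n x : ℂ) + ((R x / 2 : ℝ) : ℂ)) :=
      Finsupp.onFinset_sum _ fun _ => rfl
    have h2 : m.sum (fun _ k => k) = ∑ x ∈ S, n x :=
      Finsupp.sum_of_support_subset _ Finset.subset_union_left _ fun _ _ => rfl
    have h3 : B.weight.sum (fun P a => if N P = B.W P then a else -a) = ∑ x ∈ S, R x :=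
      Finsupp.sum_of_support_subset _ Finset.subset_union_right _ fun _ _ => by simp
    rw [h1] at hres
    rw [SpecialParabolic.parDegree, h2, h3]
    -- The sum of the residues is the degree plus half the signed weights, that is, the parabolic
    -- degree.
    have h4 : ((∑ x ∈ S, ((n x : ℝ) + R x / 2) : ℝ) : ℂ) = 0 := by
      rw [← hres]; push_cast; rfl
    have h5 : ∑ x ∈ S, ((n x : ℝ) + R x / 2) = 0 := by exact_mod_cast h4
    rw [← h5, Finset.sum_add_distrib, Finset.mul_sum]
    push_cast
    congr 1
    exact Finset.sum_congr rfl fun _ _ => by ring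
  · intro x₀
    obtain ⟨ρ, hρ, -, hh⟩ := hloc x₀
    obtain ⟨a, j, u, hj, hu, hu0, hfu⟩ := hf x₀
    filter_upwards [eventually_eventually_nhdsWithin.2 hh,
      eventually_analyticAt_of_normalForm hu hfu, nhdsWithin_le_nhds hρ.eventually_analyticAt,
      self_mem_nhdsWithin] with z h1 h2 h3 hne
    rw [(isOpen_compl_singleton.nhdsWithin_eq hne : 𝓝[{chartAt ℂ x₀ x₀}ᶜ] z = 𝓝 z)] at h1
    have hz0 : z - chartAt ℂ x₀ x₀ ≠ 0 := sub_ne_zero.2 hne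
    refine DifferentiableAt.congr_of_eventuallyEq ?_ (h1.mono fun _ h => h.2)
    exact h3.differentiableAt.fun_div
      ((differentiableAt_id.sub_const _).fun_mul h2.deriv.differentiableAt)
      (mul_ne_zero hz0 h1.self_of_nhds.1)
  · intro x₀
    obtain ⟨ρ, hρ, hρ0, hh⟩ := hloc x₀
    rw [← hρ0]
    refine (hρ.continuousAt.tendsto.mono_left nhdsWithin_le_nhds).congr' ?_
    filter_upwards [hh, self_mem_nhdsWithin] with z h1 hne
    have hz0 : z - chartAt ℂ x₀ x₀ ≠ 0 := sub_ne_zero.2 hne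
    rw [h1.2]
    have := h1.1
    field_simp

end InvariantSubbundle

end CMCOne

namespace CMCOne

/-! ### Planes with `v ∧ w = 0` -/

section DegeneratePlanes

variable {Y : Type*} [TopologicalSpace Y] [T2Space Y] [ChartedSpace ℂ Y] [IsManifold 𝓘(ℂ, ℂ) ω Y]
  {E : Y → Type*} [∀ x, AddCommGroup (E x)] [∀ x, Module ℂ (E x)]
  [∀ x, TopologicalSpace (E x)] [∀ x, IsTopologicalAddGroup (E x)]
  [∀ x, ContinuousSMul ℂ (E x)] [TopologicalSpace (TotalSpace (Fin 2 → ℂ) E)]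
  [FiberBundle (Fin 2 → ℂ) E] [VectorBundle ℂ (Fin 2 → ℂ) E]
  [ContMDiffVectorBundle ω (Fin 2 → ℂ) E 𝓘(ℂ, ℂ)]
  {L : Y → Type*} [∀ x, AddCommGroup (L x)] [∀ x, Module ℂ (L x)]
  [∀ x, TopologicalSpace (L x)] [TopologicalSpace (TotalSpace ℂ L)]
  [FiberBundle ℂ L] [VectorBundle ℂ ℂ L] [ContMDiffVectorBundle ω ℂ L 𝓘(ℂ, ℂ)]
  {B : SpecialParabolic E}

lemma HolFunAt.exists_eq_pow_mul {g : Y → ℂ} {x₀ : Y} (hg : HolFunAt g x₀)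
    (h0 : ∀ᶠ x in 𝓝[≠] x₀, g x ≠ 0) : ∃ (k : ℕ) (u : Y → ℂ), HolFunAt u x₀ ∧ u x₀ ≠ 0 ∧
      ∀ᶠ x in 𝓝 x₀, g x = coord x₀ x ^ k * u x := by
  have h1 : ¬∀ᶠ z in 𝓝 (chartAt ℂ x₀ x₀), g ((chartAt ℂ x₀).symm z) = 0 := by
    intro h
    obtain ⟨x, hx, hx'⟩ :=
      (h0.and (nhdsWithin_le_nhds (eventually_of_chart (p := fun x => g x = 0) h))).exists
    exact hx hx'
  obtain ⟨k, u, hu, hu0, h⟩ :=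
    (holFunAt_iff.1 hg).exists_eventuallyEq_pow_smul_nonzero_iff.2 h1
  refine ⟨k, fun x => u (chartAt ℂ x₀ x), holFunAt_of_chart hu, hu0, ?_⟩
  filter_upwards [(tendsto_chart_nhds x₀).eventually h, eventually_mem_chart_source x₀]
    with x hx hxs
  rwa [(chartAt ℂ x₀).left_inv hxs] at hx

variable [PreconnectedSpace Y]

lemma exists_contract_eq_pow_smul {v : HEL L E} (hv : v ≠ 0) (x₀ : Y) :
    ∃ (m : ℕ) (e : ∀ x, E x), HolAt (Fin 2 → ℂ) e x₀ ∧ e x₀ ≠ 0 ∧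
      ∀ᶠ x in 𝓝 x₀, contract L E x₀ x (v.1 x) = coord x₀ x ^ m • e x := by
  refine (holAt_contract v x₀).exists_eq_pow_smul fun h => ?_
  obtain ⟨x, h1, h2, h3⟩ := ((eventually_HEL_ne_zero hv x₀).and (nhdsWithin_le_nhds
    (h.and (eventually_mem_baseSet (F := ℂ) (V := L) x₀)))).exists
  exact h1 ((contract_eq_zero_iff h3 _).1 h2)

lemma exists_isMeromorphicSection_divSection {v : HEL L E} (hv : v ≠ 0)
    {σ : Cₛ^ω⟮𝓘(ℂ, ℂ); ℂ, L⟯} (hσ : σ ≠ 0) :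
    ∃ e n, IsMeromorphicSection (divSection v.1 σ) e n := by
  have hloc : ∀ x₀, ∃ (e : ∀ x, E x) (n : ℤ), HolAt (Fin 2 → ℂ) e x₀ ∧ e x₀ ≠ 0 ∧
      ∀ᶠ x in 𝓝[≠] x₀, divSection v.1 σ x = coord x₀ x ^ n • e x := by
    intro x₀
    obtain ⟨m, e, he, he0, hm⟩ := exists_contract_eq_pow_smul hv x₀
    have hg := holFunAt_fiberCoord σ x₀
    have hg0 : ∀ᶠ x in 𝓝[≠] x₀, fiberCoord L x₀ x (σ x) ≠ 0 := by
      filter_upwards [eventually_section_ne_zero hσ x₀,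
        nhdsWithin_le_nhds (eventually_mem_baseSet (F := ℂ) (V := L) x₀)] with x h1 h2
      exact (fiberCoord_eq_zero_iff h2 _).not.2 h1
    obtain ⟨k, u, hu, hu0, hk⟩ := hg.exists_eq_pow_mul hg0
    -- The order of `v/σ` is that of `v` minus that of `σ`.
    refine ⟨fun x => (u x)⁻¹ • e x, m - k, he.smul (hu.inv hu0),
      smul_ne_zero (inv_ne_zero hu0) he0, ?_⟩
    filter_upwards [nhdsWithin_le_nhds hm, nhdsWithin_le_nhds hk,
      eventually_section_ne_zero hσ x₀, eventually_coord_ne_zero x₀,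
      nhdsWithin_le_nhds (eventually_mem_baseSet (F := ℂ) (V := L) x₀)] with x h1 h2 h3 h4 h5
    rw [divSection_eq h5 v.1 h3, h1, h2, smul_smul, smul_smul, zpow_sub₀ h4, zpow_natCast,
      zpow_natCast, mul_inv]
    congr 1
    ring
  choose e n h1 h2 h3 using hloc
  exact ⟨e, n, h1, h2, h3⟩

/-- If `v ∧ w = 0` then `w / v` is a nonconstant meromorphic function. -/
lemma exists_quotient_normalForm {v w : HEL L E} (hli : LinearIndependent ℂ ![v, w])
    {σ : Cₛ^ω⟮𝓘(ℂ, ℂ); ℂ, L⟯} (hσ : σ ≠ 0)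
    (hvw : ∀ x, wedgeMap B x (v.1 x) (w.1 x) = 0) : ∃ f : Y → ℂ,
      (∀ x₀, ∀ᶠ x in 𝓝[≠] x₀, divSection w.1 σ x = f x • divSection v.1 σ x) ∧
      ∀ x₀, ∃ (a : ℂ) (j : ℤ) (u : ℂ → ℂ), j ≠ 0 ∧ AnalyticAt ℂ u (chartAt ℂ x₀ x₀) ∧
        u (chartAt ℂ x₀ x₀) ≠ 0 ∧ ∀ᶠ z in 𝓝[≠] (chartAt ℂ x₀ x₀),
          f ((chartAt ℂ x₀).symm z) = a + (z - chartAt ℂ x₀ x₀) ^ j * u z := by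
  have hv : v ≠ 0 := hli.ne_zero 0
  have hli' := LinearIndependent.pair_iff.1 hli
  set f : Y → ℂ := fun x =>
    Classical.epsilon fun c => divSection w.1 σ x = c • divSection v.1 σ x
  have hloc : ∀ x₀, ∃ (m : ℕ) (G : Y → ℂ), HolFunAt G x₀ ∧ ∀ᶠ x in 𝓝[≠] x₀,
      divSection w.1 σ x = f x • divSection v.1 σ x ∧ f x = (coord x₀ x ^ m)⁻¹ * G x := by
    intro x₀
    obtain ⟨m, e, he, he0, hm⟩ := exists_contract_eq_pow_smul hv x₀
    obtain ⟨b, hb⟩ := exists_vol_ne_zero (B := B) he0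
    obtain ⟨β, hβ, rfl⟩ := exists_holAt_apply_eq (F := Fin 2 → ℂ) x₀ b
    have hden := B.vol_hol e β x₀ he hβ
    have hnum := B.vol_hol _ β x₀ (holAt_contract w x₀) hβ
    refine ⟨m, _, hnum.div hden hb, ?_⟩
    filter_upwards [nhdsWithin_le_nhds hm, nhdsWithin_le_nhds (he.eventually_ne_zero he0),
      nhdsWithin_le_nhds (hden.continuousAt.eventually_ne hb),
      eventually_section_ne_zero hσ x₀, eventually_coord_ne_zero x₀,
      nhdsWithin_le_nhds (eventually_mem_baseSet (F := ℂ) (V := L) x₀)] with x h1 h2 h3 h4 h5 h6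
    have hV : contract L E x₀ x (v.1 x) ≠ 0 := by
      rw [h1]; exact smul_ne_zero (pow_ne_zero _ h5) h2
    obtain ⟨c, hc⟩ := exists_eq_smul_of_vol_eq_zero (B := B) hV
      (b := contract L E x₀ x (w.1 x)) (by rw [← fiberCoordSq_wedgeMap, hvw, map_zero])
    have hg0 := (fiberCoord_eq_zero_iff h6 (σ x)).not.2 h4
    have hex : divSection w.1 σ x = c • divSection v.1 σ x := by
      rw [divSection_eq h6 _ h4, divSection_eq h6 _ h4, hc, smul_comm]
    have hfx : divSection w.1 σ x = f x • divSection v.1 σ x := 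
      Classical.epsilon_spec (p := fun c => divSection w.1 σ x = c • divSection v.1 σ x) ⟨c, hex⟩
    have hd0 : divSection v.1 σ x ≠ 0 := by
      rw [divSection_eq h6 _ h4]
      exact smul_ne_zero (inv_ne_zero hg0) hV
    refine ⟨hfx, ?_⟩
    rw [smul_left_injective ℂ hd0 (hfx.symm.trans hex), hc, h1]
    simp only [map_smul, LinearMap.smul_apply, smul_eq_mul]
    field_simp
  refine ⟨f, fun x₀ => ?_, fun x₀ => ?_⟩
  · obtain ⟨m, G, -, h⟩ := hloc x₀
    exact h.mono fun x hx => hx.1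
  · obtain ⟨m, G, hG, h⟩ := hloc x₀
    refine exists_normalForm ?_ fun a ha => ?_
    · have h1 : MeromorphicAt (fun z => ((z - chartAt ℂ x₀ x₀) ^ m)⁻¹ *
          G ((chartAt ℂ x₀).symm z)) (chartAt ℂ x₀ x₀) :=
        (((analyticAt_id.sub analyticAt_const).pow m).meromorphicAt.inv).mul
          (holFunAt_iff.1 hG).meromorphicAt
      refine h1.congr ?_
      filter_upwards [(tendsto_chart_symm x₀).eventually h,
        nhdsWithin_le_nhds (eventually_mem_chart_target x₀)] with z h2 h3
      rw [h2.2, coord_chart_symm h3]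
    -- If `f` were equal to `a` near a point, `w - a v` would vanish there and hence everywhere,
    -- against independence.
    · have hne : w + (-a) • v ≠ 0 := fun h0 => by
        have := hli' (-a) 1 (by rw [one_smul, add_comm]; exact h0)
        exact one_ne_zero this.2
      obtain ⟨x, h1, h2, h3, h4⟩ := ((eventually_HEL_ne_zero hne x₀).and (h.and
        ((eventually_ne_of_chart (p := fun x => f x = a) ha).and
          (eventually_section_ne_zero hσ x₀)))).exists
      refine h1 ?_
      have h5 : w.1 x = a • v.1 x := by
        rw [eq_divSection_tmul w.1 h4, eq_divSection_tmul v.1 h4, h2.1, h3,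
          TensorProduct.smul_tmul']
      change w.1 x + (-a) • v.1 x = 0
      rw [h5, neg_smul, add_neg_cancel]

/-- A plane `span (v, w)` with `v ∧ w = 0` and `∇(v/σ) ∧ ∇(w/σ) = 0` yields a line subbundle of
parabolic degree zero. -/
theorem exists_parDegree_eq_zero_of_wedge_eq_zero [CompactSpace Y]
    {nabla : (∀ x, E x) → ∀ x, TangentSpace 𝓘(ℂ, ℂ) x →L[ℂ] E x} (hn : B.IsAssociated nabla)
    {v w : HEL L E} (hli : LinearIndependent ℂ ![v, w])
    {σ : Cₛ^ω⟮𝓘(ℂ, ℂ); ℂ, L⟯} (hσ : σ ≠ 0)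
    (hvw : ∀ x, wedgeMap B x (v.1 x) (w.1 x) = 0)
    (hθ : ∀ x ∉ B.weight.support, σ x ≠ 0 → ∀ ξ ξ', theta B nabla σ v.1 w.1 x ξ ξ' = 0) :
    ∃ (N : ∀ x, Submodule ℂ (E x)) (d : ℤ), IsLineSubbundle N ∧ HasDegree N d ∧
      B.parDegree N d = 0 := by
  have hv : v ≠ 0 := hli.ne_zero 0
  obtain ⟨f, hfs, hf⟩ := exists_quotient_normalForm hli hσ hvw
  obtain ⟨e, n, hs⟩ := exists_isMeromorphicSection_divSection hv hσ
  refine exists_parDegree_eq_zero hn hs (fun x₀ => ?_) hf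
  obtain ⟨a, j, u, hj, hu, hu0, hfu⟩ := hf x₀
  have hfan := eventually_ne_of_chart (x := x₀)
    (p := fun x => AnalyticAt ℂ (fun z => f ((chartAt ℂ x₀).symm z)) (chartAt ℂ x₀ x)) (by
      filter_upwards [eventually_analyticAt_of_normalForm hu hfu,
        nhdsWithin_le_nhds (eventually_mem_chart_target x₀)] with z h1 h2
      rwa [(chartAt ℂ x₀).right_inv h2])
  have hfd := eventually_ne_of_chart (x := x₀) (p := fun x => chartDeriv x₀ f x ≠ 0) (by
      filter_upwards [eventually_deriv_ne_zero_of_normalForm hj hu hu0 hfu,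
        nhdsWithin_le_nhds (eventually_mem_chart_target x₀)] with z h1 h2
      rwa [chartDeriv, (chartAt ℂ x₀).right_inv h2])
  filter_upwards [hfan, hfd, eventually_nhds_of_nhdsNE (hfs x₀), hs.eventually_holAt x₀,
    eventually_section_ne_zero hσ x₀, eventually_notMem_support (B := B) x₀,
    nhdsWithin_le_nhds (eventually_mem_chart_source x₀)] with x h1 h2 h3 h4 h5 h6 h7 ξ
  have hfx : HolFunAt f x := holFunAt_of_analyticAt_chart h7 h1
  have hws : HolAt (Fin 2 → ℂ) (divSection w.1 σ) x := (h4.smul hfx).congr h3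
  obtain ⟨ξ', hξ'⟩ := exists_dcoord_eq_one h7
  have h8 := hθ x h6 h5 ξ ξ'
  -- With `s = v/σ` this expands `∇s ∧ ∇(f s) = f ∇s ∧ ∇s + df (∇s ∧ s)`. The first term is zero on
  -- a curve and `df` is not, so `∇s ∧ s = 0`.
  rw [theta, smul_eq_zero, tmul_self_eq_zero_iff, or_iff_left h5,
    nabla_congr hn h6 hws (h4.smul hfx) h3, nabla_smul hn h6 hfx h4,
    mvfderiv_eq_chartDeriv h7 hfx.mdifferentiableAt, hξ', one_mul, map_add, map_smul,
    map_smul] at h8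
  have h9 : B.vol x (nabla (divSection v.1 σ) x ξ) (nabla (divSection v.1 σ) x ξ') = 0 := by
    have := vol_apply_comm (B := B) (x := x) (nabla (divSection v.1 σ) x)
      (nabla (divSection v.1 σ) x) ξ ξ'
    linear_combination this / 2
  rw [h9, smul_zero, zero_add, smul_eq_zero] at h8
  exact h8.resolve_left h2

end DegeneratePlanes

end CMCOne

namespace CMCOne

/-! ### Biregular maps from polynomial lifts -/

section Lifts

variable {A A' X X' : Type*} [AddCommGroup A] [Module ℂ A] [AddCommGroup A'] [Module ℂ A']
  {U : Set A} {U' : Set A'}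

/-- A bijection that lifts in both directions to polynomial maps is biregular. In the second
direction the lift need only exist over `Z'`, provided that the fibres of `pr'` are the orbits of a
family `g` of polynomial maps. -/
lemma isBiregular_of_lifts {pr : U → X} {pr' : U' → X'} {Z : Set X} {Z' : Set X'} (e : Z ≃ Z')
    {φ : A → A'} {ψ : A' → A} (hφ : ∀ p ∈ polyFun A', (fun a => p (φ a)) ∈ polyFun A)
    (hψ : ∀ p ∈ polyFun A, (fun a => p (ψ a)) ∈ polyFun A')
    {Φ : X → X'} (hφΦ : ∀ u : U, ∃ hu : φ u ∈ U', pr' ⟨φ u, hu⟩ = Φ (pr u))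
    (he : ∀ z, (e z).1 = Φ z.1)
    (hψe : ∀ (u : U') (h : pr' u ∈ Z'), ∃ hu : ψ u ∈ U, pr ⟨ψ u, hu⟩ = (e.symm ⟨pr' u, h⟩).1)
    {ι : Type*} {g : ι → A' → A'} (hg : ∀ i, ∀ p ∈ polyFun A', (fun a => p (g i a)) ∈ polyFun A')
    (hg1 : ∀ i (u : U'), ∃ hu : g i u ∈ U', pr' ⟨g i u, hu⟩ = pr' u)
    (hg2 : ∀ u u' : U', pr' u = pr' u' → ∃ i, u'.1 = g i u)
    (hsurj : ∀ z ∈ Z', ∃ u, pr' u = z) : IsBiregular pr pr' e where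
  isOpen_iff := by
    intro O
    rw [isOpen_zariskiSub_iff, isOpen_zariskiSub_iff]
    constructor
    · rintro ⟨O', hO', hOO'⟩
      obtain ⟨V, hV, hVO⟩ := isOpen_zariskiQuot_iff.1 hO'
      refine ⟨Φ ⁻¹' O', isOpen_zariskiQuot_iff.2
        ⟨φ ⁻¹' V, isOpen_zariski_preimage hφ hV, fun u => ?_⟩, fun z => ?_⟩
      · obtain ⟨hu, h⟩ := hφΦ u
        rw [Set.mem_preimage, ← h, hVO]
        rfl
      · rw [Set.mem_preimage, hOO', he, Set.mem_preimage]
    · rintro ⟨O', hO', hOO'⟩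
      obtain ⟨V, hV, hVO⟩ := isOpen_zariskiQuot_iff.1 hO'
      -- Outside `Z'` the condition `ψ u ∈ V` may depend on the representative `u`. Saturating by
      -- the maps `g` gives a set that descends to the quotient and is still open.
      refine ⟨{x | ∃ u, pr' u = x ∧ ψ u.1 ∈ V}, isOpen_zariskiQuot_iff.2
        ⟨⋃ i, {a | ψ (g i a) ∈ V}, ?_, fun u => ?_⟩, fun z => ?_⟩
      · exact @isOpen_iUnion _ _ (zariskiSpace A') _ fun i =>
          isOpen_zariski_preimage (ψ := fun a => ψ (g i a)) (fun p hp => hg i _ (hψ p hp)) hV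
      · rw [Set.mem_iUnion]
        constructor
        · rintro ⟨u', h1, h2⟩
          obtain ⟨i, hi⟩ := hg2 u u' h1.symm
          exact ⟨i, by rw [Set.mem_ofPred_eq, ← hi]; exact h2⟩
        · rintro ⟨i, hi⟩
          obtain ⟨hu, h⟩ := hg1 i u
          exact ⟨_, h, hi⟩
      · have key : ∀ (u : U') (h : pr' u ∈ Z'), (⟨pr' u, h⟩ : Z') ∈ O ↔ ψ u.1 ∈ V := by
          intro u h
          obtain ⟨hu, hpr⟩ := hψe u h
          have h1 := hOO' (e.symm ⟨pr' u, h⟩)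
          rw [Set.mem_preimage, Equiv.apply_symm_apply, ← hpr, hVO] at h1
          exact h1
        obtain ⟨z, hz⟩ := z
        constructor
        · intro hzO
          obtain ⟨u, rfl⟩ := hsurj z hz
          exact ⟨u, rfl, (key u hz).1 hzO⟩
        · rintro ⟨u, rfl, hu⟩
          exact (key u hz).2 hu
  isRegularOn_iff := by
    intro O _ f
    constructor
    · intro h u₀ h₀ hO
      have lift : ∀ (u : U) (h : pr u ∈ Z), ∃ (hu : φ u ∈ U') (h' : pr' ⟨φ u, hu⟩ ∈ Z'),
          e ⟨pr u, h⟩ = ⟨pr' ⟨φ u, hu⟩, h'⟩ := fun u h => by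
        obtain ⟨hu, hpr⟩ := hφΦ u
        have h1 : (e ⟨pr u, h⟩).1 = pr' ⟨φ u, hu⟩ := by rw [he, hpr]
        exact ⟨hu, h1 ▸ (e ⟨pr u, h⟩).2, Subtype.ext h1⟩
      obtain ⟨hu, h', hl⟩ := lift u₀ h₀
      rw [Set.mem_preimage, hl] at hO
      obtain ⟨p, hp, q, hq, hq0, hpq⟩ := h ⟨φ u₀, hu⟩ h' hO
      refine ⟨_, hφ p hp, _, hφ q hq, hq0, fun u hu hO hqu => ?_⟩
      obtain ⟨hu', h', hl⟩ := lift u hu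
      rw [Set.mem_preimage, hl] at hO
      rw [Function.comp_apply, hl]
      exact hpq ⟨φ u, hu'⟩ h' hO hqu
    · intro h u₀ h₀ hO
      have lift : ∀ (u : U') (h : pr' u ∈ Z'), ∃ (hu : ψ u ∈ U) (h' : pr ⟨ψ u, hu⟩ ∈ Z),
          e ⟨pr ⟨ψ u, hu⟩, h'⟩ = ⟨pr' u, h⟩ := fun u h => by
        obtain ⟨hu, hpr⟩ := hψe u h
        have h' : pr ⟨ψ u, hu⟩ ∈ Z := hpr ▸ (e.symm ⟨pr' u, h⟩).2
        refine ⟨hu, h', ?_⟩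
        exact (Equiv.eq_symm_apply e).1 (Subtype.ext hpr)
      obtain ⟨hu, h', hl⟩ := lift u₀ h₀
      rw [← hl] at hO
      obtain ⟨p, hp, q, hq, hq0, hpq⟩ := h ⟨ψ u₀, hu⟩ h' hO
      refine ⟨_, hψ p hp, _, hψ q hq, hq0, fun u hu hO hqu => ?_⟩
      obtain ⟨hu', h', hl⟩ := lift u hu
      rw [← hl] at hO ⊢
      exact hpq ⟨ψ u, hu'⟩ h' hO hqu

end Lifts

/-! ### Bases of planes -/

section Planes

variable {V : Type*} [AddCommGroup V] [Module ℂ V]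

lemma linearIndependent_pair_iff_finrank {v w : V} :
    LinearIndependent ℂ ![v, w] ↔ Module.finrank ℂ (Submodule.span ℂ {v, w}) = 2 := by
  rw [linearIndependent_iff_card_eq_finrank_span, Set.finrank, Fintype.card_fin,
    Matrix.range_cons_cons_empty, eq_comm]

lemma exists_basis_of_finrank_eq_two {S : Submodule ℂ V} (h : Module.finrank ℂ S = 2) :
    ∃ v w : V, LinearIndependent ℂ ![v, w] ∧ S = Submodule.span ℂ {v, w} := by
  obtain ⟨e, e', r, r', -, hr, -⟩ := exists_coordinates_of_finrank_eq_two h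
  have hS : S = Submodule.span ℂ {e.1, e'.1} := by
    refine le_antisymm (fun v hv => ?_) ?_
    · rw [Submodule.mem_span_pair]
      exact ⟨_, _, (congrArg Subtype.val (hr ⟨v, hv⟩)).symm⟩
    · rw [Submodule.span_le]
      rintro _ (rfl | rfl)
      · exact e.2
      · exact e'.2
  exact ⟨e, e', linearIndependent_pair_iff_finrank.2 (hS ▸ h), hS⟩

lemma span_pair_eq_of_det_ne_zero (v w : V) {a b a' b' : ℂ} (hdet : a * b' - b * a' ≠ 0) :
    Submodule.span ℂ {a • v + b • w, a' • v + b' • w} = Submodule.span ℂ {v, w} := by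
  refine le_antisymm ?_ ?_ <;> rw [Submodule.span_le]
  · rintro _ (rfl | rfl) <;> exact Submodule.mem_span_pair.2 ⟨_, _, rfl⟩
  · rintro _ (rfl | rfl) <;> refine Submodule.mem_span_pair.2 ?_
    · refine ⟨(a * b' - b * a')⁻¹ * b', -((a * b' - b * a')⁻¹ * b), ?_⟩
      match_scalars <;> field_simp <;> ring
    · refine ⟨-((a * b' - b * a')⁻¹ * a'), (a * b' - b * a')⁻¹ * a, ?_⟩
      match_scalars <;> field_simp <;> ring

lemma det_ne_zero_of_linearIndependent_pair {v w : V} {a b a' b' : ℂ}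
    (h : LinearIndependent ℂ ![a • v + b • w, a' • v + b' • w]) : a * b' - b * a' ≠ 0 := by
  intro hdet
  rw [LinearIndependent.pair_iff] at h
  have h1 := h b' (-b) (by
    have : b' • (a • v + b • w) + -b • (a' • v + b' • w) = (a * b' - b * a') • v := by module
    rw [this, hdet, zero_smul])
  have h2 := h a' (-a) (by
    have : a' • (a • v + b • w) + -a • (a' • v + b' • w) = -(a * b' - b * a') • w := by module
    rw [this, hdet, neg_zero, zero_smul])
  have h3 := h 1 0 (by
    rw [neg_eq_zero.1 h2.2, neg_eq_zero.1 h1.2]; simp)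
  exact one_ne_zero h3.1

end Planes

end CMCOne

namespace CMCOne

/-! ### The zero locus of `Λ` and the `𝓑`-planes -/

section ZeroLocus

variable {Y : Type*} [TopologicalSpace Y] [T2Space Y] [ChartedSpace ℂ Y] [IsManifold 𝓘(ℂ, ℂ) ω Y]
  {E : Y → Type*} [∀ x, AddCommGroup (E x)] [∀ x, Module ℂ (E x)]
  [∀ x, TopologicalSpace (E x)] [∀ x, IsTopologicalAddGroup (E x)]
  [∀ x, ContinuousSMul ℂ (E x)] [TopologicalSpace (TotalSpace (Fin 2 → ℂ) E)]
  [FiberBundle (Fin 2 → ℂ) E] [VectorBundle ℂ (Fin 2 → ℂ) E]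
  [ContMDiffVectorBundle ω (Fin 2 → ℂ) E 𝓘(ℂ, ℂ)]
  {L : Y → Type*} [∀ x, AddCommGroup (L x)] [∀ x, Module ℂ (L x)]
  [∀ x, TopologicalSpace (L x)] [TopologicalSpace (TotalSpace ℂ L)]
  [FiberBundle ℂ L] [VectorBundle ℂ ℂ L] [ContMDiffVectorBundle ω ℂ L 𝓘(ℂ, ℂ)]
  {B : SpecialParabolic E}

lemma grMk_val (u : grFrames L E) :
    (grMk L E u).1 = Submodule.span ℂ {u.1.1, u.1.2} := by
  simp only [grMk, Matrix.range_cons_cons_empty]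

lemma exists_grMk_eq (S : Gr L E) : ∃ u, grMk L E u = S := by
  obtain ⟨v, w, hli, hS⟩ := exists_basis_of_finrank_eq_two S.2
  exact ⟨⟨(v, w), hli⟩, Subtype.ext ((grMk_val _).trans hS.symm)⟩

lemma exists_eq_combination_of_span_eq {v w v' w' : HEL L E}
    (h : Submodule.span ℂ {v', w'} = Submodule.span ℂ {v, w}) :
    ∃ a b a' b' : ℂ, v' = a • v + b • w ∧ w' = a' • v + b' • w := by
  have hv : v' ∈ Submodule.span ℂ {v, w} := h ▸ Submodule.subset_span (by simp)
  have hw : w' ∈ Submodule.span ℂ {v, w} := h ▸ Submodule.subset_span (by simp)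
  obtain ⟨a, b, hv⟩ := Submodule.mem_span_pair.1 hv
  obtain ⟨a', b', hw⟩ := Submodule.mem_span_pair.1 hw
  exact ⟨a, b, a', b', hv.symm, hw.symm⟩

lemma IsSpecialFrame.isSquareOf {v w : HEL L E} {σ : Cₛ^ω⟮𝓘(ℂ, ℂ); ℂ, L⟯}
    (h : IsSpecialFrame B v w σ) : IsSquareOf L (wedgeHLL B v w) σ := h.2

lemma IsSpecialFrame.wedgeHLL_ne_zero {v w : HEL L E} {σ : Cₛ^ω⟮𝓘(ℂ, ℂ); ℂ, L⟯}
    (h : IsSpecialFrame B v w σ) : wedgeHLL B v w ≠ 0 := h.isSquareOf.ne_zero.2 h.1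

/-- Every basis of a special plane is special, and the class of its wedge product depends only on
the plane. -/
lemma IsSpecialFrame.of_span_eq {v w v' w' : HEL L E} {σ : Cₛ^ω⟮𝓘(ℂ, ℂ); ℂ, L⟯}
    (h : IsSpecialFrame B v w σ)
    (hspan : Submodule.span ℂ {v', w'} = Submodule.span ℂ {v, w}) :
    ∃ (σ' : Cₛ^ω⟮𝓘(ℂ, ℂ); ℂ, L⟯) (h' : IsSpecialFrame B v' w' σ'),
      Projectivization.mk ℂ (wedgeHLL B v' w') h'.wedgeHLL_ne_zero =
        Projectivization.mk ℂ (wedgeHLL B v w) h.wedgeHLL_ne_zero := by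
  obtain ⟨a, b, a', b', hv, hw⟩ := exists_eq_combination_of_span_eq hspan
  obtain ⟨c, d, c', d', hv', hw'⟩ := exists_eq_combination_of_span_eq hspan.symm
  have h1 : wedgeHLL B v' w' = (a * b' - b * a') • wedgeHLL B v w := by
    rw [hv, hw, wedgeHLL_add_smul]
  have h2 : wedgeHLL B v w = (c * d' - d * c') • wedgeHLL B v' w' := by
    conv_lhs => rw [hv', hw', wedgeHLL_add_smul]
  have hdet : a * b' - b * a' ≠ 0 := by
    intro h0
    rw [h0, zero_smul] at h1
    rw [h1, smul_zero] at h2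
    exact h.wedgeHLL_ne_zero h2
  -- A change of basis multiplies `v ∧ w` by the determinant, so a square root of it rescales `σ`.
  obtain ⟨κ, hκ⟩ := IsAlgClosed.exists_eq_mul_self (a * b' - b * a')
  have hκ0 : κ ≠ 0 := by
    rintro rfl
    exact hdet (by rw [hκ, mul_zero])
  have h' : IsSpecialFrame B v' w' (κ • σ) := by
    refine ⟨smul_ne_zero hκ0 h.1, fun x => ?_⟩
    have h3 : wedge B x (v'.1 x) (w'.1 x) = (a * b' - b * a') • wedge B x (v.1 x) (w.1 x) :=
      congrArg (fun τ : HLL L => τ.1 x) h1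
    rw [h3, h.2, hκ, ← TensorProduct.smul_tmul_smul]
    rfl
  refine ⟨_, h', ?_⟩
  rw [Projectivization.mk_eq_mk_iff']
  exact ⟨_, h1.symm⟩

lemma mem_upsilonRho_iff {t : Gr L E × Q L} : t ∈ upsilonRho L B ↔
    ∃ (v w : HEL L E) (σ : Cₛ^ω⟮𝓘(ℂ, ℂ); ℂ, L⟯) (h : IsSpecialFrame B v w σ),
      t.1.1 = Submodule.span ℂ {v, w} ∧
      t.2.1 = Projectivization.mk ℂ (wedgeHLL B v w) h.wedgeHLL_ne_zero := by
  constructor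
  · rintro ⟨v, w, σ, h, hspan, τ, hτ, hsq, ht⟩
    refine ⟨v, w, σ, h, hspan, ?_⟩
    have h1 : τ = wedgeHLL B v w :=
      Subtype.ext (funext fun x => (hsq x).trans (h.isSquareOf x).symm)
    subst h1
    exact ht
  · rintro ⟨v, w, σ, h, hspan, ht⟩
    exact ⟨v, w, σ, h, hspan, _, h.wedgeHLL_ne_zero, h.isSquareOf, ht⟩

/-- `ϱ` is a well defined map on special planes. -/
lemma eq_of_mem_upsilonRho {t t' : Gr L E × Q L} (ht : t ∈ upsilonRho L B)
    (ht' : t' ∈ upsilonRho L B) (h : t.1 = t'.1) : t = t' := by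
  obtain ⟨v, w, σ, hs, h1, h2⟩ := mem_upsilonRho_iff.1 ht
  obtain ⟨v', w', σ', hs', h1', h2'⟩ := mem_upsilonRho_iff.1 ht'
  have hspan : Submodule.span ℂ {v', w'} = Submodule.span ℂ {v, w} := by
    rw [← h1, ← h1', h]
  obtain ⟨σ'', hs'', h3⟩ := hs.of_span_eq hspan
  exact Prod.ext h (Subtype.ext (h2.trans (h3.symm.trans h2'.symm)))

variable {nabla : (∀ x, E x) → ∀ x, TangentSpace 𝓘(ℂ, ℂ) x →L[ℂ] E x}

section

variable [PreconnectedSpace Y] (hn : B.IsAssociated nabla) {Λ : BundleMap L B}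
  (hΛ : IsLambda B nabla Λ)

include hn hΛ

set_option maxHeartbeats 1000000 in
-- The exterior square of the plane is a line spanned by `v ∧ w`, so vanishing may be tested on one
-- basis and one `σ`.
lemma lambda_eq_zero_iff (t : upsilon L B) {v w : HEL L E}
    (hspan : t.1.1.1 = Submodule.span ℂ {v, w}) {σ : Cₛ^ω⟮𝓘(ℂ, ℂ); ℂ, L⟯} {τ : HLL L}
    (hτ : τ ≠ 0) (hsq : IsSquareOf L τ σ) (htτ : t.1.2.1 = Projectivization.mk ℂ τ hτ) :
    Λ t = 0 ↔
      ∀ x ∉ B.weight.support, σ x ≠ 0 → ∀ ξ ξ', theta B nabla σ v.1 w.1 x ξ ξ' = 0 := by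
  have hv : v ∈ t.1.1.1 := hspan ▸ Submodule.subset_span (by simp)
  have hw : w ∈ t.1.1.1 := hspan ▸ Submodule.subset_span (by simp)
  have hcomb : ∀ u ∈ t.1.1.1, ∃ a b : ℂ, a • v + b • w = u := fun u hu => by
    rw [hspan] at hu
    exact Submodule.mem_span_pair.1 hu
  constructor
  · intro h x hx hσx ξ ξ'
    refine (hΛ t ⟨v, hv⟩ ⟨w, hw⟩ σ τ hτ hsq htτ x hx hσx ξ ξ').symm.trans ?_
    rw [h]
    rfl
  · intro h
    refine exteriorSquare_linearMap_ext fun v' w' =>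
      HW_ext (hsq.ne_zero.1 hτ) fun x hx hσx ξ ξ' => ?_
    rw [hΛ t v' w' σ τ hτ hsq htτ x hx hσx ξ ξ']
    obtain ⟨a, b, hab⟩ := hcomb v'.1 v'.2
    obtain ⟨a', b', hab'⟩ := hcomb w'.1 w'.2
    have h0 : theta B nabla σ v'.1.1 w'.1.1 x ξ ξ' = 0 := by
      rw [← hab, ← hab']
      refine (theta_add_smul hn hx hσx v w a b a' b' ξ ξ').trans ?_
      rw [h x hx hσx ξ ξ', smul_zero]
    exact h0

/-- Stability excludes zeros of `Λ` on the boundary. -/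
theorem zeroLocus_subset_upsilonRho [CompactSpace Y] (hB : B.IsStable) :
    zeroLocus Λ ⊆ upsilonRho L B := by
  rintro t ⟨ht, hΛt⟩
  obtain ⟨v, w, hli, hspan⟩ := exists_basis_of_finrank_eq_two t.1.2
  obtain ⟨σ, hσ, τ, hτ, hsq, htτ⟩ := t.2.2
  have hv : v ∈ t.1.1 := hspan ▸ Submodule.subset_span (by simp)
  have hw : w ∈ t.1.1 := hspan ▸ Submodule.subset_span (by simp)
  obtain ⟨c, hc⟩ := exists_wedgeHLL_eq_smul ht hv hw hτ htτ
  have hwedge : ∀ x, wedgeMap B x (v.1 x) (w.1 x) = c • (σ x ⊗ₜ[ℂ] σ x) := fun x => by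
    rw [← hsq x, ← wedgeHLL_apply, hc]; rfl
  -- If `c = 0`, the plane yields a line subbundle of parabolic degree zero, which stability
  -- forbids. If `c ≠ 0`, the plane is special with section `√c σ`.
  rcases eq_or_ne c 0 with rfl | hc0
  · obtain ⟨N, d, h1, h2, h3⟩ := exists_parDegree_eq_zero_of_wedge_eq_zero hn hli hσ
      (fun x => by rw [hwedge, zero_smul])
      ((lambda_eq_zero_iff hn hΛ ⟨t, ht⟩ hspan hτ hsq htτ).1 hΛt)
    exact absurd h3 (hB N d h1 h2).ne
  · obtain ⟨κ, hκ⟩ := IsAlgClosed.exists_eq_mul_self c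
    have hκ0 : κ ≠ 0 := by
      rintro rfl
      exact hc0 (by rw [hκ, mul_zero])
    have hs : IsSpecialFrame B v w (κ • σ) := by
      refine ⟨smul_ne_zero hκ0 hσ, fun x => ?_⟩
      rw [wedge_eq, hwedge, hκ, ← TensorProduct.smul_tmul_smul]
      rfl
    refine mem_upsilonRho_iff.2 ⟨v, w, _, hs, hspan, ?_⟩
    rw [htτ, eq_comm, Projectivization.mk_eq_mk_iff']
    exact ⟨c, hc.symm⟩

lemma mem_zeroLocus_of_isSpecialFrame {v w : HEL L E} {σ : Cₛ^ω⟮𝓘(ℂ, ℂ); ℂ, L⟯}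
    (hs : IsSpecialFrame B v w σ)
    (hθ : ∀ x ∉ B.weight.support, σ x ≠ 0 → ∀ ξ ξ', theta B nabla σ v.1 w.1 x ξ ξ' = 0)
    {t : Gr L E × Q L} (h1 : t.1.1 = Submodule.span ℂ {v, w})
    (h2 : t.2.1 = Projectivization.mk ℂ (wedgeHLL B v w) hs.wedgeHLL_ne_zero) :
    t ∈ zeroLocus Λ := by
  have ht : t ∈ upsilon L B :=
    @subset_closure _ (zariskiQuot (totalMk L E)) _ _ (mem_upsilonRho_iff.2 ⟨v, w, σ, hs, h1, h2⟩)
  exact ⟨ht, (lambda_eq_zero_iff hn hΛ ⟨t, ht⟩ h1 hs.wedgeHLL_ne_zero hs.isSquareOf h2).2 hθ⟩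

/-- The zero locus lies in the graph of `ϱ`, hence the projection is injective; a `𝓑`-plane together
with its image under `ϱ` provides the preimage. -/
lemma exists_zeroLocus_equiv [CompactSpace Y] (hB : B.IsStable) :
    ∃ e : zeroLocus Λ ≃ bPlanes L B nabla, ∀ t, (e t).1 = t.1.1 := by
  have hsub := zeroLocus_subset_upsilonRho hn hΛ hB
  have hmem : ∀ t : zeroLocus Λ, t.1.1 ∈ bPlanes L B nabla := by
    rintro ⟨t, ht⟩
    obtain ⟨v, w, σ, hs, h1, h2⟩ := mem_upsilonRho_iff.1 (hsub ht)
    obtain ⟨ht', h0⟩ := ht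
    exact ⟨v, w, σ, hs, h1,
      (lambda_eq_zero_iff hn hΛ ⟨t, ht'⟩ h1 hs.wedgeHLL_ne_zero hs.isSquareOf h2).1 h0⟩
  refine ⟨Equiv.ofBijective (fun t => ⟨t.1.1, hmem t⟩) ⟨fun t t' h => ?_, fun S => ?_⟩,
    fun _ => rfl⟩
  · exact Subtype.ext (eq_of_mem_upsilonRho (hsub t.2) (hsub t'.2) (congrArg Subtype.val h))
  · obtain ⟨S, v, w, σ, hs, hS, hθ⟩ := S
    exact ⟨⟨(S, ⟨_, σ, hs.1, _, hs.wedgeHLL_ne_zero, hs.isSquareOf, rfl⟩),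
      mem_zeroLocus_of_isSpecialFrame hn hΛ hs hθ hS rfl⟩, rfl⟩

/-- On frames the projection forgets the square, and its inverse appends `v ∧ w`, a quadratic map.
Two frames of the same plane differ by an invertible matrix, acting linearly through `G`. -/
lemma isBiregular_zeroLocus_equiv [CompactSpace Y] (hB : B.IsStable)
    (e : zeroLocus Λ ≃ bPlanes L B nabla) (he : ∀ t, (e t).1 = t.1.1) :
    IsBiregular (totalMk L E) (grMk L E) e := by
  have hsub := zeroLocus_subset_upsilonRho hn hΛ hB
  set A := HEL L E × HEL L E
  let G : ℂ × ℂ × ℂ × ℂ → A →ₗ[ℂ] A := fun i =>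
    ((i.1 • LinearMap.fst ℂ (HEL L E) (HEL L E)) +
      i.2.1 • LinearMap.snd ℂ (HEL L E) (HEL L E)).prod
    ((i.2.2.1 • LinearMap.fst ℂ (HEL L E) (HEL L E)) +
      i.2.2.2 • LinearMap.snd ℂ (HEL L E) (HEL L E))
  let b : A →ₗ[ℂ] A →ₗ[ℂ] A × HLL L :=
    ((wedgeHLL B).compl₁₂ (LinearMap.fst ℂ _ _) (LinearMap.snd ℂ _ _)).compr₂
      (LinearMap.inr ℂ A (HLL L))
  have hG : ∀ i u, G i u = (i.1 • u.1 + i.2.1 • u.2, i.2.2.1 • u.1 + i.2.2.2 • u.2) :=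
    fun i u => rfl
  refine isBiregular_of_lifts (ι := {i : ℂ × ℂ × ℂ × ℂ // i.1 * i.2.2.2 - i.2.1 * i.2.2.1 ≠ 0})
    e (φ := Prod.fst) (ψ := fun u => (u, wedgeHLL B u.1 u.2)) (Φ := Prod.fst)
    (g := fun i u => G i.1 u) (fun p hp => comp_linear_mem_polyFun (LinearMap.fst ℂ A (HLL L)) hp)
    (fun p hp => ?_) (fun u => ⟨u.2.1, rfl⟩) he (fun u h => ?_)
    (fun i p hp => comp_linear_mem_polyFun (G i.1) hp) (fun i u => ?_) (fun u u' h => ?_)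
    (fun S _ => exists_grMk_eq S)
  · have h1 := comp_quadratic_mem_polyFun (LinearMap.inl ℂ A (HLL L)) b hp
    convert! h1 using 2 with u
    simp only [b, LinearMap.compr₂_apply, LinearMap.compl₁₂_apply, LinearMap.inl_apply,
      LinearMap.inr_apply, Prod.mk_add_mk, add_zero, zero_add]
    rfl
  · set t := e.symm ⟨grMk L E u, h⟩ with ht
    have ht1 : t.1.1 = grMk L E u := by rw [← he, ht, Equiv.apply_symm_apply]
    obtain ⟨v, w, σ, hs, h1, h2⟩ := mem_upsilonRho_iff.1 (hsub t.2)
    obtain ⟨σ', hs', h3⟩ := hs.of_span_eq (v' := u.1.1) (w' := u.1.2) (by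
      rw [← h1, ht1, grMk_val])
    refine ⟨⟨u.2, hs'.wedgeHLL_ne_zero, σ', hs'.1, hs'.isSquareOf⟩, ?_⟩
    exact Prod.ext ht1.symm (Subtype.ext (h3.trans h2.symm))
  · have hspan := span_pair_eq_of_det_ne_zero u.1.1 u.1.2 i.2
    have hu : G i.1 u.1 ∈ grFrames L E := by
      refine linearIndependent_pair_iff_finrank.2 ?_
      rw [hG, hspan]
      exact linearIndependent_pair_iff_finrank.1 u.2
    exact ⟨hu, Subtype.ext ((grMk_val _).trans (hspan.trans (grMk_val _).symm))⟩
  · have h1 := congrArg Subtype.val h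
    rw [grMk_val, grMk_val] at h1
    obtain ⟨a, b, a', b', hv, hw⟩ := exists_eq_combination_of_span_eq h1.symm
    refine ⟨⟨(a, b, a', b'), det_ne_zero_of_linearIndependent_pair (v := u.1.1) (w := u.1.2) ?_⟩,
      Prod.ext hv hw⟩
    rw [← hv, ← hw]
    exact u'.2

end

end ZeroLocus

end CMCOne

end

theorem mainTheorem8
    {Y : Type*} [TopologicalSpace Y] [T2Space Y] [CompactSpace Y] [ConnectedSpace Y]
    [ChartedSpace ℂ Y] [IsManifold 𝓘(ℂ, ℂ) ω Y]
    {E : Y → Type*} [∀ x, AddCommGroup (E x)] [∀ x, Module ℂ (E x)]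
    [∀ x, TopologicalSpace (E x)] [∀ x, IsTopologicalAddGroup (E x)]
    [∀ x, ContinuousSMul ℂ (E x)] [TopologicalSpace (TotalSpace (Fin 2 → ℂ) E)]
    [FiberBundle (Fin 2 → ℂ) E] [VectorBundle ℂ (Fin 2 → ℂ) E]
    [ContMDiffVectorBundle ω (Fin 2 → ℂ) E 𝓘(ℂ, ℂ)]
    {L : Y → Type*} [∀ x, AddCommGroup (L x)] [∀ x, Module ℂ (L x)]
    [∀ x, TopologicalSpace (L x)] [TopologicalSpace (TotalSpace ℂ L)]
    [FiberBundle ℂ L] [VectorBundle ℂ ℂ L] [ContMDiffVectorBundle ω ℂ L 𝓘(ℂ, ℂ)]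
    (B : CMCOne.SpecialParabolic E) (hB : B.IsStable)
    (nabla : (∀ x, E x) → ∀ x, TangentSpace 𝓘(ℂ, ℂ) x →L[ℂ] E x)
    (hnabla : B.IsAssociated nabla) :
    (∃! Λ : CMCOne.BundleMap L B, CMCOne.IsLambda B nabla Λ) ∧
    ∀ Λ : CMCOne.BundleMap L B, CMCOne.IsLambda B nabla Λ →
      CMCOne.zeroLocus Λ ∩ CMCOne.upsilonZero L B = ∅ ∧
      ∃ e : CMCOne.zeroLocus Λ ≃ CMCOne.bPlanes L B nabla,
        (∀ t, (e t).1 = t.1.1) ∧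
        CMCOne.IsBiregular (CMCOne.totalMk L E) (CMCOne.grMk L E) e := by
  refine ⟨CMCOne.existsUnique_isLambda hnabla, fun Λ hΛ => ⟨?_, ?_⟩⟩
  · rw [Set.eq_empty_iff_forall_notMem]
    rintro t ⟨ht, -, ht0⟩
    exact ht0 (CMCOne.zeroLocus_subset_upsilonRho hnabla hΛ hB ht)
  · obtain ⟨e, he⟩ := CMCOne.exists_zeroLocus_equiv hnabla hΛ hB
    exact ⟨e, he, CMCOne.isBiregular_zeroLocus_equiv hnabla hΛ hB e he⟩
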